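/- Let $C$ be an algebraically closed field of characteristic $0$, $\Lambda$ a commutative local $C$-algebra with $\dim_C\Lambda<\infty$, and $\vartheta=x\frac{d}{dx}$ on $C((x))$. For $s\ge 1$ let $x_s$ be a primitive $s$-th root of $x$ (so $x_s^s=x$), and extend $\vartheta$ to $C((x_s))$. A connection over $C((x))$ is a finite-dimensional $C((x))$-vector space $E$ with a $C$-linear map $\nabla:E\to E$ such that $\nabla(fe)=\vartheta(f)e+f\nabla(e)$; it extends to $E_{(s)}=C((x_s))\otimes_{C((x))}E$ by the same rule. It is *diagonalizable* if it is a direct sum of connections of rank one, *semisimple* if it becomes diagonalizable over some $C((x_s))$, and *regular singular* if it is isomorphic to $C((x))\otimes_{C[[x]]}\mathcal E$ for some finite $C[[x]]$-module $\mathcal E$ with a $C$-linear map satisfying the same Leibniz rule. A *Jordan–Levelt decomposition* is a decomposition $\nabla=S+N$ with $S$ a semisimple connection and $N$ a nilpotent $C((x))$-linear endomorphism commuting with $S$. The *Turrittin index* of $(E,\nabla)$ is the least $s\ge1$ such that $(E_{(s)},S)$ is diagonalizable, where $S$ is the semisimple part of $\nabla$. If $S$ is diagonalizable over $C((x))$,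 the *TLJ-decomposition* of $(E,\nabla)$ over $C((x))$ is $E=\bigoplus_\rho E_\rho$, where $E_\rho\neq0$ is the sum of the rank one subconnections of $(E,S)$ of type $\rho\in C((x))/\{u^{-1}\vartheta u:u\ne0\}$ (this group contains $C/\mathbb Z$). For a commutative ring $K$, $f\in K$ and $r\geq 0$, $J^\flat_r(f)$ denotes an $r\times r$ matrix with $f$ on the diagonal, entries in $\{0,1\}$ on the subdiagonal, and $0$ elsewhere. **Theorem.** Let $(E,\nabla)$ be a connection over $C((x))$ with a $C$-algebra homomorphism $\alpha:\Lambda\to\mathrm{End}(E,\nabla)$. Then the Turrittin index $s$ of $(E,\nabla)$ exists, and there is exactly one decomposition $\nabla=\nabla^{\rm rs}+P_\nabla$ with the following properties. (i) $(E,\nabla^{\rm rs})$ is a regular singular connection, and $\Lambda$ acts on it through $\alpha$, i.e. every $\alpha(\lambda)$ commutes with $\nabla^{\rm rs}$. (ii) $P_\nabla$ is $\Lambda((x))$-linear, and it is diagonalizable over $C((x_s))$ as a $C((x))$-linear endomorphism. (iii) $(E,\nabla^{\rm rs})$ admits a TLJ-decomposition $E=\bigoplus_{\rho\in\Sigma}E_\rho$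 over $C((x))$ with $\Sigma\subset C/\mathbb Z$ finite. For $\rho\in\Sigma$ let $F_\rho=\bigoplus E_{\rho'}$, the sum over all $\rho'\in\Sigma$ with $\rho'-\rho\in s^{-1}\mathbb Z/\mathbb Z$ (so $F_\rho=E_\rho$ if $s=1$). Then for each $\rho\in\Sigma$: (a) $P_\nabla(F_\rho)\subset F_\rho$; (b) there exist a $C((x_s))$-basis $\mathbf e_\rho$ of $C((x_s))\otimes_{C((x))}F_\rho$, $c_\rho\in C$ and $f_{\rho1},\dots,f_{\rho\ell}\in x_s^{-1}C[x_s^{-1}]$ such that $$\mathrm{Mat}(\nabla^{\rm rs}|_{F_\rho},\mathbf e_\rho)=\mathrm{diag}\big(J^\flat_{r_{\rho1}}(c_\rho),\dots,J^\flat_{r_{\rho\ell}}(c_\rho)\big),\qquad \mathrm{Mat}(\nabla|_{F_\rho},\mathbf e_\rho)=\mathrm{diag}\big(J^\flat_{r_{\rho1}}(c_\rho+f_{\rho1}),\dots,J^\flat_{r_{\rho\ell}}(c_\rho+f_{\rho\ell})\big),$$ with the same subdiagonal entries in both matrices (so the first matrix is a $J^\flat_{r_\rho}(c_\rho)$, and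 $P_\nabla$ is diagonal in the basis $\mathbf e_\rho$). -/

import Mathlib

open scoped TensorProduct PowerSeries LaurentSeries

universe u v w

noncomputable section

namespace LogDec

/-! ### Rings with an Euler derivation -/

/-- A commutative `C`-algebra with a distinguished `C`-linear derivation `ϑ`. -/
class Theta (C : Type*) (A : Type*) [CommRing C] [CommRing A] [Algebra C A] where
  theta : Derivation C A A

/-- The distinguished derivation `ϑ`. -/
abbrev ϑ (C : Type*) {A : Type*} [CommRing C] [CommRing A] [Algebra C A] [Theta C A] :
    Derivation C A A := Theta.theta

/-- The algebra map `A → B` commutes with `ϑ`. -/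
class ThetaAlgebra (C A B : Type*) [CommRing C] [CommRing A] [CommRing B] [Algebra C A]
    [Algebra C B] [Algebra A B] [Theta C A] [Theta C B] : Prop where
  theta_algebraMap : ∀ a : A, ϑ C (algebraMap A B a) = algebraMap A B (ϑ C a)

/-- The coefficientwise `C`-algebra structure on `C((x))`, singled out for instance search. -/
instance laurentAlgebra (C : Type u) [Field C] : Algebra C C⸨X⸩ := HahnSeries.instAlgebra

/-- `C((x))` is an algebra over `C⟦x⟧` compatibly with the structures over `C`. -/
instance (C : Type u) [Field C] : IsScalarTower C C⟦X⟧ C⸨X⸩ :=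
  IsScalarTower.of_algebraMap_eq fun c => by
    change HahnSeries.C c = ((PowerSeries.C c : C⟦X⟧) : C⸨X⸩)
    exact (PowerSeries.coe_C c).symm

section EulerDerivation

variable {C : Type u} [Field C]

/-- The operator `∑ aₙ Xⁿ ↦ ∑ (c n) aₙ Xⁿ` on Laurent series, as a linear map. -/
def eulerLin (c : C) : C⸨X⸩ →ₗ[C] C⸨X⸩ where
  toFun f :=
    { coeff := fun n => c * (n : C) * f.coeff n
      isPWO_support' := f.isPWO_support.mono fun n hn h0 => hn (by simp [h0]) }
  map_add' f g := by ext n; simp [mul_add]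
  map_smul' r f := by ext n; simp; ring

@[simp] theorem eulerLin_coeff (c : C) (f : C⸨X⸩) (n : ℤ) :
    (eulerLin c f).coeff n = c * (n : C) * f.coeff n := rfl

theorem eulerLin_support (c : C) (f : C⸨X⸩) : (eulerLin c f).support ⊆ f.support := by
  intro n hn h0
  exact hn (by simp [h0])

/-- The derivation `∑ aₙ Xⁿ ↦ ∑ (c n) aₙ Xⁿ`, that is `c X d/dX`, on Laurent series. -/
def eulerDer (c : C) : Derivation C C⸨X⸩ C⸨X⸩ :=
  Derivation.mk' (eulerLin c) fun f g => by
    ext n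
    rw [HahnSeries.coeff_add, smul_eq_mul, smul_eq_mul, eulerLin_coeff, HahnSeries.coeff_mul,
      HahnSeries.coeff_mul_right' g.isPWO_support (eulerLin_support c g),
      HahnSeries.coeff_mul_right' f.isPWO_support (eulerLin_support c f), Finset.mul_sum]
    have key : ∑ ij ∈ Finset.antidiagonal g.isPWO_support f.isPWO_support n,
          g.coeff ij.1 * (eulerLin c f).coeff ij.2
        = ∑ ij ∈ Finset.antidiagonal f.isPWO_support g.isPWO_support n,
          g.coeff ij.2 * (eulerLin c f).coeff ij.1 := by
      refine Finset.sum_nbij' Prod.swap Prod.swap ?_ ?_ ?_ ?_ ?_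
      · intro a ha
        simp only [Finset.mem_antidiagonal, Prod.fst_swap, Prod.snd_swap] at ha ⊢
        exact ⟨ha.2.1, ha.1, by rw [add_comm]; exact ha.2.2⟩
      · intro a ha
        simp only [Finset.mem_antidiagonal, Prod.fst_swap, Prod.snd_swap] at ha ⊢
        exact ⟨ha.2.1, ha.1, by rw [add_comm]; exact ha.2.2⟩
      · intro a _; simp
      · intro a _; simp
      · intro a _; simp
    rw [key, ← Finset.sum_add_distrib]
    refine Finset.sum_congr rfl fun ij hij => ?_
    have h : ij.1 + ij.2 = n := (Finset.mem_antidiagonal.1 hij).2.2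
    rw [eulerLin_coeff, eulerLin_coeff, ← h]
    push_cast
    ring

@[simp] theorem eulerDer_coeff (c : C) (f : C⸨X⸩) (n : ℤ) :
    (eulerDer c f).coeff n = c * (n : C) * f.coeff n := rfl

end EulerDerivation

/-- On `C⟦x⟧`, `ϑ = x d/dx`. -/
instance (C : Type u) [Field C] : Theta C C⟦X⟧ where
  theta := (PowerSeries.X : C⟦X⟧) • PowerSeries.derivative (R := C)

/-- On `C((x))`, `ϑ (∑ aₙ xⁿ) = ∑ n aₙ xⁿ`. -/
instance (C : Type u) [Field C] : Theta C C⸨X⸩ where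
  theta := eulerDer 1

instance (C : Type u) [Field C] : ThetaAlgebra C C⟦X⟧ C⸨X⸩ where
  theta_algebraMap f := by
    ext n
    have h : ∀ g : C⟦X⟧, algebraMap C⟦X⟧ C⸨X⸩ g = (g : C⸨X⸩) := fun _ => rfl
    change (eulerDer 1 (algebraMap C⟦X⟧ C⸨X⸩ f)).coeff n = _
    rw [h, h, eulerDer_coeff, PowerSeries.coeff_coe, PowerSeries.coeff_coe]
    split_ifs with hn
    · simp
    · obtain ⟨m, rfl⟩ := Int.eq_ofNat_of_zero_le (not_lt.1 hn)
      change _ = PowerSeries.coeff _ ((PowerSeries.X : C⟦X⟧) * PowerSeries.derivative (R := C) f)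
      cases m with
      | zero => simp
      | succ k =>
        simp only [Int.natAbs_natCast]
        rw [PowerSeries.coeff_succ_X_mul, PowerSeries.coeff_derivative]
        push_cast
        ring

/-! ### The ramified extension `C((x_s))` of `C((x))`, where `x_s ^ s = x` -/

/-- The field `C((x_s))` of Laurent series in a primitive `s`-th root `x_s` of `x`. -/
def Ram (C : Type u) [Field C] (_s : ℕ+) : Type u := C⸨X⸩

section Ram

variable (C : Type u) [Field C] (s : ℕ+)

instance : Field (Ram C s) := inferInstanceAs (Field C⸨X⸩)
instance : Algebra C (Ram C s) := inferInstanceAs (Algebra C C⸨X⸩)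

/-- The coefficient of `x_s ^ n`. -/
def Ram.coeff {C : Type u} [Field C] {s : ℕ+} (f : Ram C s) (n : ℤ) : C :=
  HahnSeries.coeff (show C⸨X⸩ from f) n

/-- The embedding `C((x)) → C((x_s))`, `x ↦ x_s ^ s`. -/
def ramEmb : C⸨X⸩ →ₐ[C] Ram C s :=
  (HahnSeries.embDomainAlgHom (A := C) (AddMonoidHom.mulLeft ((s : ℕ) : ℤ))
    (fun a b h => by
      have hs : ((s : ℕ) : ℤ) ≠ 0 := by exact_mod_cast s.ne_zero
      exact mul_left_cancel₀ hs h)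
    (fun a b => by
      have hs : (0 : ℤ) < ((s : ℕ) : ℤ) := by exact_mod_cast s.pos
      exact mul_le_mul_iff_right₀ hs) : C⸨X⸩ →ₐ[C] C⸨X⸩)

instance : Algebra C⸨X⸩ (Ram C s) := (ramEmb C s).toRingHom.toAlgebra

instance : IsScalarTower C C⸨X⸩ (Ram C s) :=
  IsScalarTower.of_algebraMap_eq fun c => ((ramEmb C s).commutes c).symm

/-- On `C((x_s))`, `ϑ = s⁻¹ x_s d/dx_s`. -/
instance : Theta C (Ram C s) where
  theta := (eulerDer ((s : ℕ) : C)⁻¹ : Derivation C C⸨X⸩ C⸨X⸩)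

instance [CharZero C] : ThetaAlgebra C C⸨X⸩ (Ram C s) where
  theta_algebraMap f := by
    have hs : ((s : ℕ) : C) ≠ 0 := by exact_mod_cast s.ne_zero
    refine HahnSeries.ext (Γ := ℤ) (R := C) (funext fun n => ?_)
    change ((s : ℕ) : C)⁻¹ * (n : C) * HahnSeries.coeff (ramEmb C s f : C⸨X⸩) n
      = HahnSeries.coeff (ramEmb C s (eulerDer 1 f) : C⸨X⸩) n
    by_cases hn : ∃ m : ℤ, ((s : ℕ) : ℤ) * m = n
    · obtain ⟨m, rfl⟩ := hn
      have h (g : C⸨X⸩) : HahnSeries.coeff (ramEmb C s g : C⸨X⸩) (((s : ℕ) : ℤ) * m)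
          = g.coeff m :=
        HahnSeries.embDomain_coeff (a := m)
      rw [h, h, eulerDer_coeff]
      push_cast
      field_simp
    · have h (g : C⸨X⸩) : HahnSeries.coeff (ramEmb C s g : C⸨X⸩) n = 0 :=
        HahnSeries.embDomain_of_notMem_range (by
          rintro ⟨m, hm⟩
          exact hn ⟨m, hm⟩)
      rw [h, h, mul_zero]

end Ram

/-! ### Connections -/

/-- A connection on an `A`-module `E`: a `C`-linear map `∇ : E → E` satisfying
`∇ (f e) = ϑ(f) e + f ∇ e`.  For finite modules over `C((x))` and `C((x_s))` these are the
objects of the categories of connections, for finite modules over `C⟦x⟧` the logarithmic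
connections. -/
structure Connection (C : Type*) (A : Type*) (E : Type*) [CommRing C] [CommRing A] [Algebra C A]
    [Theta C A] [AddCommGroup E] [Module C E] [Module A E] where
  toLin : E →ₗ[C] E
  leibniz : ∀ (f : A) (e : E), toLin (f • e) = ϑ C f • e + f • toLin e

namespace Connection

section Basic

variable {C A E : Type*} [CommRing C] [CommRing A] [Algebra C A] [Theta C A]
  [AddCommGroup E] [Module C E] [Module A E]

instance : CoeFun (Connection C A E) (fun _ => E → E) := ⟨fun D => D.toLin⟩

/-- The algebra of `A`-linear endomorphisms of `E` that commute with the connection, that is the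
endomorphism algebra of the object `(E, ∇)`. -/
def endAlgebra [IsScalarTower C A E] (D : Connection C A E) :
    Subalgebra C (Module.End A E) where
  carrier := {φ | ∀ e, D (φ e) = φ (D e)}
  mul_mem' {a b} ha hb e := by simp only [Module.End.mul_apply, ha (b e), hb e]
  add_mem' {a b} ha hb e := by simp only [LinearMap.add_apply, map_add, ha e, hb e]
  algebraMap_mem' c e := by simp [Module.algebraMap_end_apply]

/-- `D (bⱼ) = ∑ᵢ Mᵢⱼ bᵢ`: the matrix of the connection with respect to the family `b` is `M`. -/
def HasMatrix (D : Connection C A E) {ι : Type*} [Fintype ι] (b : ι → E) (M : Matrix ι ι A) :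
    Prop :=
  ∀ j, D (b j) = ∑ i, M i j • b i

/-- `(E, ∇)` is a direct sum of connections of rank one: there is a basis `b` with
`∇ bᵢ = gᵢ bᵢ`. -/
def IsDiagonalizable (D : Connection C A E) : Prop :=
  ∃ (b : Module.Basis (Fin (Module.finrank A E)) A E) (g : Fin (Module.finrank A E) → A),
    ∀ i, D (b i) = g i • b i

end Basic

section BaseChange

variable {C A E : Type*} [CommRing C] [CommRing A] [Algebra C A] [Theta C A]
  [AddCommGroup E] [Module C E] [Module A E]
  (B : Type*) [CommRing B] [Algebra C B] [Algebra A B] [Theta C B] [ThetaAlgebra C A B]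

/-- The additive map `g ⊗ e ↦ ϑ(g) ⊗ e + g ⊗ ∇ e`. -/
def baseChangeAdd (D : Connection C A E) : B ⊗[A] E →+ B ⊗[A] E :=
  TensorProduct.liftAddHom
    (AddMonoidHom.mk' (fun g => AddMonoidHom.mk' (fun e => ϑ C g ⊗ₜ[A] e + g ⊗ₜ[A] D e)
        (fun e e' => by simp only [TensorProduct.tmul_add, map_add]; abel))
      (fun g g' => by
        ext e
        simp only [AddMonoidHom.mk'_apply, AddMonoidHom.add_apply, TensorProduct.add_tmul, map_add]
        abel))
    (fun a g e => by
      simp only [AddMonoidHom.mk'_apply, D.leibniz, TensorProduct.tmul_add]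
      rw [Algebra.smul_def, Derivation.leibniz, ThetaAlgebra.theta_algebraMap, smul_eq_mul,
        smul_eq_mul, ← Algebra.smul_def, mul_comm g, ← Algebra.smul_def, ← Algebra.smul_def,
        TensorProduct.add_tmul, TensorProduct.smul_tmul, TensorProduct.smul_tmul,
        TensorProduct.smul_tmul]
      abel)

@[simp] theorem baseChangeAdd_tmul (D : Connection C A E) (g : B) (e : E) :
    D.baseChangeAdd B (g ⊗ₜ[A] e) = ϑ C g ⊗ₜ[A] e + g ⊗ₜ[A] D e := rfl

/-- The base change of a connection along `A → B`: the connection on `B ⊗ E` given by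
`∇ (g ⊗ e) = ϑ(g) ⊗ e + g ⊗ ∇ e`. -/
def baseChange (D : Connection C A E) : Connection C B (B ⊗[A] E) where
  toLin :=
    { toFun := D.baseChangeAdd B
      map_add' := map_add _
      map_smul' := fun c z => by
        induction z using TensorProduct.induction_on with
        | zero => simp
        | add x y hx hy => simp only [smul_add, map_add, hx, hy]
        | tmul g e =>
          simp only [TensorProduct.smul_tmul', baseChangeAdd_tmul, Derivation.map_smul,
            RingHom.id_apply, smul_add] }
  leibniz f z := by
    change D.baseChangeAdd B (f • z) = ϑ C f • z + f • D.baseChangeAdd B z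
    induction z using TensorProduct.induction_on with
    | zero => simp
    | add x y hx hy => simp only [smul_add, map_add, hx, hy]; abel
    | tmul g e =>
      simp only [TensorProduct.smul_tmul', baseChangeAdd_tmul, smul_add, smul_eq_mul,
        Derivation.leibniz, TensorProduct.add_tmul]
      rw [mul_comm g]
      abel

@[simp] theorem baseChange_tmul (D : Connection C A E) (g : B) (e : E) :
    D.baseChange B (g ⊗ₜ[A] e) = ϑ C g ⊗ₜ[A] e + g ⊗ₜ[A] D e := rfl

end BaseChange

end Connection

/-- The group of logarithmic derivatives `{u⁻¹ ϑ(u) : u ≠ 0}` of a field `K`. -/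
def dLog (C K : Type*) [Field C] [Field K] [Algebra C K] [Theta C K] : AddSubgroup K where
  carrier := {f | ∃ u : K, u ≠ 0 ∧ f = u⁻¹ * ϑ C u}
  zero_mem' := ⟨1, one_ne_zero, by simp⟩
  add_mem' := by
    rintro _ _ ⟨u, hu, rfl⟩ ⟨t, ht, rfl⟩
    refine ⟨u * t, mul_ne_zero hu ht, ?_⟩
    rw [Derivation.leibniz, smul_eq_mul, smul_eq_mul]
    field_simp
    ring
  neg_mem' := by
    rintro _ ⟨u, hu, rfl⟩
    refine ⟨u⁻¹, inv_ne_zero hu, ?_⟩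
    have h : u * ϑ C u⁻¹ + u⁻¹ * ϑ C u = 0 := by
      have := (ϑ C).leibniz u u⁻¹
      rw [mul_inv_cancel₀ hu, Derivation.map_one_eq_zero] at this
      simpa using this.symm
    rw [inv_inv]
    linear_combination -h

section Laurent

variable {C : Type u} [Field C]
  {E : Type w} [AddCommGroup E] [Module C E] [Module C⸨X⸩ E] [IsScalarTower C C⸨X⸩ E]

/-- `(E, ∇)` is regular singular: it is isomorphic to `C((x)) ⊗ (M, ∇_M)` for a logarithmic
connection `∇_M` on a finite `C⟦x⟧`-module `M`. -/
def IsRegularSingular (D : Connection C C⸨X⸩ E) : Prop :=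
  ∃ (M : Type u) (_ : AddCommGroup M) (_ : Module C M) (_ : Module C⟦X⟧ M)
    (_ : IsScalarTower C C⟦X⟧ M) (_ : Module.Finite C⟦X⟧ M)
    (DM : Connection C C⟦X⟧ M) (φ : (C⸨X⸩ ⊗[C⟦X⟧] M) ≃ₗ[C⸨X⸩] E),
    ∀ z, D (φ z) = φ (DM.baseChange C⸨X⸩ z)

/-- The connection is semisimple: it becomes diagonalizable over some `C((x_s))`. -/
def IsSemisimpleConn [CharZero C] (D : Connection C C⸨X⸩ E) : Prop :=
  ∃ s : ℕ+, (D.baseChange (Ram C s)).IsDiagonalizable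

/-- `∇ = S + N` is a Jordan-Levelt decomposition: `S` is a semisimple connection, `N` is a
nilpotent `C((x))`-linear endomorphism, and `S` and `N` commute. -/
structure IsJordanLevelt [CharZero C] (D S : Connection C C⸨X⸩ E) (N : Module.End C⸨X⸩ E) :
    Prop where
  eq_add : ∀ e, D e = S e + N e
  semisimple : IsSemisimpleConn S
  nilpotent : IsNilpotent N
  commute : ∀ e, S (N e) = N (S e)

/-- `s` is the Turrittin index of `(E, ∇)`: the smallest `s ≥ 1` such that the semisimple part of
`∇` becomes diagonalizable over `C((x_s))`. -/
def IsTurrittinIndex [CharZero C] (D : Connection C C⸨X⸩ E) (s : ℕ+) : Prop :=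
  ∃ (S : Connection C C⸨X⸩ E) (N : Module.End C⸨X⸩ E), IsJordanLevelt D S N ∧
    IsLeast {s' : ℕ+ | (S.baseChange (Ram C s')).IsDiagonalizable} s

/-- The sum of all rank one subconnections of type `φ` of `(E, S)`: it is spanned by the `e` with
`S e = f e` for some `f` in the class `φ` modulo logarithmic derivatives. -/
def isotypical (S : Connection C C⸨X⸩ E) (φ : C⸨X⸩ ⧸ dLog C C⸨X⸩) : Submodule C⸨X⸩ E :=
  Submodule.span C⸨X⸩ {e | ∃ f : C⸨X⸩, QuotientAddGroup.mk f = φ ∧ S e = f • e}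

/-- `(E, ∇) = ⨁_{ρ ∈ Σ} E_ρ` is the Turrittin-Levelt-Jordan decomposition of `(E, ∇)` over
`C((x))`: the semisimple part `S` of `∇` is diagonalizable over `C((x))`, each `E_ρ` is the
isotypical component of `S` of type `ρ`, `Σ` is the set of types that occur, and `E` is the direct
sum of the `E_ρ`. -/
def IsTLJDecomposition [CharZero C] (D : Connection C C⸨X⸩ E)
    (types : Finset (C⸨X⸩ ⧸ dLog C C⸨X⸩))
    (comp : (C⸨X⸩ ⧸ dLog C C⸨X⸩) → Submodule C⸨X⸩ E) : Prop :=
  ∃ (S : Connection C C⸨X⸩ E) (N : Module.End C⸨X⸩ E), IsJordanLevelt D S N ∧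
    S.IsDiagonalizable ∧
    (∀ ρ, comp ρ = isotypical S ρ) ∧
    (∀ ρ, ρ ∈ types ↔ comp ρ ≠ ⊥) ∧
    iSupIndep (fun ρ : types => comp ρ) ∧
    (⨆ ρ : types, comp ρ) = ⊤

/-- The class modulo logarithmic derivatives of a constant.  It induces an embedding of `C / ℤ`. -/
def constClass (c : C) : C⸨X⸩ ⧸ dLog C C⸨X⸩ :=
  QuotientAddGroup.mk (algebraMap C C⸨X⸩ c)

/-- The sum of the components whose type is congruent to `ρ` modulo `s⁻¹ ℤ`, i.e. of the
components whose types agree with `ρ` over `C((x_s))`.  For `s = 1` this is `E_ρ` itself. -/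
def ramComponent (s : ℕ+) (types : Finset (C⸨X⸩ ⧸ dLog C C⸨X⸩))
    (comp : (C⸨X⸩ ⧸ dLog C C⸨X⸩) → Submodule C⸨X⸩ E) (ρ : C⸨X⸩ ⧸ dLog C C⸨X⸩) :
    Submodule C⸨X⸩ E :=
  ⨆ ρ' ∈ {ρ' | ρ' ∈ types ∧ ∃ k : ℤ, ρ' - ρ = constClass ((k : C) / ((s : ℕ) : C))}, comp ρ'

/-- The lower bidiagonal matrix `J♭_r(f)` with `f` on the diagonal, whose entry at `(j + 1, j)`
is `1` or `0` according to `star j`. -/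
def flatJordan {K : Type*} [CommRing K] (r : ℕ) (f : K) (star : Fin r → Bool) :
    Matrix (Fin r) (Fin r) K :=
  fun i j => if i = j then f else if (i : ℕ) = (j : ℕ) + 1 ∧ star j = true then 1 else 0

/-- `f ∈ x_s⁻¹ C[x_s⁻¹]`: only negative powers of `x_s` occur in `f`. -/
def IsPolar {s : ℕ+} (f : Ram C s) : Prop := ∀ n : ℤ, 0 ≤ n → f.coeff n = 0

/-- There are a basis `b` of `C((x_s)) ⊗ F` (seen inside `C((x_s)) ⊗ E`), a constant `c` and
`f₁, …, f_ℓ ∈ x_s⁻¹ C[x_s⁻¹]` such that, for one and the same choice of the subdiagonal entries,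
`Drs` has the matrix `J♭_r(c)`, written as `diag(J♭_{r₁}(c), …, J♭_{r_ℓ}(c))`, and `D` has the
matrix `diag(J♭_{r₁}(c + f₁), …, J♭_{r_ℓ}(c + f_ℓ))`. -/
def HasCommonFlatJordanForm [CharZero C] (s : ℕ+) (D Drs : Connection C C⸨X⸩ E)
    (F : Submodule C⸨X⸩ E) : Prop :=
  ∃ (l : ℕ) (r : Fin l → ℕ)
    (b : Module.Basis ((i : Fin l) × Fin (r i)) (Ram C s) (F.baseChange (Ram C s)))
    (c : C) (f : Fin l → Ram C s) (star : (i : Fin l) → Fin (r i) → Bool),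
    (∀ i, IsPolar (f i)) ∧
    (Drs.baseChange (Ram C s)).HasMatrix (fun j => (b j : Ram C s ⊗[C⸨X⸩] E))
      (Matrix.blockDiagonal' fun i => flatJordan (r i) (algebraMap C (Ram C s) c) (star i)) ∧
    (D.baseChange (Ram C s)).HasMatrix (fun j => (b j : Ram C s ⊗[C⸨X⸩] E))
      (Matrix.blockDiagonal' fun i => flatJordan (r i) (algebraMap C (Ram C s) c + f i) (star i))

/-- The `C((x))`-linear endomorphism `P` becomes diagonalizable over `C((x_s))`. -/
def IsDiagonalizableOver (s : ℕ+) (P : Module.End C⸨X⸩ E) : Prop :=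
  ∃ (b : Module.Basis (Fin (Module.finrank C⸨X⸩ E)) (Ram C s) (Ram C s ⊗[C⸨X⸩] E))
    (g : Fin (Module.finrank C⸨X⸩ E) → Ram C s),
    ∀ i, P.baseChange (Ram C s) (b i) = g i • b i

variable {L : Type v} [CommRing L] [Algebra C L]

/-- The action on `E` of a Laurent series `∑ λₙ xⁿ ∈ Λ((x))`, for a finite-dimensional `Λ` acting
on `E`: if `(vᵢ)` is a `C`-basis of `Λ` and `∑ λₙ xⁿ = ∑ᵢ aᵢ vᵢ` with `aᵢ ∈ C((x))`, then it acts
as `∑ᵢ aᵢ α(vᵢ)`. -/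
def laurentAction [Module.Finite C L] (α : L →ₐ[C] Module.End C⸨X⸩ E) (a : L⸨X⸩) :
    Module.End C⸨X⸩ E :=
  ∑ i, (HahnSeries.map a ((Module.finBasis C L).coord i) : C⸨X⸩) • α (Module.finBasis C L i)

/-- The properties that characterize the logarithmic decomposition `∇ = ∇ʳˢ + P` of a connection
with an action `α` of `Λ`, where `s` is the Turrittin index of `∇`. -/
structure IsLogDecomposition [CharZero C] [Module.Finite C L] (s : ℕ+)
    (D : Connection C C⸨X⸩ E) (α : L →ₐ[C] D.endAlgebra)
    (Drs : Connection C C⸨X⸩ E) (P : Module.End C⸨X⸩ E) : Prop where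
  eq_add : ∀ e, D e = Drs e + P e
  /-- `(E, ∇ʳˢ)` is regular singular -/
  regularSingular : IsRegularSingular Drs
  /-- `Λ` acts on `(E, ∇ʳˢ)` by endomorphisms of connections -/
  action : ∀ a : L, (α a : Module.End C⸨X⸩ E) ∈ Drs.endAlgebra
  /-- `P` is `Λ((x))`-linear -/
  linear : ∀ (a : L⸨X⸩) (e : E),
    P (laurentAction (D.endAlgebra.val.comp α) a e) =
      laurentAction (D.endAlgebra.val.comp α) a (P e)
  diagonalizable : IsDiagonalizableOver s P
  /-- the Turrittin-Levelt-Jordan decomposition of `(E, ∇ʳˢ)` over `C((x))`, all of whose types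
  lie in `C / ℤ`, and its compatibility with `P` and `∇` -/
  tlj : ∃ (types : Finset (C⸨X⸩ ⧸ dLog C C⸨X⸩))
    (comp : (C⸨X⸩ ⧸ dLog C C⸨X⸩) → Submodule C⸨X⸩ E),
    IsTLJDecomposition Drs types comp ∧
    (∀ ρ ∈ types, ∃ c : C, ρ = constClass c) ∧
    ∀ ρ ∈ types,
      (∀ e ∈ ramComponent s types comp ρ, P e ∈ ramComponent s types comp ρ) ∧
      HasCommonFlatJordanForm s D Drs (ramComponent s types comp ρ)

end Laurent

end LogDec

end

noncomputable section

set_option linter.unusedSectionVars false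

/-! The proof is organized around generalized eigenvectors: vectors `v` with `(∇ - g) ^ k v = 0` for
some series `g`. Multiplying `v` by `u ≠ 0` adds `u⁻¹ ϑ(u)` to `g`. Over `C((x_s))` an eigenvalue
can thus be normalized to `a + f` with `a` constant and `f` polar (`exists_normal_form`), and then
`f` is unique and `a` is unique modulo `s⁻¹ ℤ` (`eq_of_eulerDer_eq_mul`).

Turrittin's theorem takes the form that, after ramification, `E` is spanned by generalized
eigenvectors with such eigenvalues (`exists_genSpan_matConn_eq_top`). A single eigenvector is enough
(`hasEigenvector`): for the dual connection it gives a subconnection of corank one, and a rank one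
quotient causes no obstruction because rank one equations are solvable up to a kernel
(`mem_genSpan_of_shift_mem`). To find an eigenvector, one passes to a cyclic submodule, removes the
trace by a twist and ramifies until the Newton slope is an integer. Either the system becomes
integral, and a nonresonant eigenvalue of its constant term lifts to an eigenvector, or the leading
matrix has two distinct eigenvalues, and a generalized eigenspace lifts to a proper subconnection.

Spanning gives a Jordan basis over `C((x_s))` with eigenvalues `aᵢ + fᵢ`; the polar part `P`
multiplies the basis vectors by the `fᵢ`. The decisive fact is that `P` multiplies every generalized
eigenvector with eigenvalue `a + f` by `f` (`JordanBasis.polar_of_mem_genEig`), so it does not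
depend on the basis. Hence `P` commutes with `x_s ↦ ζ x_s` and descends to `C((x))`; it commutes
with all horizontal endomorphisms, in particular with `Λ`; and it equals every `P` as in the
theorem, because the bases in (iii)(b) consist of generalized eigenvectors with eigenvalues `c_ρ +
f`.

The connection `∇ - P` has constant eigenvalues over `C((x_s))`. Projecting `C((x_s)) ⊗ E` to its
part of exponent `0` shows the same over `C((x))` (`genSpan_eq_top_of_baseChange`), so `∇ - P` has a
Jordan basis over `C((x))`; this gives regular singularity and the TLJ-decomposition. Over
`C((x_s))` the component `F_ρ` becomes the span of the Jordan vectors with constant in `c + s⁻¹ ℤ`,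
and taking the `aᵢ` among fixed representatives modulo `s⁻¹ ℤ` makes these constants equal to a
single `c_ρ`. -/

namespace LogDec

/-! ### Generalized eigenvectors over a differential field. -/

section Abstract

variable {C A E : Type*} [Field C] [Field A] [Algebra C A] [AddCommGroup E] [Module C E]
  [Module A E] [IsScalarTower C A E]

/-- The operator `D - g`. -/
def shift (D : E →ₗ[C] E) (g : A) : Module.End C E := D - Algebra.lsmul C C E g

theorem shift_apply (D : E →ₗ[C] E) (g : A) (e : E) : shift D g e = D e - g • e := rfl

/-- The generalized eigenspace of `D` for `g`. -/
def genEig (D : E →ₗ[C] E) (g : A) : Submodule C E :=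
  ⨆ k : ℕ, LinearMap.ker (shift D g ^ k)

theorem ker_pow_mono (T : Module.End C E) : Monotone fun k : ℕ => LinearMap.ker (T ^ k) := by
  intro k l hkl v hv
  obtain ⟨m, rfl⟩ := Nat.exists_eq_add_of_le' hkl
  rw [LinearMap.mem_ker] at hv ⊢
  rw [pow_add, Module.End.mul_apply, hv, map_zero]

theorem mem_genEig {D : E →ₗ[C] E} {g : A} {v : E} :
    v ∈ genEig D g ↔ ∃ k : ℕ, (shift D g ^ k) v = 0 := by
  unfold genEig
  rw [Submodule.mem_iSup_of_directed _ (ker_pow_mono _).directed_le]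
  rfl

theorem mem_genEig_of_shift_mem {D : E →ₗ[C] E} {g : A} {v : E} (h : shift D g v ∈ genEig D g) :
    v ∈ genEig D g := by
  obtain ⟨k, hk⟩ := mem_genEig.1 h
  exact mem_genEig.2 ⟨k + 1, by rwa [pow_succ, Module.End.mul_apply]⟩

/-- The span of the generalized eigenvectors of `D` for `g ∈ G`. -/
def genSpan (D : E →ₗ[C] E) (G : Set A) : Submodule A E :=
  Submodule.span A (⋃ g ∈ G, (genEig D g : Set E))

theorem mem_genSpan {D : E →ₗ[C] E} {G : Set A} {g : A} (hg : g ∈ G) {v : E}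
    (hv : v ∈ genEig D g) : v ∈ genSpan D G :=
  Submodule.subset_span (Set.mem_biUnion hg hv)

theorem genSpan_induction {D : E →ₗ[C] E} {G : Set A} {X : Submodule A E}
    (h : ∀ g ∈ G, ∀ v ∈ genEig D g, v ∈ X) : genSpan D G ≤ X := by
  refine Submodule.span_le.2 fun v hv => ?_
  obtain ⟨g, hg, hv⟩ := Set.mem_iUnion₂.1 hv
  exact h g hg v hv

variable {δ : Derivation C A A} {D : E →ₗ[C] E}

/-- The auxiliary `g'` is free: a coefficient `f` passes through `D - g` at the price of the rank
one operator `δ + (g' - g)` applied to `f`, while the vector sees `D - g'`. -/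
theorem shift_smul (hD : ∀ (f : A) (e : E), D (f • e) = δ f • e + f • D e) (g g' f : A) (e : E) :
    shift D g (f • e) = (δ f + (g' - g) * f) • e + f • shift D g' e := by
  rw [shift_apply, shift_apply, hD, smul_sub, add_smul, sub_mul, sub_smul, mul_smul, mul_smul,
    smul_comm f g']
  abel

/-- A vector that is reached from outside a stable submodule. -/
theorem exists_shift_mem {g : A} {v : E} (hv : v ∈ genEig D g) {X : Submodule A E} (hX : v ∉ X) :
    ∃ v', v' ∉ X ∧ shift D g v' ∈ X ∧ v' ∈ genEig D g := by
  classical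
  have hk : ∃ k : ℕ, (shift D g ^ k) v ∈ X := by
    obtain ⟨k, hk⟩ := mem_genEig.1 hv
    exact ⟨k, by rw [hk]; exact X.zero_mem⟩
  obtain ⟨m, hm⟩ : ∃ m, Nat.find hk = m + 1 := by
    refine Nat.exists_eq_succ_of_ne_zero fun h0 => hX ?_
    have := Nat.find_spec hk
    rw [h0] at this
    simpa using this
  refine ⟨(shift D g ^ m) v, Nat.find_min hk (by omega), ?_, ?_⟩
  · have := Nat.find_spec hk
    rwa [hm, pow_succ', Module.End.mul_apply] at this
  · obtain ⟨k, hk⟩ := mem_genEig.1 hv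
    refine mem_genEig.2 ⟨k, ?_⟩
    rw [← Module.End.mul_apply, ← pow_add, add_comm, pow_add, Module.End.mul_apply, hk, map_zero]

/-- Socle argument. Choose `X` maximal among the stable submodules with `Z ⊓ X = ⊥`, and a
generalized eigenvector `v ∉ X` with `(D - g) v ∈ X`. By maximality `X + A v` meets `Z` in some `x +
v`, after scaling, and `D - g` sends this vector into `Z ⊓ X = ⊥`. -/
theorem exists_eigenvector_of_le_genSpan [Module.Finite A E]
    (hD : ∀ (f : A) (e : E), D (f • e) = δ f • e + f • D e) {G : Set A} {Z : Submodule A E}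
    (hZ : Z ≤ genSpan D G) (hZD : ∀ z ∈ Z, D z ∈ Z) (hZ0 : Z ≠ ⊥) :
    ∃ g ∈ G, ∃ z ∈ Z, z ≠ 0 ∧ D z = g • z := by
  let 𝒮 : Set (Submodule A E) := {X | (∀ x ∈ X, D x ∈ X) ∧ Z ⊓ X = ⊥}
  obtain ⟨X, ⟨hXD, hXZ⟩, hmax⟩ : ∃ X ∈ 𝒮, ∀ Y ∈ 𝒮, ¬ X < Y :=
    WellFounded.has_min (wellFounded_gt : WellFounded ((· > ·) : Submodule A E → _ → Prop)) 𝒮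
      ⟨⊥, fun x hx => by simp [(Submodule.mem_bot A).1 hx], by simp⟩
  have hex : ∃ g ∈ G, ∃ v ∈ genEig D g, v ∉ X := by
    by_contra! h
    have : genSpan D G ≤ X := genSpan_induction h
    exact hZ0 (by rw [← hXZ, inf_eq_left.2 (hZ.trans this)])
  obtain ⟨g, hg, v₀, hv₀, hvX₀⟩ := hex
  obtain ⟨v, hvX, hv, -⟩ := exists_shift_mem hv₀ hvX₀
  let Y := X ⊔ Submodule.span A {v}
  have hDY : ∀ x ∈ Y, D x ∈ Y := by
    intro y hy
    obtain ⟨x, hx, _, hz, rfl⟩ := Submodule.mem_sup.1 hy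
    obtain ⟨a, rfl⟩ := Submodule.mem_span_singleton.1 hz
    have h1 : v ∈ Y := Submodule.mem_sup_right (Submodule.mem_span_singleton_self v)
    have h2 : D v ∈ Y := by
      have : D v = shift D g v + g • v := by rw [shift_apply]; abel
      rw [this]
      exact Y.add_mem (Submodule.mem_sup_left hv) (Y.smul_mem _ h1)
    rw [map_add, hD]
    exact Y.add_mem (Submodule.mem_sup_left (hXD x hx))
      (Y.add_mem (Y.smul_mem _ h1) (Y.smul_mem _ h2))
  have hlt : X < Y := lt_of_le_of_ne le_sup_left fun h =>
    hvX (h ▸ Submodule.mem_sup_right (Submodule.mem_span_singleton_self v))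
  have hne : Z ⊓ Y ≠ ⊥ := fun h => hmax Y ⟨hDY, h⟩ hlt
  obtain ⟨z, ⟨hzZ, hzY⟩, hz0⟩ := Submodule.exists_mem_ne_zero_of_ne_bot hne
  obtain ⟨x, hx, _, hz, rfl⟩ := Submodule.mem_sup.1 hzY
  obtain ⟨a, rfl⟩ := Submodule.mem_span_singleton.1 hz
  have ha : a ≠ 0 := by
    rintro rfl
    apply hz0
    have : x + (0 : A) • v ∈ Z ⊓ X := ⟨hzZ, by simpa using hx⟩
    rwa [hXZ, Submodule.mem_bot] at this
  have hz' : a⁻¹ • x + v ∈ Z := by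
    have := Z.smul_mem a⁻¹ hzZ
    rwa [smul_add, smul_smul, inv_mul_cancel₀ ha, one_smul] at this
  refine ⟨g, hg, a⁻¹ • x + v, hz', fun h => hvX ?_, ?_⟩
  · rw [← neg_eq_of_add_eq_zero_right h]
    exact X.neg_mem (X.smul_mem _ hx)
  · have h1 : shift D g (a⁻¹ • x + v) ∈ Z ⊓ X := by
      constructor
      · exact Z.sub_mem (hZD _ hz') (Z.smul_mem _ hz')
      · rw [map_add]
        exact X.add_mem (X.sub_mem (hXD _ (X.smul_mem _ hx)) (X.smul_mem _ (X.smul_mem _ hx))) hv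
    rw [hXZ, Submodule.mem_bot, shift_apply, sub_eq_zero] at h1
    exact h1

/-- Multiplication by `u` intertwines `D - g'` and `D - g`. -/
theorem smul_mem_genEig (hD : ∀ (f : A) (e : E), D (f • e) = δ f • e + f • D e)
    {g g' u : A} (hu : δ u = (g - g') * u) {v : E} (hv : v ∈ genEig D g') :
    u • v ∈ genEig D g := by
  have h : ∀ (k : ℕ) (w : E), (shift D g ^ k) (u • w) = u • (shift D g' ^ k) w := by
    intro k
    induction k with
    | zero => simp
    | succ k ih =>
      intro w
      rw [pow_succ, Module.End.mul_apply, shift_smul hD g g', hu, ← add_mul, sub_add_sub_cancel,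
        sub_self, zero_mul, zero_smul, zero_add, ih, pow_succ, Module.End.mul_apply]
  obtain ⟨k, hk⟩ := mem_genEig.1 hv
  exact mem_genEig.2 ⟨k, by rw [h, hk, smul_zero]⟩

/-- The twisted derivation `δ + h` on the field itself. -/
def twist (δ : Derivation C A A) (h : A) : Module.End C A :=
  (δ : A →ₗ[C] A) + Algebra.lmul C A h

theorem twist_apply (h a : A) : twist δ h a = δ a + h * a := rfl

/-- In rank one there are no nontrivial Jordan blocks: if `a' = (δ + h) a ≠ 0` is killed by `δ + h`,
then `δ (a / a') = 1`. The hypothesis `hA` excludes such a logarithm, since it would make `a / a'` a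
constant. -/
theorem twist_apply_eq_zero_of_pow (hA : ∀ a, δ (δ a) = 0 → a ∈ (algebraMap C A).range)
    {h a : A} {k : ℕ} (hk : (twist δ h ^ k) a = 0) : twist δ h a = 0 := by
  have key : ∀ a, twist δ h (twist δ h a) = 0 → twist δ h a = 0 := by
    intro a ha
    by_contra h0
    set a' := twist δ h a with ha'
    have h1 : δ a' = - (h * a') := by rw [twist_apply] at ha; exact eq_neg_of_add_eq_zero_left ha
    have h2 : δ (a'⁻¹ * a') = 0 := by rw [inv_mul_cancel₀ h0]; exact δ.map_one_eq_zero
    have h3 : δ (a'⁻¹ * a) = 1 := by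
      have e1 : δ a = a' - h * a := by rw [ha', twist_apply]; ring
      rw [Derivation.leibniz, smul_eq_mul, smul_eq_mul, h1] at h2
      have h4 : a' * δ a'⁻¹ = a' * (h * a'⁻¹) := by linear_combination h2
      have h5 := mul_left_cancel₀ h0 h4
      rw [Derivation.leibniz, smul_eq_mul, smul_eq_mul, h5, e1]
      have := inv_mul_cancel₀ h0
      linear_combination this
    obtain ⟨c, hc⟩ := hA (a'⁻¹ * a) (by rw [h3]; exact δ.map_one_eq_zero)
    rw [← hc, Derivation.map_algebraMap] at h3
    exact zero_ne_one h3
  induction k generalizing a with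
  | zero => rw [pow_zero] at hk; have : a = 0 := hk; rw [this, map_zero]
  | succ k ih =>
    cases k with
    | zero => simpa using hk
    | succ k =>
      rw [pow_succ, Module.End.mul_apply] at hk
      exact key a (ih hk)

end Abstract

end LogDec

/-! ### Jordan-Levelt decompositions, rank one extensions and linear independence. -/

namespace LogDec

section Abstract

variable {C A E : Type*} [Field C] [Field A] [Algebra C A] [AddCommGroup E] [Module C E]
  [Module A E] [IsScalarTower C A E] {δ : Derivation C A A} {D : E →ₗ[C] E}

section JordanLevelt

variable {ι : Type*} {b : Module.Basis ι A E} {g : ι → A} {N : Module.End A E}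

theorem repr_shift_semisimple {S : E →ₗ[C] E}
    (hS : ∀ (f : A) (e : E), S (f • e) = δ f • e + f • S e)
    (hb : ∀ i, S (b i) = g i • b i) (γ : A) (v : E) (i : ι) :
    b.repr (shift S γ v) i = twist δ (g i - γ) (b.repr v i) := by
  have hv : v ∈ Submodule.span A (Set.range b) := by rw [b.span_eq]; trivial
  induction hv using Submodule.span_induction with
  | mem x hx =>
    obtain ⟨j, rfl⟩ := hx
    rw [shift_apply, hb, ← sub_smul, map_smul, b.repr_self, twist_apply]
    by_cases h : j = i
    · subst h; simp
    · simp [Finsupp.single_eq_of_ne' h]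
  | zero => simp
  | add x y _ _ hx hy => simp only [map_add, Finsupp.add_apply, hx, hy]
  | smul a x _ hx =>
    rw [shift_apply, twist_apply] at hx
    rw [shift_apply, hS, twist_apply]
    simp only [map_add, map_sub, map_smul, Finsupp.add_apply, Finsupp.sub_apply,
      Finsupp.smul_apply, smul_eq_mul, Derivation.leibniz] at hx ⊢
    linear_combination a * hx

/-- If `D = S + N` with `S` diagonal and `N` nilpotent commuting with `S`, the generalized
eigenvectors of `D` are the eigenvectors of `S`. -/
theorem semisimple_apply_of_mem_genEig (hA : ∀ a, δ (δ a) = 0 → a ∈ (algebraMap C A).range)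
    (hD : ∀ (f : A) (e : E), D (f • e) = δ f • e + f • D e) (hN : IsNilpotent N)
    (hb : ∀ i, D (b i) = g i • b i + N (b i))
    (hcomm : ∀ i, D (N (b i)) = g i • N (b i) + N (N (b i))) {γ : A} {v : E}
    (hv : v ∈ genEig D γ) :
    D v = γ • v + N v ∧ ∀ i, δ (b.repr v i) = (γ - g i) * b.repr v i := by
  let N' : Module.End C E := N.restrictScalars C
  let S : E →ₗ[C] E := D - N'
  have hSapp : ∀ e, S e = D e - N e := fun e => rfl
  have hS : ∀ (f : A) (e : E), S (f • e) = δ f • e + f • S e := by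
    intro f e
    rw [hSapp, hSapp, hD, map_smul, smul_sub]; abel
  have hSb : ∀ i, S (b i) = g i • b i := fun i => by rw [hSapp, hb]; abel
  have hSN : ∀ e, S (N e) = N (S e) := by
    intro e
    have he : e ∈ Submodule.span A (Set.range b) := by rw [b.span_eq]; trivial
    induction he using Submodule.span_induction with
    | mem x hx => obtain ⟨j, rfl⟩ := hx; rw [hSb, map_smul, hSapp, hcomm]; abel
    | zero => simp
    | add x y _ _ hx hy => simp only [map_add, hx, hy]
    | smul a x _ hx => rw [map_smul, hS, hS, map_add, map_smul, map_smul, hx]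
  have hshift : shift S γ = -N' + shift D γ := by
    ext e; simp only [shift_apply, hSapp, LinearMap.add_apply, LinearMap.neg_apply, N',
      LinearMap.restrictScalars_apply]; abel
  have hcom : Commute (-N') (shift D γ) := by
    refine Commute.neg_left ?_
    ext e
    have h1 := hSN e
    rw [hSapp, hSapp, map_sub, sub_left_inj] at h1
    simp only [Module.End.mul_apply, shift_apply, map_sub, N', LinearMap.restrictScalars_apply,
      map_smul, h1]
  obtain ⟨k, hk⟩ := mem_genEig.1 hv
  obtain ⟨l, hl⟩ := hN
  have hl' : N' ^ l = 0 := by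
    have : ∀ m, ∀ e, (N' ^ m) e = (N ^ m) e := by
      intro m
      induction m with
      | zero => simp
      | succ m ih =>
        intro e
        rw [pow_succ, pow_succ, Module.End.mul_apply, Module.End.mul_apply, ih]
        rfl
    ext e
    rw [this, hl]
    rfl
  -- Binomial theorem for `S - γ = (D - γ) - N`: each term contains either `N ^ l = 0` or a power of
  -- `D - γ` that kills `v`.
  have hpow : (shift S γ ^ (k + l)) v = 0 := by
    rw [hshift, hcom.add_pow, LinearMap.sum_apply]
    refine Finset.sum_eq_zero fun m hm => ?_
    rw [(Nat.cast_commute _ _).symm.eq, Module.End.mul_apply, Module.End.mul_apply]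
    have : ((-N') ^ m) ((shift D γ ^ (k + l - m)) v) = 0 := by
      by_cases h : l ≤ m
      · have : (-N') ^ m = 0 := by
          rw [neg_pow, ← Nat.sub_add_cancel h, pow_add N', hl', mul_zero, mul_zero]
        rw [this]; rfl
      · obtain ⟨j, hj⟩ := Nat.exists_eq_add_of_le' (show k ≤ k + l - m by omega)
        rw [hj, pow_add, Module.End.mul_apply, hk, map_zero, map_zero]
    rw [this, map_zero]
  have hcoord : ∀ i, twist δ (g i - γ) (b.repr v i) = 0 := by
    intro i
    have : ∀ (m : ℕ) (e : E), b.repr ((shift S γ ^ m) e) i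
        = (twist δ (g i - γ) ^ m) (b.repr e i) := by
      intro m
      induction m with
      | zero => simp
      | succ m ih =>
        intro e
        rw [pow_succ, Module.End.mul_apply, ih, repr_shift_semisimple hS hSb, pow_succ,
          Module.End.mul_apply]
    refine twist_apply_eq_zero_of_pow (k := k + l) hA ?_
    rw [← this, hpow]; simp
  constructor
  · have : shift S γ v = 0 := by
      apply b.repr.injective
      ext i
      rw [repr_shift_semisimple hS hSb, hcoord]; simp
    rw [shift_apply, hSapp, sub_sub, sub_eq_zero] at this
    rw [this, add_comm]
  · intro i
    have := hcoord i
    rw [twist_apply] at this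
    linear_combination this

end JordanLevelt

/-- If a nonzero shift is solvable, a vector that `D - g` maps into the span of generalized
eigenvectors is a generalized eigenvector modulo this span. -/
theorem mem_genSpan_of_shift_mem (hD : ∀ (f : A) (e : E), D (f • e) = δ f • e + f • D e)
    {G : Set A} {g : A} (hg : g ∈ G)
    (hsolve : ∀ g' ∈ G, ∀ w, ∃ u, twist δ (g' - g) (twist δ (g' - g) u - w) = 0)
    {v : E} (hv : shift D g v ∈ genSpan D G) : v ∈ genSpan D G := by
  -- Variation of constants, by induction on the nilpotency order of `x`. If `u₀` solves `(δ + g' -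
  -- g) u₀ = a` up to the kernel, then `(D - g)(u₀ x)` is `a x`, plus an element of `genEig D g`,
  -- plus `u₀ (D - g') x`; the last term is removed by the induction hypothesis with coefficient
  -- `u₀`.
  have key₁ : ∀ g' ∈ G, ∀ (k : ℕ) (x : E), (shift D g' ^ k) x = 0 → ∀ a : A,
      ∃ u ∈ genSpan D G, shift D g u - a • x ∈ genEig D g := by
    intro g' hg' k
    induction k with
    | zero =>
      intro x hx a
      have : x = 0 := hx
      exact ⟨0, Submodule.zero_mem _, by simp [this]⟩
    | succ k ih =>
      intro x hx a
      obtain ⟨u₀, hu₀⟩ := hsolve g' hg' a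
      obtain ⟨u₁, hu₁, h₁⟩ := ih (shift D g' x)
        (by rwa [pow_succ, Module.End.mul_apply] at hx) u₀
      have hxV : x ∈ genEig D g' := mem_genEig.2 ⟨k + 1, hx⟩
      refine ⟨u₀ • x - u₁, Submodule.sub_mem _ (Submodule.smul_mem _ _ (mem_genSpan hg' hxV)) hu₁,
        ?_⟩
      have e : shift D g (u₀ • x - u₁) - a • x
          = (twist δ (g' - g) u₀ - a) • x - (shift D g u₁ - u₀ • shift D g' x) := by
        rw [map_sub, shift_smul hD g g', twist_apply, sub_smul]; abel
      rw [e]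
      refine Submodule.sub_mem _ (smul_mem_genEig hD ?_ hxV) h₁
      rw [twist_apply] at hu₀
      linear_combination hu₀
  have key : ∀ w ∈ genSpan D G, ∀ a : A, ∃ u ∈ genSpan D G,
      shift D g u - a • w ∈ genEig D g := by
    intro w hw
    induction hw using Submodule.span_induction with
    | zero => exact fun a => ⟨0, Submodule.zero_mem _, by simp⟩
    | mem x hx =>
      obtain ⟨g', hg', hx⟩ := Set.mem_iUnion₂.1 hx
      obtain ⟨k, hk⟩ := mem_genEig.1 hx
      exact key₁ g' hg' k x hk
    | add x y _ _ hx hy =>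
      intro a
      obtain ⟨u, hu, h⟩ := hx a
      obtain ⟨u', hu', h'⟩ := hy a
      refine ⟨u + u', Submodule.add_mem _ hu hu', ?_⟩
      have := Submodule.add_mem _ h h'
      rwa [sub_add_sub_comm, ← map_add, ← smul_add] at this
    | smul a' x hx ih =>
      intro a
      rw [smul_smul]
      exact ih _
  obtain ⟨u, hu, h⟩ := key _ hv 1
  -- `u` solves the same equation as `v` up to `genEig D g`, so the difference is itself a
  -- generalized eigenvector.
  have : u - v ∈ genSpan D G := by
    refine mem_genSpan hg (mem_genEig_of_shift_mem ?_)
    rwa [map_sub, ← one_smul A (shift D g v)]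
  have := Submodule.sub_mem _ hu this
  rwa [sub_sub_cancel] at this

/-- Generalized eigenvectors that are independent over the constants are independent. -/
theorem linearIndependent_of_const (hA : ∀ a, δ (δ a) = 0 → a ∈ (algebraMap C A).range)
    (hD : ∀ (f : A) (e : E), D (f • e) = δ f • e + f • D e)
    {ι : Type*} [Fintype ι] [DecidableEq ι] {v : ι → E} {g : ι → A} {n : Matrix ι ι C}
    (hn : IsNilpotent n) (hng : ∀ i j, n i j ≠ 0 → g i = g j)
    (hv : ∀ j, D (v j) = g j • v j + ∑ i, n i j • v i)
    (hg : ∀ i j, ∀ u : A, u ≠ 0 → δ u = (g i - g j) * u → g i = g j)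
    (hind : ∀ (γ : A) (z : ι → C), (∀ i, z i ≠ 0 → g i = γ) → ∑ i, z i • v i = 0 → z = 0) :
    LinearIndependent A v := by
  -- `T` is the connection on the free module `ι → A` with the matrix prescribed for the `v j`. The
  -- map `Φ` below sends its standard basis to `v` and is horizontal, so its kernel is `T`-stable.
  let N : Module.End A (ι → A) := Matrix.toLin' (n.map (algebraMap C A))
  let T : (ι → A) →ₗ[C] (ι → A) :=
    LinearMap.pi (fun i => twist δ (g i) ∘ₗ LinearMap.proj i) + N.restrictScalars C
  have hT : ∀ a i, T a i = δ (a i) + g i * a i + ∑ j, n i j • a j := by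
    intro a i
    change twist δ (g i) (a i) + N a i = _
    simp [twist_apply, N, Matrix.toLin'_apply, Matrix.mulVec, dotProduct, Algebra.smul_def]
  have hTD : ∀ (f : A) (e : ι → A), T (f • e) = δ f • e + f • T e := by
    intro f e
    ext i
    simp only [hT, Pi.smul_apply, Pi.add_apply, smul_eq_mul, Derivation.leibniz, mul_add,
      Finset.mul_sum, mul_smul_comm]
    ring
  let κ : (ι → C) → ι → A := fun z i => algebraMap C A (z i)
  have hNκ : ∀ z, N (κ z) = κ (n.mulVec z) := by
    intro z
    ext i
    simp [N, κ, Matrix.toLin'_apply, Matrix.mulVec, dotProduct]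
  have hTκ : ∀ (γ : A) (z : ι → C), (∀ i, z i ≠ 0 → g i = γ) →
      T (κ z) = γ • κ z + N (κ z) := by
    intro γ z hz
    have : T (κ z) = (fun i => g i * κ z i) + N (κ z) := by
      ext i
      change twist δ (g i) (κ z i) + N (κ z) i = _
      rw [twist_apply, Derivation.map_algebraMap, zero_add]; rfl
    rw [this]
    congr 1
    ext i
    by_cases h : z i = 0
    · simp [κ, h]
    · simp [hz i h]
  have hsupp : ∀ (γ : A) (z : ι → C), (∀ i, z i ≠ 0 → g i = γ) →
      ∀ i, n.mulVec z i ≠ 0 → g i = γ := by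
    intro γ z hz i hi
    obtain ⟨j, -, hj⟩ := Finset.exists_ne_zero_of_sum_ne_zero hi
    rw [hng i j (left_ne_zero_of_mul hj), hz j (right_ne_zero_of_mul hj)]
  have hpow : ∀ (γ : A) (k : ℕ) (z : ι → C), (∀ i, z i ≠ 0 → g i = γ) →
      (shift T γ ^ k) (κ z) = κ ((n ^ k).mulVec z) := by
    intro γ k
    induction k with
    | zero => simp
    | succ k ih =>
      intro z hz
      rw [pow_succ, Module.End.mul_apply, shift_apply, hTκ γ z hz, add_sub_cancel_left, hNκ,
        ih _ (hsupp γ z hz), pow_succ, Matrix.mulVec_mulVec]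
  have hsingle : ∀ j, ∀ i, (Pi.single j (1 : C) : ι → C) i ≠ 0 → g i = g j := by
    intro j i hi
    by_contra h
    exact hi (Pi.single_eq_of_ne (fun hij => h (by rw [hij])) _)
  have hκs : ∀ j, κ (Pi.single j 1) = Pi.single j 1 := by
    intro j
    ext i
    by_cases h : i = j
    · subst h; simp [κ]
    · simp [κ, Pi.single_eq_of_ne h]
  obtain ⟨l, hl⟩ := hn
  have hNnil : IsNilpotent N := ⟨l, by
    rw [← Matrix.toLin'_pow, ← Matrix.map_pow, hl]; simp⟩
  have hbasis : ∀ j, (Pi.single j 1 : ι → A) ∈ genEig T (g j) := fun j =>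
    mem_genEig.2 ⟨l, by rw [← hκs, hpow _ _ _ (hsingle j), hl]; ext i; simp [κ]⟩
  let Φ := Fintype.linearCombination A v
  have hΦ : ∀ a, Φ a = ∑ i, a i • v i := fun a => rfl
  have hΦT : ∀ a, Φ (T a) = D (Φ a) := by
    intro a
    simp only [hΦ, hT, map_sum, hD, hv, add_smul, smul_add, Finset.sum_add_distrib, add_assoc]
    congr 1
    simp only [mul_smul, Finset.sum_smul, Finset.smul_sum]
    congr 1
    · exact Finset.sum_congr rfl fun i _ => smul_comm _ _ _
    · rw [Finset.sum_comm]
      refine Finset.sum_congr rfl fun i _ => Finset.sum_congr rfl fun j _ => ?_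
      rw [smul_assoc, smul_comm]
  suffices hker : LinearMap.ker Φ = ⊥ from Fintype.linearIndependent_iff.2 fun a ha i =>
    by
      have : a ∈ LinearMap.ker Φ := ha
      rw [hker, Submodule.mem_bot] at this
      rw [this]; rfl
  -- A nonzero kernel would contain an eigenvector of `T`. Its coordinates solve rank one equations,
  -- so by `hg` they are constants supported on one eigenvalue, which is a relation of the kind
  -- excluded by `hind`.
  by_contra hne
  obtain ⟨γ, ⟨i₀, rfl⟩, z, hz, hz0, hTz⟩ := exists_eigenvector_of_le_genSpan (D := T) hTD
    (G := Set.range g) (Z := LinearMap.ker Φ)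
    (by
      have : genSpan T (Set.range g) = ⊤ := by
        rw [eq_top_iff, ← (Pi.basisFun A ι).span_eq, Submodule.span_le]
        rintro _ ⟨j, rfl⟩
        rw [Pi.basisFun_apply]
        exact mem_genSpan (Set.mem_range_self j) (hbasis j)
      rw [this]; exact le_top)
    (fun z hz => by rw [LinearMap.mem_ker] at hz ⊢; rw [hΦT, hz, map_zero]) hne
  have hzV : z ∈ genEig T (g i₀) := mem_genEig.2 ⟨1, by rw [pow_one, shift_apply, hTz, sub_self]⟩
  have hcoord := (semisimple_apply_of_mem_genEig (b := Pi.basisFun A ι) (g := g) hA hTD hNnil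
    (fun i => by
      rw [Pi.basisFun_apply, ← hκs, hTκ _ _ (hsingle i)])
    (fun i => by
      rw [Pi.basisFun_apply, ← hκs, hNκ, hTκ _ _ (hsupp _ _ (hsingle i))]) hzV).2
  have hzc : ∀ i, ∃ c : C, z i = algebraMap C A c ∧ (c ≠ 0 → g i = g i₀) := by
    intro i
    have h1 := hcoord i
    rw [Pi.basisFun_repr] at h1
    by_cases h : z i = 0
    · exact ⟨0, by simpa using h, by simp⟩
    have h2 := hg _ _ _ h h1
    rw [h2, sub_self, zero_mul] at h1
    obtain ⟨c, hc⟩ := hA (z i) (by rw [h1, map_zero])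
    exact ⟨c, hc.symm, fun _ => h2.symm⟩
  choose c hc hc' using hzc
  have : c = 0 := hind _ c hc' (by
    rw [LinearMap.mem_ker, hΦ] at hz
    rw [← hz]
    exact Finset.sum_congr rfl fun i _ => by rw [hc, algebraMap_smul])
  apply hz0
  ext i
  rw [hc, this]; simp

end Abstract

end LogDec

/-! ### Jordan bases over the constants and over the differential field. -/

namespace LogDec

open Polynomial in
/-- Jordan normal form of a nilpotent endomorphism. -/
theorem exists_jordan_basis {C H : Type*} [Field C] [AddCommGroup H] [Module C H]
    [Module.Finite C H] {N : Module.End C H} (hN : IsNilpotent N) :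
    ∃ (l : ℕ) (r : Fin l → ℕ) (b : Module.Basis ((i : Fin l) × Fin (r i)) C H),
      ∀ i j, N (b ⟨i, j⟩) = if h : (j : ℕ) + 1 < r i then b ⟨i, ⟨j + 1, h⟩⟩ else 0 := by
  classical
  obtain ⟨n, hn⟩ := hN
  -- With `X` acting as `N`, the space is a finite `X`-power torsion `C[X]`-module, hence a sum of
  -- modules `C[X] / (X ^ k)`; the powers of the root in each summand form a Jordan chain.
  have htors : Module.IsTorsion' (Module.AEval' N) (Submonoid.powers (X : C[X])) := by
    intro x
    refine ⟨⟨X ^ n, n, rfl⟩, ?_⟩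
    obtain ⟨x, rfl⟩ := (Module.AEval'.of N).surjective x
    change (X ^ n : C[X]) • Module.AEval'.of N x = 0
    rw [Module.AEval'.X_pow_smul_of, hn]
    simp
  have : Module.Finite C[X] (Module.AEval' N) := inferInstance
  obtain ⟨d, k, ⟨e⟩⟩ := Module.torsion_by_prime_power_decomposition irreducible_X htors
  have hm : ∀ i, (X ^ k i : C[X]).Monic := fun i => monic_X_pow _
  let pb := fun i => AdjoinRoot.powerBasis' (hm i)
  let bb : Module.Basis ((i : Fin d) × Fin (pb i).dim) C
    (Π₀ i : Fin d, AdjoinRoot (X ^ k i : C[X])) := DFinsupp.basis fun i => (pb i).basis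
  let e' : (Π₀ i : Fin d, AdjoinRoot (X ^ k i : C[X])) ≃ₗ[C] H :=
    (e.symm.restrictScalars C) ≪≫ₗ (Module.AEval'.of N).symm
  let μ : (Π₀ i : Fin d, AdjoinRoot (X ^ k i : C[X])) → Π₀ i : Fin d, AdjoinRoot (X ^ k i : C[X]) :=
    fun z => (X : C[X]) • (show DirectSum (Fin d) fun i =>
      C[X] ⧸ Submodule.span C[X] {(X : C[X]) ^ k i} from z)
  have hμ : ∀ z i, μ z i = AdjoinRoot.root (X ^ k i : C[X]) * z i := by
    intro z i
    change (X : C[X]) • (show C[X] ⧸ Submodule.span C[X] {(X : C[X]) ^ k i} from z i) = _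
    obtain ⟨p, hp⟩ := AdjoinRoot.mk_surjective (z i)
    rw [← hp, ← AdjoinRoot.mk_X, ← map_mul]
    rfl
  have hX : ∀ z, N (e' z) = e' (μ z) := by
    intro z
    apply (Module.AEval'.of N).injective
    rw [← Module.AEval'.X_smul_of]
    change _ = Module.AEval'.of N ((Module.AEval'.of N).symm (e.symm ((X : C[X]) • _)))
    rw [LinearEquiv.apply_symm_apply, map_smul]
    congr 1
  refine ⟨d, fun i => (pb i).dim, bb.map e', fun i j => ?_⟩
  have hbb : ∀ i j, bb ⟨i, j⟩ = DFinsupp.single i (AdjoinRoot.root (X ^ k i : C[X]) ^ (j : ℕ)) := by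
    intro i j
    refine bb.apply_eq_iff.2 (Finsupp.ext fun ⟨i', j'⟩ => ?_)
    have h1 : bb.repr (DFinsupp.single i (AdjoinRoot.root (X ^ k i : C[X]) ^ (j : ℕ))) ⟨i', j'⟩
        = (pb i').basis.repr (DFinsupp.single (β := fun i => AdjoinRoot (X ^ k i : C[X])) i
          (AdjoinRoot.root (X ^ k i : C[X]) ^ (j : ℕ)) i') j' := rfl
    rw [h1]
    by_cases h : i = i'
    · subst h
      have h2 : AdjoinRoot.root (X ^ k i : C[X]) ^ (j : ℕ) = (pb i).basis j := by
        rw [PowerBasis.basis_eq_pow]; rfl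
      rw [DFinsupp.single_eq_same, h2, Module.Basis.repr_self]
      simp [Finsupp.single_apply]
    · rw [DFinsupp.single_eq_of_ne (Ne.symm h), map_zero, Finsupp.single_apply,
        if_neg (by rintro ⟨⟩; exact h rfl)]
      rfl
  have hsm : μ (DFinsupp.single (β := fun i => AdjoinRoot (X ^ k i : C[X])) i
      (AdjoinRoot.root (X ^ k i : C[X]) ^ (j : ℕ))) =
      DFinsupp.single (β := fun i => AdjoinRoot (X ^ k i : C[X])) i
        (AdjoinRoot.root (X ^ k i : C[X]) ^ ((j : ℕ) + 1)) := by
    refine DFinsupp.ext fun i' => ?_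
    rw [hμ]
    by_cases h : i = i'
    · subst h
      rw [DFinsupp.single_eq_same, DFinsupp.single_eq_same, pow_succ']
    · rw [DFinsupp.single_eq_of_ne (Ne.symm h), DFinsupp.single_eq_of_ne (Ne.symm h), mul_zero]
  rw [Module.Basis.map_apply, hX, hbb, hsm]
  split_ifs with h
  · rw [Module.Basis.map_apply, hbb]
  · have hj : (j : ℕ) + 1 = k i := by
      have h1 : (pb i).dim = k i := by simp [pb]
      have h2 : (j : ℕ) < (pb i).dim := j.2
      have h3 : ¬ (j : ℕ) + 1 < (pb i).dim := h
      omega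
    have : AdjoinRoot.root (X ^ k i : C[X]) ^ ((j : ℕ) + 1) = 0 := by
      rw [hj, ← AdjoinRoot.mk_X, ← map_pow, AdjoinRoot.mk_self]
    rw [this, DFinsupp.single_zero, map_zero]

section Structure

variable {C : Type u} {A : Type v} {E : Type w} [Field C] [Field A] [Algebra C A]
  [AddCommGroup E] [Module C E] [Module A E] [IsScalarTower C A E]
  {δ : Derivation C A A} {D : E →ₗ[C] E}

/-- The subdiagonal matrix of a sum of nilpotent Jordan blocks. -/
def nilBlocks (C : Type*) [Field C] {κ : Type*} [DecidableEq κ] (r : κ → ℕ) :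
    Matrix ((x : κ) × Fin (r x)) ((x : κ) × Fin (r x)) C :=
  fun p q => if p.1 = q.1 ∧ (p.2 : ℕ) = q.2 + 1 then 1 else 0

theorem isNilpotent_nilBlocks {κ : Type*} [DecidableEq κ] [Fintype κ] (r : κ → ℕ) :
    IsNilpotent (nilBlocks C r) := by
  have h : ∀ (k : ℕ) p q, (nilBlocks C r ^ k) p q ≠ 0 → p.1 = q.1 ∧ (p.2 : ℕ) = q.2 + k := by
    intro k
    induction k with
    | zero =>
      intro p q hpq
      rw [pow_zero] at hpq
      have : p = q := by
        by_contra h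
        exact hpq (Matrix.one_apply_ne h)
      subst this; simp
    | succ k ih =>
      intro p q hpq
      rw [pow_succ, Matrix.mul_apply] at hpq
      obtain ⟨m, -, hm⟩ := Finset.exists_ne_zero_of_sum_ne_zero hpq
      obtain ⟨h1, h2⟩ := ih p m (left_ne_zero_of_mul hm)
      have h3 : m.1 = q.1 ∧ (m.2 : ℕ) = q.2 + 1 := by
        by_contra h
        exact right_ne_zero_of_mul hm (if_neg h)
      exact ⟨h1.trans h3.1, by omega⟩
  refine ⟨Finset.univ.sup r, ?_⟩
  ext p q
  by_contra hne
  have := (h _ p q hne).2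
  have h2 : r p.1 ≤ Finset.univ.sup r := Finset.le_sup (Finset.mem_univ _)
  have := p.2.2
  omega

theorem sum_nilBlocks_smul {κ : Type*} [DecidableEq κ] [Fintype κ] (r : κ → ℕ)
    (v : ((x : κ) × Fin (r x)) → E) (x : κ) (j : Fin (r x)) :
    ∑ p, nilBlocks C r p ⟨x, j⟩ • v p
      = if h : (j : ℕ) + 1 < r x then v ⟨x, ⟨j + 1, h⟩⟩ else 0 := by
  split_ifs with h
  · rw [Finset.sum_eq_single (⟨x, ⟨j + 1, h⟩⟩ : (x : κ) × Fin (r x))]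
    · simp [nilBlocks]
    · rintro ⟨y, i⟩ - hne
      rw [nilBlocks, if_neg, zero_smul]
      rintro ⟨h1, h2⟩
      simp only at h1 h2
      subst h1
      exact hne (by congr 1; exact Fin.ext h2)
    · simp
  · refine Finset.sum_eq_zero fun ⟨y, i⟩ _ => ?_
    rw [nilBlocks, if_neg, zero_smul]
    rintro ⟨h1, h2⟩
    simp only at h1 h2
    subst h1
    have := i.2
    omega

/-- A connection spanned by generalized eigenvectors has a Jordan basis. -/
theorem exists_jordan_basis_of_genSpan_eq_top [Module.Finite A E]
    (hA : ∀ a, δ (δ a) = 0 → a ∈ (algebraMap C A).range)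
    (hD : ∀ (f : A) (e : E), D (f • e) = δ f • e + f • D e) {G : Set A}
    (hG : ∀ g ∈ G, ∀ g' ∈ G, ∀ u : A, u ≠ 0 → δ u = (g - g') * u → g = g')
    (hspan : genSpan D G = ⊤) :
    ∃ (κ : Type v) (_ : Fintype κ) (r : κ → ℕ) (b : Module.Basis ((i : κ) × Fin (r i)) A E)
      (g : κ → A), (∀ i, g i ∈ G) ∧ ∀ i j, D (b ⟨i, j⟩) =
        g i • b ⟨i, j⟩ + if h : (j : ℕ) + 1 < r i then b ⟨i, ⟨j + 1, h⟩⟩ else 0 := by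
  classical
  obtain ⟨T, hTS, hT⟩ := (Submodule.fg_span_iff_fg_span_finset_subset _).1
    (show (genSpan D G).FG from hspan ▸ Module.Finite.fg_top)
  have hex : ∀ v : T, ∃ g, g ∈ G ∧ (v : E) ∈ genEig D g := fun v => by
    obtain ⟨g, hg, h⟩ := Set.mem_iUnion₂.1 (hTS v.2)
    exact ⟨g, hg, h⟩
  choose γ hγG hγ using hex
  choose k hk using fun v => mem_genEig.1 (hγ v)
  let K := Finset.univ.sup k
  have hK : ∀ v, (shift D (γ v) ^ K) (v : E) = 0 := fun v =>
    ker_pow_mono (shift D (γ v)) (Finset.le_sup (Finset.mem_univ v)) (hk v)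
  let Γ : Finset A := Finset.univ.image γ
  -- `H g` is spanned over `C` by the iterates of finitely many generators. It replaces the full
  -- generalized eigenspace because it is visibly finite-dimensional, stable under `D - g` and
  -- killed by `(D - g) ^ K`.
  let W : A → Set E := fun g => (fun p : T × Fin K => (shift D g ^ (p.2 : ℕ)) (p.1 : E)) ''
    {p | γ p.1 = g}
  let H : A → Submodule C E := fun g => Submodule.span C (W g)
  have hHfin : ∀ g, Module.Finite C (H g) := fun g =>
    FiniteDimensional.span_of_finite C ((Set.toFinite _).image _)
  have hHK : ∀ g, H g ≤ LinearMap.ker (shift D g ^ K) := by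
    intro g
    refine Submodule.span_le.2 ?_
    rintro _ ⟨⟨v, j⟩, rfl, rfl⟩
    change (shift D (γ v) ^ K) ((shift D (γ v) ^ (j : ℕ)) (v : E)) = 0
    rw [← Module.End.mul_apply, ← pow_add, add_comm, pow_add, Module.End.mul_apply, hK, map_zero]
  have hHs : ∀ g, ∀ x ∈ H g, shift D g x ∈ H g := by
    intro g
    change H g ≤ (H g).comap (shift D g)
    refine Submodule.span_le.2 ?_
    rintro _ ⟨⟨v, j⟩, hv, rfl⟩
    change shift D g ((shift D g ^ (j : ℕ)) (v : E)) ∈ H g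
    rw [← Module.End.mul_apply, ← pow_succ']
    by_cases h : (j : ℕ) + 1 < K
    · exact Submodule.subset_span ⟨⟨v, ⟨j + 1, h⟩⟩, hv, rfl⟩
    · have hj : (j : ℕ) + 1 = K := by have := j.2; omega
      obtain rfl : γ v = g := hv
      rw [hj, hK]
      exact Submodule.zero_mem _
  let N : ∀ g, Module.End C (H g) := fun g => (shift D g).restrict (hHs g)
  have hN : ∀ g, IsNilpotent (N g) := by
    refine fun g => ⟨K, ?_⟩
    ext x
    rw [Module.End.pow_restrict, LinearMap.coe_restrict_apply]
    exact hHK g x.2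
  choose l r b hb using fun g => exists_jordan_basis (hN g)
  let κ := (g : Γ) × Fin (l g)
  let R : κ → ℕ := fun x => r x.1 x.2
  let V : ((x : κ) × Fin (R x)) → E := fun p => (b p.1.1 ⟨p.1.2, p.2⟩ : H p.1.1)
  have hV : ∀ x j, D (V ⟨x, j⟩) = (x.1 : A) • V ⟨x, j⟩
      + if h : (j : ℕ) + 1 < R x then V ⟨x, ⟨j + 1, h⟩⟩ else 0 := by
    intro x j
    have h1 := congrArg (Subtype.val) (hb x.1 x.2 j)
    have h2 : (N x.1 (b x.1 ⟨x.2, j⟩) : E) = D (V ⟨x, j⟩) - (x.1 : A) • V ⟨x, j⟩ := rfl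
    rw [h2, sub_eq_iff_eq_add'] at h1
    rw [h1]
    congr 1
    change ((if h : (j : ℕ) + 1 < R x then _ else _ : H x.1) : E) = _
    split_ifs <;> rfl
  -- Constant relations within a single `H g` are excluded by the basis of `H g`;
  -- `linearIndependent_of_const` shows that no others have to be considered.
  have hli : LinearIndependent A V := by
    refine linearIndependent_of_const (g := fun p => (p.1.1 : A)) (n := nilBlocks C R) hA hD
      (isNilpotent_nilBlocks R) ?_ ?_ ?_ ?_
    · intro p q hpq
      have : p.1 = q.1 := by
        by_contra h
        exact hpq (if_neg fun h' => h h'.1)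
      rw [this]
    · rintro ⟨x, j⟩
      rw [hV, sum_nilBlocks_smul]
    · intro p q u hu h
      have hmem : ∀ g : Γ, (g : A) ∈ G := by
        rintro ⟨g, hg⟩
        obtain ⟨v, -, rfl⟩ := Finset.mem_image.1 hg
        exact hγG v
      exact hG _ (hmem _) _ (hmem _) u hu h
    · intro g z hz hsum
      by_contra hne
      obtain ⟨p, hp⟩ := Function.ne_iff.1 hne
      obtain rfl := hz p hp
      have h1 : ∑ q, z ⟨⟨p.1.1, q.1⟩, q.2⟩ • (b p.1.1 q : E) = 0 := by
        rw [← hsum, Fintype.sum_sigma, Fintype.sum_sigma, Fintype.sum_sigma,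
          Finset.sum_eq_single p.1.1]
        · intro g' _ hg'
          refine Finset.sum_eq_zero fun i _ => Finset.sum_eq_zero fun j _ => ?_
          have : z ⟨⟨g', i⟩, j⟩ = 0 := by
            by_contra h
            exact hg' (Subtype.ext (hz _ h))
          rw [this, zero_smul]
        · simp
      have h2 := Fintype.linearIndependent_iff.1
        ((b p.1.1).linearIndependent.map' (H p.1.1).subtype (Submodule.ker_subtype _)) _ h1
      exact hp (h2 ⟨p.1.2, p.2⟩)
  have hsp : ⊤ ≤ Submodule.span A (Set.range V) := by
    rw [← hspan, genSpan, hT, Submodule.span_le]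
    intro v hv
    have hΓ : γ ⟨v, hv⟩ ∈ Γ := Finset.mem_image_of_mem _ (Finset.mem_univ _)
    have hvH : v ∈ H (γ ⟨v, hv⟩) := by
      by_cases h : 0 < K
      · exact Submodule.subset_span ⟨⟨⟨v, hv⟩, ⟨0, h⟩⟩, rfl, by simp⟩
      · have h1 := hK ⟨v, hv⟩
        have : K = 0 := by omega
        rw [this, pow_zero] at h1
        have : v = 0 := h1
        generalize γ ⟨v, hv⟩ = g
        rw [this]
        exact Submodule.zero_mem _
    have h1 := congrArg Subtype.val ((b (γ ⟨v, hv⟩)).sum_repr ⟨v, hvH⟩)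
    simp only [AddSubmonoidClass.coe_finsetSum, Submodule.coe_smul] at h1
    rw [← h1]
    refine Submodule.sum_mem _ fun q _ => ?_
    rw [← algebraMap_smul A]
    refine Submodule.smul_mem _ _ (Submodule.subset_span ⟨⟨⟨⟨_, hΓ⟩, q.1⟩, q.2⟩, rfl⟩)
  refine ⟨κ, inferInstance, R, Module.Basis.mk hli hsp, fun x => (x.1 : A), ?_, ?_⟩
  · rintro ⟨⟨g, hg⟩, i⟩
    obtain ⟨v, -, rfl⟩ := Finset.mem_image.1 hg
    exact hγG v
  · intro x j
    simp only [Module.Basis.mk_apply]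
    exact hV x j

end Structure

end LogDec

/-! ### Recursive solution of power series equations. -/

namespace LogDec

/-- Dependent recursion where the next term may use all earlier ones. By `hcongr` the relation reads
only the entries up to `m`, so the later entries of the prefix can be filled with the dummy value
`a₀`. -/
theorem exists_seq_of_forall_prefix {α : Type*} (a₀ : α) (R : ℕ → (ℕ → α) → α → Prop)
    (hR : ∀ m p, ∃ a, R m p a)
    (hcongr : ∀ m p q a, (∀ k ≤ m, p k = q k) → R m p a → R m q a) :
    ∃ u : ℕ → α, u 0 = a₀ ∧ ∀ m, R m u (u (m + 1)) := by
  choose F hF using hR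
  let step : (m : ℕ) → ((k : ℕ) → k < m → α) → α := fun m ih =>
    match m, ih with
    | 0, _ => a₀
    | m + 1, ih => F m fun k => if h : k < m + 1 then ih k h else a₀
  let u : ℕ → α := fun m => (Nat.lt_wfRel.wf).fix (C := fun _ => α) step m
  have hu : ∀ m, u m = step m fun k _ => u k := fun m => WellFounded.fix_eq _ _ _
  refine ⟨u, hu 0, fun m => ?_⟩
  rw [hu (m + 1)]
  refine hcongr m _ u _ (fun k hk => ?_) (hF m _)
  rw [dif_pos (Nat.lt_succ_of_le hk)]

section PowerSeries

variable {C : Type u} [Field C]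

/-- The derivation `c X d/dX` on power series. -/
def psEuler (c : C) (f : C⟦X⟧) : C⟦X⟧ := PowerSeries.mk fun n => c * n * PowerSeries.coeff n f

@[simp] theorem coeff_psEuler (c : C) (f : C⟦X⟧) (n : ℕ) :
    PowerSeries.coeff n (psEuler c f) = c * n * PowerSeries.coeff n f := PowerSeries.coeff_mk _ _

theorem eulerDer_coe (c : C) (f : C⟦X⟧) :
    eulerDer c (f : C⸨X⸩) = ((psEuler c f : C⟦X⟧) : C⸨X⸩) := by
  ext n
  rw [eulerDer_coeff, PowerSeries.coeff_coe, PowerSeries.coeff_coe]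
  split_ifs with hn
  · simp
  · obtain ⟨m, rfl⟩ := Int.eq_ofNat_of_zero_le (not_lt.1 hn)
    simp

theorem map_coeff_mul {n j l : Type*} [Fintype j] (A : Matrix n j C⟦X⟧) (B : Matrix j l C⟦X⟧)
    (m : ℕ) : (A * B).map (PowerSeries.coeff m) = ∑ p ∈ Finset.HasAntidiagonal.antidiagonal m,
      A.map (PowerSeries.coeff p.1) * B.map (PowerSeries.coeff p.2) := by
  ext a b
  simp only [Matrix.map_apply, Matrix.mul_apply, map_sum, PowerSeries.coeff_mul, Matrix.sum_apply]
  rw [Finset.sum_comm]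

/-- Formal block diagonalization, one coefficient at a time. -/
theorem exists_formal_block {n j : Type*} [Fintype n] [Fintype j] (c : C) (r : ℕ)
    (B : Matrix n n C⟦X⟧) (Y₀ : Matrix n j C) (G₀ : Matrix j j C) (P : Matrix j j C → Prop)
    (h₀ : B.map (PowerSeries.coeff 0) * Y₀ = Y₀ * G₀)
    (hs : ∀ m : ℕ, 1 ≤ m → ∀ Z : Matrix n j C, ∃ (Y : Matrix n j C) (G : Matrix j j C), P G ∧
      (if r = 0 then c * m else 0) • Y + B.map (PowerSeries.coeff 0) * Y - Y * G₀ - Y₀ * G = Z) :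
    ∃ (Y : Matrix n j C⟦X⟧) (G : Matrix j j C⟦X⟧), Y.map (PowerSeries.coeff 0) = Y₀ ∧
      G.map (PowerSeries.coeff 0) = G₀ ∧ (∀ m, 1 ≤ m → P (G.map (PowerSeries.coeff m))) ∧
      (PowerSeries.X : C⟦X⟧) ^ r • Y.map (psEuler c) + B * Y = Y * G := by
  let α := Matrix n j C × Matrix j j C
  -- The coefficient of `X ^ m` in `X ^ r Y' + B Y - Y G`, with `p k` standing for the pair of
  -- `k`-th coefficients of `Y` and `G`.
  let expr : ℕ → (ℕ → α) → Matrix n j C := fun m p =>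
    (if r ≤ m then (c * ((m - r : ℕ) : C)) • (p (m - r)).1 else 0)
      + ∑ q ∈ Finset.HasAntidiagonal.antidiagonal m, B.map (PowerSeries.coeff q.1) * (p q.2).1
      - ∑ q ∈ Finset.HasAntidiagonal.antidiagonal m, (p q.1).1 * (p q.2).2
  obtain ⟨u, hu0, hu⟩ := exists_seq_of_forall_prefix (α := α) (Y₀, G₀)
    -- The implication makes the recursive choice possible also after a prefix with the wrong
    -- initial value, where nothing is asked.
    (fun m p a => p 0 = (Y₀, G₀) → P a.2 ∧ expr (m + 1) (Function.update p (m + 1) a) = 0)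
    (by
      intro m p
      by_cases hp : p 0 = (Y₀, G₀)
      swap
      · exact ⟨(Y₀, G₀), fun h => absurd h hp⟩
      obtain ⟨Y, G, hP, h⟩ := hs (m + 1) (by omega)
        (-expr (m + 1) (Function.update p (m + 1) (0, 0)))
      refine ⟨(Y, G), fun _ => ⟨hP, ?_⟩⟩
      -- The new coefficients enter linearly, through the two ends of each convolution sum. The
      -- derivative involves them only if `r = 0`; otherwise it reads index `m + 1 - r`, which is
      -- smaller.
      have key : ∀ a : α, expr (m + 1) (Function.update p (m + 1) a)
          = expr (m + 1) (Function.update p (m + 1) (0, 0))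
            + ((if r = 0 then c * ((m + 1 : ℕ) : C) else 0) • a.1
              + B.map (PowerSeries.coeff 0) * a.1 - a.1 * G₀ - Y₀ * a.2) := by
        intro a
        have hmid : ∀ k ∈ Finset.range m, k + 1 ≠ m + 1 ∧ m + 1 - (k + 1) ≠ m + 1 := by
          intro k hk
          have := Finset.mem_range.1 hk
          omega
        simp only [expr, Finset.Nat.sum_antidiagonal_eq_sum_range_succ_mk]
        rw [Finset.sum_range_succ, Finset.sum_range_succ', Finset.sum_range_succ,
          Finset.sum_range_succ', Finset.sum_range_succ, Finset.sum_range_succ',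
          Finset.sum_range_succ, Finset.sum_range_succ']
        have e1 : ∀ a : α, ∑ k ∈ Finset.range m, B.map (PowerSeries.coeff (k + 1))
            * (Function.update p (m + 1) a (m + 1 - (k + 1))).1
            = ∑ k ∈ Finset.range m, B.map (PowerSeries.coeff (k + 1)) * (p (m + 1 - (k + 1))).1 :=
          fun a => Finset.sum_congr rfl fun k hk => by
            rw [Function.update_of_ne (hmid k hk).2]
        have e2 : ∀ a : α, ∑ k ∈ Finset.range m, (Function.update p (m + 1) a (k + 1)).1
            * (Function.update p (m + 1) a (m + 1 - (k + 1))).2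
            = ∑ k ∈ Finset.range m, (p (k + 1)).1 * (p (m + 1 - (k + 1))).2 :=
          fun a => Finset.sum_congr rfl fun k hk => by
            rw [Function.update_of_ne (hmid k hk).2, Function.update_of_ne (hmid k hk).1]
        have e3 : ∀ a : α, Function.update p (m + 1) a 0 = (Y₀, G₀) := fun a => by
          rw [Function.update_of_ne (by omega), hp]
        simp only [e1, e2, e3, Nat.sub_zero, Nat.sub_self, Function.update_self,
          Matrix.mul_zero, Matrix.zero_mul]
        by_cases hr : r = 0
        · subst hr
          simp only [Nat.sub_zero, Function.update_self, zero_le, if_true, smul_zero, zero_add]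
          abel
        · rw [if_neg hr, Function.update_of_ne (by omega), Function.update_of_ne (by omega),
            zero_smul]
          abel
      rw [key, h, add_neg_cancel])
    (by
      intro m p q a hpq h hq
      obtain ⟨hP, h⟩ := h (by rw [hpq 0 (Nat.zero_le _), hq])
      refine ⟨hP, ?_⟩
      rw [← h]
      have e : ∀ k ≤ m + 1, Function.update q (m + 1) a k = Function.update p (m + 1) a k := by
        intro k hk
        by_cases hkm : k = m + 1
        · rw [hkm, Function.update_self, Function.update_self]
        · rw [Function.update_of_ne hkm, Function.update_of_ne hkm, hpq k (by omega)]
      simp only [expr]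
      rw [e _ (Nat.sub_le _ _)]
      congr 1
      · congr 1
        refine Finset.sum_congr rfl fun x hx => ?_
        rw [e _ (Finset.HasAntidiagonal.antidiagonal.snd_le hx)]
      · refine Finset.sum_congr rfl fun x hx => ?_
        rw [e _ (Finset.HasAntidiagonal.antidiagonal.snd_le hx), e _ (Finset.HasAntidiagonal.antidiagonal.fst_le hx)])
  have hu' : ∀ m, expr m u = 0 := by
    intro m
    cases m with
    | zero =>
      simp only [expr, Finset.Nat.antidiagonal_zero, Finset.sum_singleton, hu0, h₀, Nat.zero_sub,
        Nat.cast_zero, mul_zero, zero_smul, ite_self, zero_add, sub_self]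
    | succ m =>
      have := (hu m hu0).2
      rwa [Function.update_eq_self] at this
  let Y : Matrix n j C⟦X⟧ := fun a b => PowerSeries.mk fun m => (u m).1 a b
  let G : Matrix j j C⟦X⟧ := fun a b => PowerSeries.mk fun m => (u m).2 a b
  have hY : ∀ m, Y.map (PowerSeries.coeff m) = (u m).1 := fun m => by
    ext a b; rw [Matrix.map_apply]; exact PowerSeries.coeff_mk _ _
  have hG : ∀ m, G.map (PowerSeries.coeff m) = (u m).2 := fun m => by
    ext a b; rw [Matrix.map_apply]; exact PowerSeries.coeff_mk _ _
  refine ⟨Y, G, by rw [hY, hu0], by rw [hG, hu0], ?_, ?_⟩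
  · intro m hm
    obtain ⟨k, rfl⟩ := Nat.exists_eq_add_of_le' hm
    rw [hG]
    exact (hu k hu0).1
  · have hmat : ∀ m, ((PowerSeries.X : C⟦X⟧) ^ r • Y.map (psEuler c) + B * Y).map
        (PowerSeries.coeff m) = (Y * G).map (PowerSeries.coeff m) := by
      intro m
      have h1 := hu' m
      simp only [expr, sub_eq_zero] at h1
      rw [map_coeff_mul]
      simp only [hY, hG]
      rw [← h1]
      simp only [← hY]
      rw [← map_coeff_mul]
      ext a b
      simp only [Matrix.map_apply, Matrix.add_apply, Matrix.smul_apply, map_add, smul_eq_mul]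
      congr 1
      rw [PowerSeries.coeff_X_pow_mul']
      split_ifs
      · simp
      · simp
    ext a b m
    exact congrFun (congrFun (hmat m) a) b

end PowerSeries

end LogDec

/-! ### Rank one equations over `C((x))`. -/

namespace LogDec

section Scalar

variable {C : Type u} [Field C]

theorem algebraMap_laurent (a : C) : algebraMap C C⸨X⸩ a = HahnSeries.C a := rfl

theorem coeff_algebraMap_mul (a : C) (f : C⸨X⸩) (n : ℤ) :
    (algebraMap C C⸨X⸩ a * f).coeff n = a * f.coeff n := by
  rw [← Algebra.smul_def]; rfl

/-- Only negative powers of the variable occur. -/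
def IsPolarLaurent (f : C⸨X⸩) : Prop := ∀ n : ℤ, 0 ≤ n → f.coeff n = 0

theorem eulerDer_single (c a : C) (p : ℤ) :
    eulerDer c (HahnSeries.single p a) = algebraMap C C⸨X⸩ (c * p) * HahnSeries.single p a := by
  ext n
  rw [eulerDer_coeff, coeff_algebraMap_mul]
  by_cases h : n = p
  · rw [h]
  · rw [HahnSeries.coeff_single_of_ne h, mul_zero, mul_zero]

variable [CharZero C] {c : C}

theorem const_of_eulerDer_eulerDer (hc : c ≠ 0) (a : C⸨X⸩)
    (ha : eulerDer c (eulerDer c a) = 0) : a ∈ (algebraMap C C⸨X⸩).range := by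
  refine ⟨a.coeff 0, ?_⟩
  ext n
  rw [algebraMap_laurent]
  by_cases hn : n = 0
  · subst hn; simp
  · have h1 := congrArg (fun f => HahnSeries.coeff f n) ha
    simp only [eulerDer_coeff, HahnSeries.coeff_zero] at h1
    have hn' : (n : C) ≠ 0 := by exact_mod_cast hn
    rw [HahnSeries.C_apply, HahnSeries.coeff_single_of_ne hn]
    simpa [hc, hn', eq_comm] using h1

/-- A nonzero polar `f` would give `f u` a term of order below that of `u`, which nothing can
cancel. After that, the leading coefficient of `u` forces `a = c * u.order`. -/
theorem eq_of_eulerDer_eq_mul {a : C} {f u : C⸨X⸩} (hf : IsPolarLaurent f)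
    (hu : u ≠ 0) (h : eulerDer c u = (algebraMap C C⸨X⸩ a + f) * u) :
    f = 0 ∧ ∃ p : ℤ, a = c * p := by
  have hu0 : u.coeff u.order ≠ 0 := HahnSeries.coeff_order_eq_zero.not.2 hu
  have hf0 : f = 0 := by
    by_contra hne
    have hf1 : f.coeff f.order ≠ 0 := HahnSeries.coeff_order_eq_zero.not.2 hne
    have hneg : f.order < 0 := by
      by_contra h0
      exact hf1 (hf _ (not_lt.1 h0))
    have h1 := congrArg (fun g => HahnSeries.coeff g (f.order + u.order)) h
    simp only [add_mul, HahnSeries.coeff_add, coeff_algebraMap_mul, eulerDer_coeff] at h1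
    have h2 : u.coeff (f.order + u.order) = 0 := HahnSeries.coeff_eq_zero_of_lt_order (by omega)
    rw [HahnSeries.coeff_mul_order_add_order, h2, mul_zero, mul_zero, zero_add] at h1
    have h3 : f.leadingCoeff * u.leadingCoeff ≠ 0 :=
      mul_ne_zero (HahnSeries.leadingCoeff_ne_zero.2 hne) (HahnSeries.leadingCoeff_ne_zero.2 hu)
    exact h3 h1.symm
  refine ⟨hf0, u.order, ?_⟩
  have h1 := congrArg (fun g => HahnSeries.coeff g u.order) h
  simp only [hf0, add_zero, coeff_algebraMap_mul, eulerDer_coeff] at h1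
  exact (mul_right_cancel₀ hu0 h1).symm

/-- As `M ≥ 1`, the `m`-th coefficient of the equation is `b(0) u_m` plus terms in earlier
coefficients of `u`, so the recursion never meets a resonance. -/
theorem exists_psEuler_add_mul (c : C) {M : ℕ} (hM : 1 ≤ M) {b : C⟦X⟧}
    (hb : PowerSeries.coeff 0 b ≠ 0) (w : C⟦X⟧) :
    ∃ u : C⟦X⟧, (PowerSeries.X : C⟦X⟧) ^ M * psEuler c u + b * u = w := by
  let rest : ℕ → (ℕ → C) → C := fun m p =>
    (if M ≤ m then c * ((m - M : ℕ) : C) * p (m - M) else 0)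
      + ∑ k ∈ Finset.range m, PowerSeries.coeff (m - k) b * p k
  obtain ⟨u, hu0, hu⟩ := exists_seq_of_forall_prefix
    ((PowerSeries.coeff 0 b)⁻¹ * PowerSeries.coeff 0 w)
    (fun m p a => rest (m + 1) p + PowerSeries.coeff 0 b * a = PowerSeries.coeff (m + 1) w)
    (fun m p => ⟨(PowerSeries.coeff 0 b)⁻¹ * (PowerSeries.coeff (m + 1) w - rest (m + 1) p), by
      rw [mul_inv_cancel_left₀ hb]; ring⟩)
    (by
      intro m p q a hpq h
      rw [← h]
      simp only [rest]
      rw [hpq _ (by omega)]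
      congr 2
      exact Finset.sum_congr rfl fun k hk => by
        rw [hpq k (Nat.lt_succ_iff.1 (Finset.mem_range.1 hk))])
  have hall : ∀ m, rest m u + PowerSeries.coeff 0 b * u m = PowerSeries.coeff m w := by
    intro m
    cases m with
    | zero =>
      simp only [rest, hu0, Finset.range_zero, Finset.sum_empty, Nat.zero_sub, Nat.cast_zero,
        mul_zero, zero_mul, ite_self, zero_add, mul_inv_cancel_left₀ hb]
    | succ m => exact hu m
  refine ⟨PowerSeries.mk u, ?_⟩
  ext m
  rw [map_add, PowerSeries.coeff_X_pow_mul', mul_comm b, PowerSeries.coeff_mul,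
    Finset.Nat.sum_antidiagonal_eq_sum_range_succ_mk, Finset.sum_range_succ, ← hall m]
  simp only [rest, coeff_psEuler, PowerSeries.coeff_mk, Nat.sub_self]
  rw [mul_comm (u m), add_assoc]
  congr 2
  exact Finset.sum_congr rfl fun k _ => mul_comm _ _

/-- The equation `(δ + h) u = w` with `h = a + f` is solvable outright when `f ≠ 0`. When `f = 0`
there may be one resonant exponent, and the part of `w` that is missed lies in the kernel of `δ +
h`; the second application of the operator allows for it. -/
theorem exists_twist_twist_sub_eq_zero (c : C) {a : C} {f : C⸨X⸩} (hf : IsPolarLaurent f)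
    (w : C⸨X⸩) : ∃ u, twist (eulerDer c) (algebraMap C C⸨X⸩ a + f)
      (twist (eulerDer c) (algebraMap C C⸨X⸩ a + f) u - w) = 0 := by
  by_cases hf0 : f = 0
  · subst hf0
    -- At a resonant exponent the inverse takes the value `0`, so the error there is `-w.coeff n`,
    -- which the factor `c n + a = 0` of the outer operator kills.
    let u : C⸨X⸩ :=
      { coeff := fun n => (c * n + a)⁻¹ * w.coeff n
        isPWO_support' := w.isPWO_support.mono fun n hn h0 => hn (by simp [h0]) }
    refine ⟨u, ?_⟩
    ext n
    simp only [twist_apply, add_zero, HahnSeries.coeff_add, coeff_algebraMap_mul, eulerDer_coeff,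
      HahnSeries.coeff_sub, HahnSeries.coeff_zero, u]
    by_cases h : c * n + a = 0
    · linear_combination (c * n * ((c * ↑n + a)⁻¹ * w.coeff n) + a * ((c * ↑n + a)⁻¹ * w.coeff n)
        - w.coeff n) * h
    · have : c * n * ((c * ↑n + a)⁻¹ * w.coeff n) + a * ((c * ↑n + a)⁻¹ * w.coeff n)
        - w.coeff n = 0 := by field_simp; ring
      linear_combination (c * n + a) * this
  · suffices ∃ u, twist (eulerDer c) (algebraMap C C⸨X⸩ a + f) u = w by
      obtain ⟨u, hu⟩ := this
      exact ⟨u, by rw [hu, sub_self, map_zero]⟩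
    set h := algebraMap C C⸨X⸩ a + f with hh
    have hcoeff : ∀ n < 0, h.coeff n = f.coeff n := by
      intro n hn
      rw [hh, HahnSeries.coeff_add, algebraMap_laurent, HahnSeries.C_apply,
        HahnSeries.coeff_single_of_ne hn.ne, zero_add]
    have hf1 : f.coeff f.order ≠ 0 := HahnSeries.coeff_order_eq_zero.not.2 hf0
    have hneg : f.order < 0 := by
      by_contra h0
      exact hf1 (hf _ (not_lt.1 h0))
    have hhne : h.coeff f.order ≠ 0 := by rw [hcoeff _ hneg]; exact hf1
    have hh0 : h ≠ 0 := fun h0 => hhne (by rw [h0]; rfl)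
    have hord : h.order < 0 := (HahnSeries.order_le_of_coeff_ne_zero hhne).trans_lt hneg
    obtain ⟨M, hM⟩ : ∃ M : ℕ, h.order = -(M : ℤ) :=
      ⟨h.order.natAbs, by omega⟩
    have hM1 : 1 ≤ M := by omega
    -- With `u = x ^ p v`, dividing the equation by `x ^ w.order` leaves a power series equation for
    -- `v`; differentiating `x ^ p` contributes the summand `c p X ^ M` to its coefficient.
    set p : ℤ := M + w.order with hp
    obtain ⟨v, hv⟩ := exists_psEuler_add_mul c hM1
      (b := h.powerSeriesPart + PowerSeries.C (c * p) * PowerSeries.X ^ M) (by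
        rw [map_add, LaurentSeries.powerSeriesPart_coeff, PowerSeries.coeff_C_mul,
          PowerSeries.coeff_X_pow, if_neg (by omega), mul_zero, add_zero, Nat.cast_zero, add_zero]
        exact HahnSeries.coeff_order_eq_zero.not.2 hh0) w.powerSeriesPart
    refine ⟨HahnSeries.single p 1 * (v : C⸨X⸩), ?_⟩
    have e1 := LaurentSeries.single_order_mul_powerSeriesPart h
    have e2 := LaurentSeries.single_order_mul_powerSeriesPart w
    have e3 := congrArg (fun f : C⟦X⟧ => (f : C⸨X⸩)) hv
    simp only [PowerSeries.coe_add, PowerSeries.coe_mul, PowerSeries.coe_pow, PowerSeries.coe_C,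
      HahnSeries.ofPowerSeries_X, HahnSeries.single_pow, one_pow] at e3
    have e4 : (HahnSeries.single (M • (1 : ℤ)) (1 : C)) * HahnSeries.single h.order 1 = 1 := by
      rw [HahnSeries.single_mul_single, hM, one_mul, nsmul_eq_mul, mul_one, add_neg_cancel]; rfl
    have e5 : (HahnSeries.single (p : ℤ) (1 : C))
        = HahnSeries.single (M • (1 : ℤ)) 1 * HahnSeries.single w.order 1 := by
      rw [HahnSeries.single_mul_single, hp, one_mul, nsmul_eq_mul, mul_one]
    rw [twist_apply, Derivation.leibniz, eulerDer_single, smul_eq_mul, smul_eq_mul, eulerDer_coe]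
    rw [e5, algebraMap_laurent]
    set x := HahnSeries.single (M • (1 : ℤ)) (1 : C)
    set y := HahnSeries.single w.order (1 : C)
    set z := HahnSeries.single h.order (1 : C)
    linear_combination y * e3 + e2 - x * y * (v : C⸨X⸩) * e1
      + y * (v : C⸨X⸩) * (h.powerSeriesPart : C⸨X⸩) * e4

/-- Up to a logarithmic derivative, a Laurent series is a constant plus a polar part. -/
theorem exists_normal_form (hc : c ≠ 0) (g : C⸨X⸩) :
    ∃ (a : C) (f u : C⸨X⸩), IsPolarLaurent f ∧ u ≠ 0 ∧
      eulerDer c u = (algebraMap C C⸨X⸩ a + f - g) * u := by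
  let f : C⸨X⸩ :=
    { coeff := fun n => if n < 0 then g.coeff n else 0
      isPWO_support' := g.isPWO_support.mono fun n hn h0 => hn (by simp [h0]) }
  let q : C⟦X⟧ := PowerSeries.mk fun n => if n = 0 then 0 else g.coeff n
  have hg : g = algebraMap C C⸨X⸩ (g.coeff 0) + f + (q : C⸨X⸩) := by
    ext n
    rw [HahnSeries.coeff_add, HahnSeries.coeff_add, algebraMap_laurent, HahnSeries.C_apply,
      PowerSeries.coeff_coe]
    rcases lt_trichotomy n 0 with hn | rfl | hn
    · rw [HahnSeries.coeff_single_of_ne hn.ne, if_pos hn]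
      simp [f, hn]
    · simp [f, q]
    · rw [HahnSeries.coeff_single_of_ne hn.ne', if_neg (by omega)]
      obtain ⟨m, rfl⟩ := Int.eq_ofNat_of_zero_le hn.le
      have hm : m ≠ 0 := by rintro rfl; simp at hn
      have hm' : ¬ ((m : ℤ) < 0) := by omega
      simp [f, q, hm]
  let B : Matrix Unit Unit C⟦X⟧ := Matrix.of fun _ _ => q
  have hB : B.map (PowerSeries.coeff 0) = 0 := by
    ext
    change PowerSeries.coeff 0 q = 0
    simp [q]
  -- The part `q` of `g` of positive order is minus the logarithmic derivative of a unit: solve `Y'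
  -- + q Y = 0` with `Y(0) = 1`. The predicate `G = 0` keeps the right-hand side zero.
  obtain ⟨Y, G, hY, hG, hG', hYG⟩ := exists_formal_block (n := Unit) (j := Unit) c 0
    B 1 0 (fun G => G = 0)
    (by rw [hB]; simp)
    (fun m hm Z => ⟨(c * m)⁻¹ • Z, 0, rfl, by
      have hm' : c * (m : C) ≠ 0 := mul_ne_zero hc (by exact_mod_cast (by omega))
      rw [hB, if_pos rfl, smul_smul, mul_inv_cancel₀ hm']
      simp⟩)
  have hG0 : G = 0 := by
    ext a b m
    by_cases hm : m = 0
    · rw [hm]; exact congrFun (congrFun hG a) b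
    · exact congrFun (congrFun (hG' m (by omega)) a) b
  have hy := congrFun (congrFun hYG ()) ()
  simp only [hG0, pow_zero, one_smul, B, Matrix.of_apply, Matrix.add_apply, Matrix.map_apply,
    Matrix.mul_apply, Finset.univ_unique, Finset.sum_singleton, Matrix.zero_apply] at hy
  have hy0 : PowerSeries.coeff 0 (Y () ()) = 1 := by
    have := congrFun (congrFun hY ()) ()
    simpa using this
  refine ⟨g.coeff 0, f, (Y () () : C⟦X⟧), ?_, ?_, ?_⟩
  · intro n hn
    exact if_neg (not_lt.2 hn)
  · intro h0
    have : Y () () = 0 := HahnSeries.ofPowerSeries_injective (Γ := ℤ) (R := C) (by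
      rw [map_zero]; exact h0)
    rw [this] at hy0
    simp at hy0
  · have e := congrArg (fun f : C⟦X⟧ => (f : C⸨X⸩)) hy
    simp only [PowerSeries.coe_add, PowerSeries.coe_mul, PowerSeries.coe_zero] at e
    have hq : algebraMap C C⸨X⸩ (g.coeff 0) + f - g = -(q : C⸨X⸩) := by linear_combination -hg
    rw [eulerDer_coe, hq]
    linear_combination e

end Scalar

end LogDec

/-! ### Ramification, gauge transformations, and regular and irregular splitting. -/

namespace LogDec

section Ramification

variable {C : Type u} [Field C]

/-- The substitution `x ↦ x ^ t` on Laurent series. -/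
def expand (t : ℕ+) : C⸨X⸩ →ₐ[C] C⸨X⸩ := ramEmb C t

theorem coeff_expand_mul (t : ℕ+) (f : C⸨X⸩) (m : ℤ) :
    (expand t f).coeff (((t : ℕ) : ℤ) * m) = f.coeff m :=
  HahnSeries.embDomain_coeff (a := m)

theorem coeff_expand_of_not_dvd (t : ℕ+) (f : C⸨X⸩) {n : ℤ} (hn : ¬ ((t : ℕ) : ℤ) ∣ n) :
    (expand t f).coeff n = 0 :=
  HahnSeries.embDomain_of_notMem_range (by
    rintro ⟨m, hm⟩
    exact hn ⟨m, hm.symm⟩)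

theorem expand_one (f : C⸨X⸩) : expand 1 f = f := by
  ext n
  have := coeff_expand_mul 1 f n
  simpa using this

theorem expand_expand (s t : ℕ+) (f : C⸨X⸩) : expand t (expand s f) = expand (s * t) f := by
  have hs : ((s : ℕ) : ℤ) ≠ 0 := by exact_mod_cast s.ne_zero
  have ht : ((t : ℕ) : ℤ) ≠ 0 := by exact_mod_cast t.ne_zero
  ext n
  by_cases hn : ((t : ℕ) : ℤ) ∣ n
  · obtain ⟨m, rfl⟩ := hn
    rw [coeff_expand_mul]
    by_cases hm : ((s : ℕ) : ℤ) ∣ m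
    · obtain ⟨k, rfl⟩ := hm
      rw [coeff_expand_mul, ← mul_assoc, mul_comm ((t : ℕ) : ℤ)]
      have := coeff_expand_mul (s * t) f k
      rw [PNat.mul_coe, Nat.cast_mul] at this
      exact this.symm
    · rw [coeff_expand_of_not_dvd _ _ hm, coeff_expand_of_not_dvd]
      rw [PNat.mul_coe, Nat.cast_mul, mul_comm ((s : ℕ) : ℤ)]
      rwa [mul_dvd_mul_iff_left ht]
  · rw [coeff_expand_of_not_dvd _ _ hn, coeff_expand_of_not_dvd]
    intro h
    rw [PNat.mul_coe, Nat.cast_mul] at h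
    exact hn (dvd_trans (dvd_mul_left _ _) h)

theorem eulerDer_expand [CharZero C] (c : C) (t : ℕ+) (f : C⸨X⸩) :
    eulerDer (c / ((t : ℕ) : C)) (expand t f) = expand t (eulerDer c f) := by
  have ht : ((t : ℕ) : C) ≠ 0 := by exact_mod_cast t.ne_zero
  ext n
  rw [eulerDer_coeff]
  by_cases hn : ((t : ℕ) : ℤ) ∣ n
  · obtain ⟨m, rfl⟩ := hn
    rw [coeff_expand_mul, coeff_expand_mul, eulerDer_coeff]
    push_cast
    field_simp
  · rw [coeff_expand_of_not_dvd _ _ hn, coeff_expand_of_not_dvd _ _ hn, mul_zero]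

end Ramification

section Gauge

open Matrix

variable {C : Type u} [Field C]

theorem derivation_mulVec {A : Type*} [CommRing A] [Algebra C A] (δ : Derivation C A A)
    {n j : Type*} [Fintype j] (Y : Matrix n j A) (w : j → A) (i : n) :
    δ ((Y *ᵥ w) i) = (Y.map δ *ᵥ w) i + (Y *ᵥ fun k => δ (w k)) i := by
  simp only [mulVec, dotProduct, map_sum, Derivation.leibniz, smul_eq_mul, Matrix.map_apply,
    ← Finset.sum_add_distrib]
  exact Finset.sum_congr rfl fun k _ => by ring

/-- After ramification, the operator `c x d/dx + A` has an eigenvector. -/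
def HasEigenvector (c : C) {n : Type*} [Fintype n] (A : Matrix n n C⸨X⸩) : Prop :=
  ∃ (t : ℕ+) (v : n → C⸨X⸩) (g : C⸨X⸩), v ≠ 0 ∧
    ∀ i, eulerDer (c / ((t : ℕ) : C)) (v i) + (A.map (expand t) *ᵥ v) i = g * v i

variable {n j : Type*} [Fintype n] [Fintype j] {c : C}

theorem hasEigenvector_of_unramified {A : Matrix n n C⸨X⸩} {v : n → C⸨X⸩} {g : C⸨X⸩}
    (hv : v ≠ 0) (h : ∀ i, eulerDer c (v i) + (A *ᵥ v) i = g * v i) : HasEigenvector c A := by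
  refine ⟨1, v, g, hv, fun i => ?_⟩
  have h1 : A.map (expand 1) = A := Matrix.ext fun a b => expand_one (A a b)
  rw [h1, ← h]
  simp

theorem hasEigenvector_of_expand (t : ℕ+) {A : Matrix n n C⸨X⸩}
    (h : HasEigenvector (c / ((t : ℕ) : C)) (A.map (expand t))) : HasEigenvector c A := by
  obtain ⟨s, v, g, hv, h⟩ := h
  have h1 : (A.map (expand t)).map (expand s) = A.map (expand (t * s)) :=
    Matrix.ext fun a b => expand_expand t s (A a b)
  have h2 : c / ((t : ℕ) : C) / ((s : ℕ) : C) = c / ((t * s : ℕ+) : ℕ) := by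
    rw [PNat.mul_coe, Nat.cast_mul, div_mul_eq_div_div]
  rw [h1, h2] at h
  exact ⟨t * s, v, g, hv, h⟩

variable [CharZero C]

/-- `Y` may be rectangular: it identifies the system `G`, twisted by `h`, with a subconnection of
`A`. The left inverse `Z` ensures that an eigenvector stays nonzero after ramification. -/
theorem hasEigenvector_of_gauge [DecidableEq j] {A : Matrix n n C⸨X⸩} {G : Matrix j j C⸨X⸩}
    {Y : Matrix n j C⸨X⸩} {Z : Matrix j n C⸨X⸩} (hZ : Z * Y = 1) (h : C⸨X⸩)
    (hY : Y.map (eulerDer c) + A * Y - h • Y = Y * G) (hG : HasEigenvector c G) :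
    HasEigenvector c A := by
  obtain ⟨t, w, g, hw, hg⟩ := hG
  have hYt : (Y.map (expand t)).map (eulerDer (c / ((t : ℕ) : C)))
      + A.map (expand t) * Y.map (expand t) - expand t h • Y.map (expand t)
      = Y.map (expand t) * G.map (expand t) := by
    have := congrArg (fun M => M.map (expand t)) hY
    simp only [Matrix.map_mul] at this
    rw [← this]
    ext a b : 2
    simp [eulerDer_expand, Matrix.mul_apply]
  refine ⟨t, Y.map (expand t) *ᵥ w, g + expand t h, fun h0 => hw ?_, fun i => ?_⟩
  · have h1 : Z.map (expand t) * Y.map (expand t) = 1 := by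
      rw [← Matrix.map_mul, hZ, Matrix.map_one _ (map_zero _) (map_one _)]
    have := congrArg (fun v => Z.map (expand t) *ᵥ v) h0
    simpa [Matrix.mulVec_mulVec, h1] using this
  · have e1 : (fun k => eulerDer (c / ((t : ℕ) : C)) (w k))
        = g • w - G.map (expand t) *ᵥ w := by
      ext k : 1
      rw [Pi.sub_apply, Pi.smul_apply, smul_eq_mul, ← hg k]
      ring
    rw [derivation_mulVec, e1, Matrix.mulVec_mulVec, mulVec_sub, Matrix.mulVec_mulVec, ← hYt,
      mulVec_smul, sub_mulVec, add_mulVec, smul_mulVec]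
    simp only [Pi.add_apply, Pi.sub_apply, Pi.smul_apply, smul_eq_mul]
    ring

end Gauge

theorem exists_left_inverse_of_linearIndependent {K n k : Type*} [Field K] [Fintype n]
    [DecidableEq n] [Fintype k] [DecidableEq k] {Y : Matrix n k K}
    (hY : LinearIndependent K fun l i => Y i l) : ∃ Z : Matrix k n K, Z * Y = 1 := by
  have hinj : LinearMap.ker (Matrix.toLin' Y) = ⊥ := by
    rw [LinearMap.ker_eq_bot']
    intro x hx
    ext l
    refine Fintype.linearIndependent_iff.1 hY x ?_ l
    ext i
    have := congrFun hx i
    rw [Matrix.toLin'_apply] at this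
    rw [Finset.sum_apply]
    refine Eq.trans (Finset.sum_congr rfl fun a _ => ?_) this
    exact mul_comm _ _
  obtain ⟨g, hg⟩ := LinearMap.exists_leftInverse_of_injective _ hinj
  refine ⟨LinearMap.toMatrix' g, ?_⟩
  rw [← LinearMap.toMatrix'_toLin' Y, ← LinearMap.toMatrix'_comp, hg, LinearMap.toMatrix'_id]

section Integral

open Matrix

variable {C : Type u} [Field C] [IsAlgClosed C] [CharZero C] {c : C}

/-- The spectrum is finite, so one can take the last eigenvalue met on going down from a given one
in steps of `c`. This nonresonance permits lifting an eigenvector order by order. -/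
theorem exists_eigenvalue_sub_not_eigenvalue {V : Type*} [AddCommGroup V] [Module C V]
    [Module.Finite C V] [Nontrivial V] (f : Module.End C V) (hc : c ≠ 0) :
    ∃ μ, f.HasEigenvalue μ ∧ ∀ m : ℕ, 1 ≤ m → ¬ f.HasEigenvalue (μ - c * m) := by
  obtain ⟨μ₀, hμ₀⟩ := Module.End.exists_eigenvalue f
  let S : Set ℕ := {m | f.HasEigenvalue (μ₀ - c * m)}
  have hS : S.Finite := by
    have hfin : {μ | f.HasEigenvalue μ}.Finite := f.finite_hasEigenvalue
    refine hfin.preimage (f := fun m : ℕ => μ₀ - c * m) ?_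
    intro a _ b _ hab
    have : c * (a : C) = c * b := by simpa using hab
    exact_mod_cast mul_left_cancel₀ hc this
  have h0 : (0 : ℕ) ∈ S := by simpa [S] using hμ₀
  obtain ⟨m, hm, hmax⟩ := hS.exists_maximal ⟨0, h0⟩
  refine ⟨μ₀ - c * m, hm, fun k hk h => ?_⟩
  have h1 : m + k ∈ S := by
    change f.HasEigenvalue (μ₀ - c * ((m + k : ℕ) : C))
    have e : μ₀ - c * ((m + k : ℕ) : C) = μ₀ - c * m - c * k := by push_cast; ring
    rw [e]; exact h
  have := hmax h1 (by simp)
  simp at this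
  omega

/-- A regular singular system has an eigenvector. -/
theorem hasEigenvector_of_integral {n : Type*} [Fintype n] [DecidableEq n] [Nonempty n]
    (hc : c ≠ 0) (B : Matrix n n C⟦X⟧) :
    HasEigenvector c (B.map (HahnSeries.ofPowerSeries ℤ C)) := by
  set B₀ := B.map (PowerSeries.coeff 0)
  obtain ⟨μ, hμ, hμm⟩ := exists_eigenvalue_sub_not_eigenvalue (toLin' B₀) hc
  obtain ⟨v₀, hv₀⟩ := hμ.exists_hasEigenvector
  have hv₁ : B₀ *ᵥ v₀ = μ • v₀ := by simpa using hv₀.apply_eq_smul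
  -- At order `m` one has to invert `B₀ - (μ - c m)`, which is possible by the choice of `μ`; `G`
  -- can therefore stay equal to the constant `μ`.
  obtain ⟨Y, G, hY, hG, hG', hYG⟩ := exists_formal_block (j := Unit) c 0 B
    (Matrix.of fun i _ => v₀ i) (Matrix.of fun _ _ => μ) (fun G => G = 0)
    (by
      ext i k
      have := congrFun hv₁ i
      simp only [Matrix.mul_apply, Matrix.of_apply, Finset.univ_unique, Finset.sum_singleton]
      rw [mul_comm]
      exact this)
    (by
      intro m hm Z
      have hunit : IsUnit (toLin' B₀ - algebraMap C (Module.End C (n → C)) (μ - c * m)) := by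
        have := hμm m hm
        rw [Module.End.hasEigenvalue_iff_mem_spectrum, spectrum.mem_iff, not_not,
          IsUnit.sub_iff] at this
        exact this
      obtain ⟨y, hy⟩ := ((Module.End.isUnit_iff _).1 hunit).2 fun i => Z i ()
      refine ⟨Matrix.of fun i _ => y i, 0, rfl, ?_⟩
      ext i k
      have h1 := congrFun hy i
      simp only [LinearMap.sub_apply, toLin'_apply, Module.algebraMap_end_apply, Pi.sub_apply,
        Pi.smul_apply, smul_eq_mul] at h1
      rw [← h1]
      simp [Matrix.mul_apply, mulVec, dotProduct, B₀]
      ring)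
  let v : n → C⟦X⟧ := fun i => Y i ()
  have hGc : G = Matrix.of fun _ _ => PowerSeries.C μ := by
    ext a b m
    by_cases hm : m = 0
    · subst hm
      have := congrFun (congrFun hG a) b
      simpa using this
    · have := congrFun (congrFun (hG' m (by omega)) a) b
      simp only [Matrix.map_apply, Matrix.zero_apply] at this
      rw [this]
      simp [PowerSeries.coeff_C, hm]
  refine hasEigenvector_of_unramified (v := fun i => (v i : C⸨X⸩)) (g := algebraMap C C⸨X⸩ μ)
    (fun h0 => hv₀.2 ?_) fun i => ?_
  · ext i
    have h1 : v i = 0 := HahnSeries.ofPowerSeries_injective (Γ := ℤ) (R := C) (by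
      rw [map_zero]; exact congrFun h0 i)
    have h2 := congrFun (congrFun hY i) ()
    simp only [Matrix.map_apply, Matrix.of_apply] at h2
    rw [← h2]
    change PowerSeries.coeff 0 (v i) = 0
    rw [h1, map_zero]
  · have h1 := congrFun (congrFun hYG i) ()
    rw [hGc] at h1
    simp only [pow_zero, one_smul, Matrix.add_apply, Matrix.map_apply, Matrix.mul_apply,
      Finset.univ_unique, Finset.sum_singleton, Matrix.of_apply] at h1
    have h2 := congrArg (HahnSeries.ofPowerSeries ℤ C) h1
    rw [eulerDer_coe]
    simp only [map_add, map_sum, map_mul, HahnSeries.ofPowerSeries_C] at h2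
    simp only [mulVec, dotProduct, Matrix.map_apply]
    rw [algebraMap_laurent, mul_comm]
    exact h2

/-- Solvability of the Sylvester equation attached to a generalized eigenspace. -/
theorem exists_sylvester {n k : Type*} [Fintype n] [DecidableEq n] [Fintype k] [DecidableEq k]
    (B₀ : Matrix n n C) (μ : C) {V : Submodule C (n → C)}
    (hV : V = Module.End.maxGenEigenspace (toLin' B₀) μ) (β : Module.Basis k C V)
    {Y₀ : Matrix n k C} (hY₀ : Y₀ = Matrix.of fun i l => (β l : n → C) i)
    {G₀ : Matrix k k C} (hG₀ : B₀ * Y₀ = Y₀ * G₀) {Z₀ : Matrix k n C} (hZ₀ : Z₀ * Y₀ = 1)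
    (Z : Matrix n k C) : ∃ (Y : Matrix n k C) (G : Matrix k k C),
      B₀ * Y - Y * G₀ - Y₀ * G = Z := by
  obtain ⟨M, hM⟩ : ∃ M : Matrix n n C, M = B₀ - μ • 1 := ⟨_, rfl⟩
  obtain ⟨ν, hν⟩ : ∃ ν : Matrix k k C, ν = G₀ - μ • 1 := ⟨_, rfl⟩
  have hpow : ∀ m : ℕ, (toLin' B₀ - μ • (1 : Module.End C (n → C))) ^ m = toLin' (M ^ m) := by
    intro m
    rw [Matrix.toLin'_pow, hM, map_sub, map_smul, Matrix.toLin'_one]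
    rfl
  obtain ⟨N, hN⟩ : ∃ N : ℕ, ∀ v, v ∈ V ↔ M ^ N *ᵥ v = 0 := by
    refine ⟨Module.finrank C (n → C), fun v => ?_⟩
    rw [hV, Module.End.maxGenEigenspace_eq_genEigenspace_finrank,
      Module.End.mem_genEigenspace_nat, LinearMap.mem_ker, hpow, toLin'_apply]
  -- `S` consists of the matrices with all columns in `V`, that is, of the products `Y₀ * G`. It
  -- therefore suffices to solve `B₀ Y - Y G₀ = Z` modulo `S`.
  let S : Submodule C (Matrix n k C) :=
    { carrier := {Y | ∀ l, (fun i => Y i l) ∈ V}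
      add_mem' := fun {a b} ha hb l => V.add_mem (ha l) (hb l)
      zero_mem' := fun l => V.zero_mem
      smul_mem' := fun a Y hY l => V.smul_mem a (hY l) }
  have hS : ∀ Y, Y ∈ S ↔ M ^ N * Y = 0 := by
    intro Y
    constructor
    · intro h
      ext i l
      exact congrFun ((hN _).1 (h l)) i
    · intro h l
      refine (hN _).2 ?_
      ext i
      exact congrFun (congrFun h i) l
  have hSl : ∀ Y ∈ S, ∀ m, M ^ m * Y ∈ S := by
    intro Y hY m
    rw [hS] at hY ⊢
    rw [← Matrix.mul_assoc, ← pow_add, add_comm, pow_add, Matrix.mul_assoc, hY, Matrix.mul_zero]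
  have hSr : ∀ Y ∈ S, ∀ X : Matrix k k C, Y * X ∈ S := by
    intro Y hY X
    rw [hS] at hY ⊢
    rw [← Matrix.mul_assoc, hY, Matrix.zero_mul]
  have hSG : ∀ Y ∈ S, ∃ G : Matrix k k C, Y = Y₀ * G := by
    intro Y hY
    refine ⟨Matrix.of fun a l => β.repr (⟨fun i => Y i l, hY l⟩ : V) a, ?_⟩
    ext i l
    have h1 := congrArg (fun v : V => (v : n → C) i) (β.sum_repr (⟨fun i => Y i l, hY l⟩ : V))
    simp only [AddSubmonoidClass.coe_finsetSum, Submodule.coe_smul, Finset.sum_apply,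
      Pi.smul_apply, smul_eq_mul] at h1
    rw [← h1, hY₀, Matrix.mul_apply]
    exact Finset.sum_congr rfl fun a _ => mul_comm _ _
  have hY₀S : Y₀ ∈ S := fun l => by
    rw [hY₀]
    exact (β l).2
  have hMY : M * Y₀ = Y₀ * ν := by
    rw [hM, hν, Matrix.sub_mul, Matrix.mul_sub, hG₀]
    simp
  have hMYp : ∀ m : ℕ, M ^ m * Y₀ = Y₀ * ν ^ m := by
    intro m
    induction m with
    | zero => simp
    | succ m ih => rw [pow_succ, Matrix.mul_assoc, hMY, ← Matrix.mul_assoc, ih, Matrix.mul_assoc,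
        pow_succ]
  have hνN : ν ^ N = 0 := by
    have h1 := hMYp N
    rw [(hS _).1 hY₀S] at h1
    have h2 := congrArg (fun X => Z₀ * X) h1
    simp only [Matrix.mul_zero, ← Matrix.mul_assoc, hZ₀, Matrix.one_mul] at h2
    exact h2.symm
  let T : Matrix n k C →ₗ[C] Matrix n k C :=
    { toFun := fun Y => M * Y - Y * ν
      map_add' := fun X Y => by rw [Matrix.mul_add, Matrix.add_mul]; abel
      map_smul' := fun a Y => by simp [smul_sub] }
  have hTS : S ≤ S.comap T := fun Y hY => by
    have := hSl Y hY 1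
    rw [pow_one] at this
    exact S.sub_mem this (hSr Y hY ν)
  -- Modulo `S`, the hypothesis lets powers of `M` on the left be traded for powers of the nilpotent
  -- `ν` on the right. Hence `M ^ N * Y ∈ S`, so `M ^ (N + N)` kills the columns of `Y`, which then
  -- lie in `V`.
  have hker : ∀ Y, T Y ∈ S → Y ∈ S := by
    intro Y hY
    have h1 : ∀ m : ℕ, M ^ m * Y - Y * ν ^ m ∈ S := by
      intro m
      induction m with
      | zero => simp
      | succ m ih =>
        have e : M ^ (m + 1) * Y - Y * ν ^ (m + 1)
            = M ^ m * (M * Y - Y * ν) + (M ^ m * Y - Y * ν ^ m) * ν := by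
          rw [pow_succ, pow_succ, Matrix.mul_sub, Matrix.sub_mul]
          simp only [Matrix.mul_assoc]
          abel
        rw [e]
        exact S.add_mem (hSl _ hY m) (hSr _ ih ν)
    have h2 := h1 N
    rw [hνN, Matrix.mul_zero, sub_zero, hS, ← Matrix.mul_assoc, ← pow_add] at h2
    intro l
    have h3 : M ^ (N + N) *ᵥ (fun i => Y i l) = 0 := by
      ext i
      exact congrFun (congrFun h2 i) l
    rw [hV, Module.End.mem_maxGenEigenspace]
    exact ⟨N + N, by rw [hpow, toLin'_apply, h3]⟩
  -- An injective endomorphism of the finite-dimensional quotient by `S` is surjective.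
  have hsurj : Function.Surjective (S.mapQ S T hTS) := by
    rw [← LinearMap.injective_iff_surjective, ← LinearMap.ker_eq_bot, Submodule.ker_mapQ]
    rw [eq_bot_iff, Submodule.map_le_iff_le_comap, Submodule.comap_bot, Submodule.ker_mkQ]
    exact hker
  obtain ⟨Q, hQ⟩ := hsurj (S.mkQ Z)
  obtain ⟨Y, rfl⟩ := S.mkQ_surjective Q
  rw [Submodule.mkQ_apply, Submodule.mapQ_apply, ← Submodule.mkQ_apply, ← sub_eq_zero, ← map_sub, Submodule.mkQ_apply,
    Submodule.Quotient.mk_eq_zero] at hQ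
  obtain ⟨G, hG⟩ := hSG _ hQ
  refine ⟨Y, G, ?_⟩
  rw [← hG]
  have : T Y = B₀ * Y - Y * G₀ := by
    change M * Y - Y * ν = _
    rw [hM, hν, Matrix.sub_mul, Matrix.mul_sub]
    simp
  rw [this]
  abel

/-- An irregular system whose leading matrix has two eigenvalues reduces to a smaller one. -/
theorem hasEigenvector_of_irregular {n : ℕ} (hn : 1 ≤ n)
    (IH : ∀ k, 1 ≤ k → k < n → ∀ G : Matrix (Fin k) (Fin k) C⸨X⸩, HasEigenvector c G)
    {r : ℕ} (hr : 1 ≤ r) (B : Matrix (Fin n) (Fin n) C⟦X⟧)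
    (hB : ∀ μ, Module.End.maxGenEigenspace (toLin' (B.map (PowerSeries.coeff 0))) μ ≠ ⊤) :
    HasEigenvector c ((HahnSeries.single (-(r : ℤ)) (1 : C)) •
      B.map (HahnSeries.ofPowerSeries ℤ C)) := by
  set B₀ := B.map (PowerSeries.coeff 0) with hB₀
  have : Nonempty (Fin n) := ⟨⟨0, hn⟩⟩
  obtain ⟨μ, hμ⟩ := Module.End.exists_eigenvalue (toLin' B₀)
  set V := Module.End.maxGenEigenspace (toLin' B₀) μ with hV
  let β := Module.finBasis C V
  set k := Module.finrank C V
  have hk1 : 1 ≤ k := by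
    have h1 : V ≠ ⊥ := fun h0 => hμ (le_bot_iff.1 (h0 ▸ Module.End.eigenspace_le_maxGenEigenspace))
    have := Submodule.one_le_finrank_iff.2 h1
    exact this
  have hkn : k < n := by
    have := Submodule.finrank_lt (hB μ)
    simpa using this
  let Y₀ : Matrix (Fin n) (Fin k) C := Matrix.of fun i l => (β l : Fin n → C) i
  have hVs : ∀ x ∈ V, toLin' B₀ x ∈ V := by
    intro x hx
    exact Module.End.mapsTo_maxGenEigenspace_of_comm (Commute.refl _) μ hx
  let G₀ : Matrix (Fin k) (Fin k) C := LinearMap.toMatrix β β ((toLin' B₀).restrict hVs)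
  have hG₀ : B₀ * Y₀ = Y₀ * G₀ := by
    ext i l
    have h1 := congrArg (fun v : V => (v : Fin n → C) i)
      (β.sum_repr ((toLin' B₀).restrict hVs (β l)))
    simp only [AddSubmonoidClass.coe_finsetSum, Submodule.coe_smul, Finset.sum_apply,
      Pi.smul_apply, smul_eq_mul, LinearMap.coe_restrict_apply, toLin'_apply] at h1
    rw [Matrix.mul_apply, Matrix.mul_apply]
    refine h1.symm.trans (Finset.sum_congr rfl fun a _ => ?_)
    rw [mul_comm]
    simp only [Y₀, G₀, LinearMap.toMatrix_apply, Matrix.of_apply]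
  obtain ⟨Z₀, hZ₀⟩ : ∃ Z₀ : Matrix (Fin k) (Fin n) C, Z₀ * Y₀ = 1 := by
    exact exists_left_inverse_of_linearIndependent
      (β.linearIndependent.map' V.subtype (Submodule.ker_subtype _))
  -- Because `r ≥ 1`, the derivative does not touch the coefficient being determined, and only a
  -- Sylvester equation remains. The columns of `Y` then span a subconnection of rank `k < n`.
  obtain ⟨Y, G, hY, -, -, hYG⟩ := exists_formal_block c r B Y₀ G₀ (fun _ => True) hG₀ (by
    intro m _ Z
    obtain ⟨Y, G, h⟩ := exists_sylvester B₀ μ hV β rfl hG₀ hZ₀ Z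
    refine ⟨Y, G, trivial, ?_⟩
    rw [if_neg (by omega), zero_smul, zero_add]
    exact h)
  let φ := HahnSeries.ofPowerSeries ℤ C
  let W : Matrix (Fin k) (Fin k) C⟦X⟧ := Z₀.map PowerSeries.C * Y
  -- `Z₀ * Y` has constant term `Z₀ * Y₀ = 1`, hence is invertible over `C((x))` and yields a left
  -- inverse of `Y`.
  have hW : IsUnit (W.map φ) := by
    have h1 : PowerSeries.coeff 0 W.det = 1 := by
      rw [PowerSeries.coeff_zero_eq_constantCoeff_apply, RingHom.map_det]
      have : (PowerSeries.constantCoeff).mapMatrix W = Z₀ * Y₀ := by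
        rw [← hY]
        ext a b
        simp [W, Matrix.mul_apply]
      rw [this, hZ₀, Matrix.det_one]
    rw [Matrix.isUnit_iff_isUnit_det]
    have h2 : (W.map φ).det = φ W.det := (RingHom.map_det φ W).symm
    rw [h2, isUnit_iff_ne_zero]
    intro h0
    have : W.det = 0 := HahnSeries.ofPowerSeries_injective (Γ := ℤ) (R := C) (by
      rw [map_zero]; exact h0)
    rw [this] at h1
    simp at h1
  refine hasEigenvector_of_gauge (Y := Y.map φ)
    (Z := (W.map φ)⁻¹ * (Z₀.map PowerSeries.C).map φ)
    (G := (HahnSeries.single (-(r : ℤ)) (1 : C)) • G.map φ) ?_ 0 ?_ (IH k hk1 hkn _)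
  · rw [Matrix.mul_assoc, ← Matrix.map_mul]
    exact Matrix.nonsing_inv_mul _ ((Matrix.isUnit_iff_isUnit_det _).1 hW)
  · have h1 := congrArg (fun M => M.map φ) hYG
    have h2 : ((PowerSeries.X : C⟦X⟧) ^ r • Y.map (psEuler c) + B * Y).map φ
        = HahnSeries.single (r : ℤ) (1 : C) • (Y.map φ).map (eulerDer c)
          + B.map φ * Y.map φ := by
      rw [← Matrix.map_mul]
      ext a b : 2
      simp only [Matrix.map_apply, Matrix.add_apply, Matrix.smul_apply, smul_eq_mul, map_add,
        map_mul, map_pow]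
      rw [show φ PowerSeries.X = HahnSeries.single 1 1 from HahnSeries.ofPowerSeries_X,
        HahnSeries.single_pow]
      rw [show eulerDer c (φ (Y a b)) = φ (psEuler c (Y a b)) from eulerDer_coe c _]
      simp
    have h3 : HahnSeries.single (-(r : ℤ)) (1 : C) * HahnSeries.single (r : ℤ) 1 = 1 := by
      rw [HahnSeries.single_mul_single, one_mul, neg_add_cancel]; rfl
    simp only [h2, Matrix.map_mul] at h1
    rw [zero_smul, sub_zero, Matrix.mul_smul, ← h1, smul_add, smul_smul, h3, one_smul,
      Matrix.smul_mul]

end Integral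

end LogDec

/-! ### Companion systems and the Newton slope. -/

namespace LogDec

open Matrix

/-- The companion matrix of the relation `y_k = ∑ aᵢ yᵢ`. -/
def companionMatrix {R : Type*} [CommRing R] {k : ℕ} (a : Fin k → R) :
    Matrix (Fin k) (Fin k) R :=
  Matrix.of fun i j => (if (i : ℕ) = j + 1 then 1 else 0) + (if (j : ℕ) + 1 = k then a i else 0)

theorem companionMatrix_apply {R : Type*} [CommRing R] {k : ℕ} (a : Fin k → R) (i j : Fin k) :
    companionMatrix a i j
      = (if (i : ℕ) = j + 1 then 1 else 0) + (if (j : ℕ) + 1 = k then a i else 0) := rfl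

theorem companionMatrix_map {R S : Type*} [CommRing R] [CommRing S] {k : ℕ} (a : Fin k → R)
    (φ : R →+* S) : (companionMatrix a).map φ = companionMatrix fun i => φ (a i) := by
  ext i j
  simp only [Matrix.map_apply, companionMatrix_apply, map_add]
  congr 1 <;> split_ifs <;> simp

/-- The vanishing last entry makes the trace zero, so a single eigenvalue `μ` would satisfy `k μ =
0`. Then the matrix would be nilpotent, whereas its `k`-th power sends the first basis vector to `a
≠ 0`. -/
theorem maxGenEigenspace_companionMatrix_ne_top {K : Type*} [Field K] [CharZero K] {k : ℕ}
    (hk : 1 ≤ k) {a : Fin k → K} (hlast : ∀ i : Fin k, (i : ℕ) + 1 = k → a i = 0) (ha : a ≠ 0)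
    (μ : K) : Module.End.maxGenEigenspace (toLin' (companionMatrix a)) μ ≠ ⊤ := by
  intro htop
  set B := companionMatrix a with hB
  have hpow : (B - μ • 1) ^ k = 0 := by
    rw [Module.End.maxGenEigenspace_eq_genEigenspace_finrank] at htop
    have h1 : (toLin' B - μ • (1 : Module.End K (Fin k → K))) ^ k = 0 := by
      refine LinearMap.ext fun v => ?_
      have : v ∈ Module.End.genEigenspace (toLin' B) μ (Module.finrank K (Fin k → K)) := by
        rw [htop]; trivial
      rw [Module.End.mem_genEigenspace_nat, LinearMap.mem_ker, Module.finrank_fin_fun] at this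
      exact this
    have h2 : toLin' ((B - μ • 1) ^ k) = 0 := by
      rw [Matrix.toLin'_pow, map_sub, map_smul, Matrix.toLin'_one]
      exact h1
    exact (toLin' : Matrix (Fin k) (Fin k) K ≃ₗ[K] _).map_eq_zero_iff.1 h2
  have htr : B.trace = 0 := by
    refine Finset.sum_eq_zero fun i _ => ?_
    rw [diag_apply, hB, companionMatrix_apply, if_neg (by omega), zero_add]
    split_ifs with h
    · exact hlast i h
    · rfl
  have hμ : μ = 0 := by
    have h1 := (Matrix.isNilpotent_trace_of_isNilpotent (⟨k, hpow⟩ : IsNilpotent _)).eq_zero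
    rw [trace_sub, htr, trace_smul, trace_one, Fintype.card_fin, zero_sub, neg_eq_zero,
      smul_eq_mul, mul_eq_zero] at h1
    exact h1.resolve_right (by exact_mod_cast (by omega))
  rw [hμ, zero_smul, sub_zero] at hpow
  have hstep : ∀ j : ℕ, ∀ hj : j < k, (B ^ j) *ᵥ (Pi.single ⟨0, hk⟩ 1) = Pi.single ⟨j, hj⟩ 1 := by
    intro j
    induction j with
    | zero => intro hj; rw [pow_zero, Matrix.one_mulVec]
    | succ j ih =>
      intro hj
      rw [pow_succ', ← mulVec_mulVec, ih (by omega), mulVec_single_one]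
      ext i
      rw [col_apply, hB, companionMatrix_apply, if_neg (show ¬ j + 1 = k by omega), add_zero,
        Pi.single_apply]
      simp only [Fin.ext_iff]
  obtain ⟨κ, rfl⟩ := Nat.exists_eq_add_of_le' hk
  apply ha
  have h1 : (B ^ (κ + 1)) *ᵥ (Pi.single ⟨0, hk⟩ 1) = 0 := by rw [hpow, zero_mulVec]
  rw [pow_succ', ← mulVec_mulVec, hstep κ (by omega), mulVec_single_one] at h1
  ext i
  have := congrFun h1 i
  rw [col_apply, hB, companionMatrix_apply, if_neg (by simp; omega), if_pos rfl, zero_add] at this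
  exact this

variable {C : Type u} [Field C] [IsAlgClosed C] [CharZero C] {c : C}

theorem exists_powerSeries_of_coeff {a : C⸨X⸩} {p : ℤ} (h : ∀ n, a.coeff n ≠ 0 → -p ≤ n) :
    ∃ b : C⟦X⟧, (b : C⸨X⸩) = HahnSeries.single p 1 * a ∧ PowerSeries.coeff 0 b = a.coeff (-p) := by
  have hco : ∀ n : ℤ, (HahnSeries.single p (1 : C) * a).coeff n = a.coeff (n - p) := by
    intro n
    have := HahnSeries.coeff_single_mul_add (r := (1 : C)) (x := a) (a := n - p) (b := p)
    rw [sub_add_cancel, one_mul] at this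
    exact this
  refine ⟨PowerSeries.mk fun m => a.coeff (m - p), ?_, by simp⟩
  ext n
  rw [PowerSeries.coeff_coe, hco]
  split_ifs with hn
  · by_contra h0
    have := h _ (Ne.symm h0)
    omega
  · rw [PowerSeries.coeff_mk, Int.natAbs_of_nonneg (not_lt.1 hn)]

/-- Once the largest slope is an integer `r`, conjugation by `diag(x ^ (r i))` gives a pole of order
at most `r` with a companion matrix as leading term. For `r > 0` this matrix has trace zero and is
not nilpotent, so the irregular splitting applies; for `r = 0` the system is integral. -/
theorem hasEigenvector_companionMatrix (hc : c ≠ 0) {n k : ℕ} (hk : 1 ≤ k) (hkn : k ≤ n)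
    (IH : ∀ c : C, c ≠ 0 → ∀ k, 1 ≤ k → k < n → ∀ G : Matrix (Fin k) (Fin k) C⸨X⸩,
      HasEigenvector c G) (a : Fin k → C⸨X⸩) (hlast : ∀ i : Fin k, (i : ℕ) + 1 = k → a i = 0) :
    HasEigenvector c (companionMatrix a) := by
  classical
  -- After `x ↦ x ^ k!` all exponents occurring in `a i` are divisible by each of `1, …, k`, in
  -- particular by `k - i`, so the slopes are integers.
  let t : ℕ+ := ⟨k.factorial, k.factorial_pos⟩
  have ht : ((t : ℕ) : C) ≠ 0 := by exact_mod_cast t.ne_zero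
  refine hasEigenvector_of_expand t ?_
  generalize hc' : c / ((t : ℕ) : C) = c'
  have hc'0 : c' ≠ 0 := hc' ▸ div_ne_zero hc ht
  have hmap : (companionMatrix a).map (expand t) = companionMatrix fun i => expand t (a i) :=
    companionMatrix_map a (expand t : C⸨X⸩ →ₐ[C] C⸨X⸩).toRingHom
  rw [hmap]
  set a' : Fin k → C⸨X⸩ := fun i => expand t (a i) with ha'
  have hdvd : ∀ i n, (a' i).coeff n ≠ 0 → ((k : ℤ) - (i : ℕ)) ∣ n := by
    intro i n hn
    have h1 : ((t : ℕ) : ℤ) ∣ n := by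
      by_contra h
      exact hn (coeff_expand_of_not_dvd t _ h)
    refine dvd_trans ?_ h1
    have h2 : k - (i : ℕ) ∣ k.factorial := Nat.dvd_factorial (by omega) (by omega)
    have h3 : ((k - (i : ℕ) : ℕ) : ℤ) = (k : ℤ) - (i : ℕ) := by omega
    rw [← h3]
    exact_mod_cast h2
  have hlast' : ∀ i : Fin k, (i : ℕ) + 1 = k → a' i = 0 := fun i hi => by
    simp only [ha', hlast i hi, map_zero]
  have hex : ∃ r : ℕ, ∀ i n, (a' i).coeff n ≠ 0 → -((r : ℤ) * (k - (i : ℕ))) ≤ n := by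
    refine ⟨Finset.univ.sup fun i => (a' i).order.natAbs, fun i n hn => ?_⟩
    have h1 : (a' i).order ≤ n := HahnSeries.order_le_of_coeff_ne_zero hn
    have h2 : (a' i).order.natAbs ≤ Finset.univ.sup fun i => (a' i).order.natAbs :=
      Finset.le_sup (f := fun i => (a' i).order.natAbs) (Finset.mem_univ i)
    generalize Finset.univ.sup (fun i => (a' i).order.natAbs) = R at *
    have h3 : (1 : ℤ) ≤ (k : ℤ) - (i : ℕ) := by omega
    have h4 : (R : ℤ) * 1 ≤ R * ((k : ℤ) - (i : ℕ)) :=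
      mul_le_mul_of_nonneg_left h3 (Int.natCast_nonneg R)
    omega
  -- The least admissible `r`. If `r > 0`, the bound for `r - 1` fails at some exponent of some `a'
  -- i`; being divisible by `k - i`, that exponent equals `-r (k - i)`, so the bound for `r` is
  -- attained.
  obtain ⟨r, hr, hmin⟩ : ∃ r : ℕ, (∀ i n, (a' i).coeff n ≠ 0 → -((r : ℤ) * (k - (i : ℕ))) ≤ n) ∧
      (r = 0 ∨ ∃ i, (a' i).coeff (-((r : ℤ) * (k - (i : ℕ)))) ≠ 0) := by
    refine ⟨Nat.find hex, Nat.find_spec hex, ?_⟩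
    by_cases h0 : Nat.find hex = 0
    · exact Or.inl h0
    right
    have h1 := Nat.find_min hex (show Nat.find hex - 1 < Nat.find hex by omega)
    have h2 := Nat.find_spec hex
    push Not at h1
    obtain ⟨i, m, hm, hlt⟩ := h1
    refine ⟨i, ?_⟩
    have h3 := h2 i m hm
    obtain ⟨q, hq⟩ := hdvd i m hm
    generalize Nat.find hex = r at *
    have h4 : (0 : ℤ) < (k : ℤ) - (i : ℕ) := by omega
    have h5 : ((r - 1 : ℕ) : ℤ) = (r : ℤ) - 1 := by omega
    rw [h5] at hlt
    have h6 : q = -r := by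
      rw [hq] at hlt h3
      have e1 : q < -((r : ℤ) - 1) := by
        refine lt_of_mul_lt_mul_left (a := (k : ℤ) - (i : ℕ)) ?_ h4.le
        linarith [mul_comm ((r : ℤ) - 1) ((k : ℤ) - (i : ℕ))]
      have e2 : -(r : ℤ) ≤ q := by
        refine le_of_mul_le_mul_left (a := (k : ℤ) - (i : ℕ)) ?_ h4
        linarith [mul_comm (r : ℤ) ((k : ℤ) - (i : ℕ))]
      omega
    have h7 : -((r : ℤ) * (k - (i : ℕ))) = m := by rw [hq, h6]; ring
    rw [h7]
    exact hm
  choose b hb hb0 using fun i => exists_powerSeries_of_coeff (hr i)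
  rcases Nat.eq_zero_or_pos r with h0 | hr1
  · have e : companionMatrix a' = (companionMatrix b).map (HahnSeries.ofPowerSeries ℤ C) := by
      rw [companionMatrix_map]
      congr 1
      ext1 i
      have h1 := hb i
      rw [h0, Nat.cast_zero, zero_mul] at h1
      rw [h1]
      exact (one_mul _).symm
    have : Nonempty (Fin k) := ⟨⟨0, hk⟩⟩
    rw [e]
    exact hasEigenvector_of_integral hc'0 _
  obtain ⟨i₀, hi₀⟩ := hmin.resolve_left hr1.ne'
  -- The diagonal summand is the logarithmic derivative `c' r i` of `x ^ (r i)`, multiplied by the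
  -- `X ^ r` factored out. It has no constant term since `r ≥ 1`.
  let B : Matrix (Fin k) (Fin k) C⟦X⟧ := companionMatrix b
    + diagonal fun i : Fin k => PowerSeries.C (c' * r * (i : ℕ)) * PowerSeries.X ^ r
  have hB : HasEigenvector c' ((HahnSeries.single (-(r : ℤ)) (1 : C)) •
      B.map (HahnSeries.ofPowerSeries ℤ C)) := by
    refine hasEigenvector_of_irregular hk
      (fun k' h1 h2 G => IH c' hc'0 k' h1 (lt_of_lt_of_le h2 hkn) G) hr1 B fun μ => ?_
    have hB0 : B.map (PowerSeries.coeff 0) = companionMatrix fun i => PowerSeries.coeff 0 (b i) := by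
      have := companionMatrix_map b (PowerSeries.constantCoeff (R := C))
      simp only [← PowerSeries.coeff_zero_eq_constantCoeff_apply] at this
      rw [← this]
      ext i j
      simp only [B, Matrix.map_apply, Matrix.add_apply, map_add, diagonal_apply]
      rw [PowerSeries.coeff_zero_eq_constantCoeff_apply, add_eq_left]
      split_ifs
      · rw [PowerSeries.coeff_C_mul, PowerSeries.coeff_X_pow, if_neg (by omega), mul_zero]
      · exact map_zero _
    rw [hB0]
    refine maxGenEigenspace_companionMatrix_ne_top hk (fun i hi => ?_) (fun h => hi₀ ?_) μ
    · rw [hb0, hlast' i hi]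
      rfl
    · rw [← hb0 i₀]
      exact congrFun h i₀
  let X : ℤ → C⸨X⸩ := fun p => HahnSeries.single p 1
  have hX : ∀ p q, X p * X q = X (p + q) := fun p q => by
    simp only [X, HahnSeries.single_mul_single, one_mul]
  refine hasEigenvector_of_gauge (Y := diagonal fun i : Fin k => X (r * (i : ℕ)))
    (Z := diagonal fun i : Fin k => X (-(r * (i : ℕ)))) ?_ 0 ?_ hB
  · rw [diagonal_mul_diagonal, ← diagonal_one]
    congr 1
    ext1 i
    rw [hX, neg_add_cancel]
    rfl
  · rw [zero_smul, sub_zero]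
    refine Matrix.ext fun i j => ?_
    rw [Matrix.add_apply, mul_diagonal, diagonal_mul, Matrix.map_apply, Matrix.smul_apply,
      Matrix.map_apply, smul_eq_mul, diagonal_apply]
    simp only [B, Matrix.add_apply, map_add, diagonal_apply]
    have hd : eulerDer c' (if i = j then X (r * (i : ℕ)) else 0)
        = X (r * (i : ℕ)) * (HahnSeries.single (-(r : ℤ)) 1 * HahnSeries.ofPowerSeries ℤ C
          (if i = j then PowerSeries.C (c' * r * (i : ℕ)) * PowerSeries.X ^ r else 0)) := by
      split_ifs
      · have h1 : HahnSeries.single (-(r : ℤ)) (1 : C) * HahnSeries.single (r : ℤ) 1 = 1 := by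
          rw [HahnSeries.single_mul_single, one_mul, neg_add_cancel]; rfl
        rw [map_mul, map_pow, HahnSeries.ofPowerSeries_C, HahnSeries.ofPowerSeries_X,
          HahnSeries.single_pow, one_pow, nsmul_eq_mul, mul_one, eulerDer_single,
          algebraMap_laurent]
        push_cast
        simp only [X]
        rw [show c' * ((r : C) * ((i : ℕ) : C)) = c' * r * (i : ℕ) by ring]
        linear_combination (-(HahnSeries.C (c' * r * ((i : ℕ) : C))
          * HahnSeries.single ((r : ℤ) * (i : ℕ)) 1)) * h1
      · simp
    have hcomp : companionMatrix a' i j * X (r * (j : ℕ)) = X (r * (i : ℕ)) *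
        (HahnSeries.single (-(r : ℤ)) 1 * HahnSeries.ofPowerSeries ℤ C (companionMatrix b i j)) := by
      rw [companionMatrix_apply, companionMatrix_apply, map_add, add_mul, mul_add, mul_add]
      congr 1
      · split_ifs with h
        · rw [show HahnSeries.ofPowerSeries ℤ C 1 = 1 from map_one _, one_mul, mul_one]
          change _ = X _ * X _
          rw [hX, h]
          congr 1
          push_cast
          ring
        · simp
      · split_ifs with h
        · rw [hb]
          change _ = X _ * (X _ * (X _ * _))
          rw [← mul_assoc, ← mul_assoc, hX, hX, mul_comm]
          congr 2
          have : ((j : ℕ) : ℤ) = (k : ℤ) - 1 := by omega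
          rw [this]
          ring
        · simp
    rw [hd, hcomp]
    ring

end LogDec

/-! ### Cyclic families and the existence of an eigenvector. -/

namespace LogDec

open Matrix

section Cyclic

variable {C A E : Type*} [Field C] [Field A] [Algebra C A] [AddCommGroup E] [Module C E]
  [Module A E] [IsScalarTower C A E] {δ : Derivation C A A} {D : E →ₗ[C] E}

theorem span_image_Iio_succ (p : ℕ → E) (i : ℕ) :
    Submodule.span A (p '' Set.Iio (i + 1))
      = Submodule.span A {p i} ⊔ Submodule.span A (p '' Set.Iio i) := by
  rw [← Submodule.span_insert, ← Set.image_insert_eq]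
  congr 2
  ext j
  simp only [Set.mem_Iio, Set.mem_insert_iff]
  omega

theorem linearIndependent_of_notMem_span (p : ℕ → E) (k : ℕ)
    (h : ∀ i < k, p i ∉ Submodule.span A (p '' Set.Iio i)) :
    LinearIndependent A fun i : Fin k => p i := by
  induction k with
  | zero => exact linearIndependent_empty_type
  | succ k ih =>
    rw [linearIndependent_finSucc']
    refine ⟨ih fun i hi => h i (by omega), ?_⟩
    have hr : Set.range (Fin.init fun i : Fin (k + 1) => p i) = p '' Set.Iio k := by
      ext x
      constructor
      · rintro ⟨i, rfl⟩
        exact ⟨i, i.2, rfl⟩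
      · rintro ⟨i, hi, rfl⟩
        exact ⟨⟨i, hi⟩, rfl⟩
    rw [hr]
    exact h k (by omega)

/-- A cyclic vector of `E` is not needed: any nonzero `e` generates a cyclic submodule, and a
subconnection suffices for finding an eigenvector. The twist by `h` is a Tschirnhaus transformation,
which removes the coefficient of `q m` from the relation for `q (m + 1)`. -/
theorem exists_cyclic_family [CharZero A] [Module.Finite A E] [Nontrivial E]
    (hD : ∀ (f : A) (e : E), D (f • e) = δ f • e + f • D e) :
    ∃ (m : ℕ) (h : A) (q : ℕ → E), (LinearIndependent A fun i : Fin (m + 1) => q i) ∧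
      (∀ i, q (i + 1) = shift D h (q i)) ∧ q (m + 1) ∈ Submodule.span A (q '' Set.Iio m) := by
  classical
  obtain ⟨e, he⟩ := exists_ne (0 : E)
  let p : ℕ → E := fun i => (D ^ i) e
  have hp : ∀ i, D (p i) = p (i + 1) := fun i => by
    simp only [p, pow_succ', Module.End.mul_apply]
  let W : ℕ → Submodule A E := fun i => Submodule.span A (p '' Set.Iio i)
  have hW : ∀ i, W (i + 1) = Submodule.span A {p i} ⊔ W i := span_image_Iio_succ p
  have hWle : ∀ i, W i ≤ W (i + 1) := fun i => by rw [hW]; exact le_sup_right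
  have hpW : ∀ i, p i ∈ W (i + 1) := fun i => Submodule.subset_span ⟨i, Nat.lt_succ_self i, rfl⟩
  have hex : ∃ k, p k ∈ W k := by
    by_contra! hall
    have := (linearIndependent_of_notMem_span (A := A) p (Module.finrank A E + 1)
      fun i _ => hall i).fintype_card_le_finrank
    rw [Fintype.card_fin] at this
    omega
  obtain ⟨m, hm⟩ : ∃ m, Nat.find hex = m + 1 := by
    refine Nat.exists_eq_succ_of_ne_zero fun h0 => he ?_
    have := Nat.find_spec hex
    rw [h0] at this
    simpa [W, p] using this
  have hlast := Nat.find_spec hex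
  have hmin : ∀ i < m + 1, p i ∉ W i := fun i hi => Nat.find_min hex (by omega)
  rw [hm, hW, Submodule.mem_sup] at hlast
  obtain ⟨y, hy, z, hz, hyz⟩ := hlast
  obtain ⟨a, rfl⟩ := Submodule.mem_span_singleton.1 hy
  have hDW : ∀ i, ∀ w ∈ W i, D w ∈ W (i + 1) := by
    intro i w hw
    induction hw using Submodule.span_induction with
    | mem x hx =>
      obtain ⟨j, hj, rfl⟩ := hx
      rw [hp]
      exact Submodule.subset_span ⟨j + 1, Nat.succ_lt_succ hj, rfl⟩
    | zero => rw [map_zero]; exact Submodule.zero_mem _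
    | add x y _ _ hx hy => rw [map_add]; exact Submodule.add_mem _ hx hy
    | smul f x hx' hx =>
      rw [hD]
      exact Submodule.add_mem _ (Submodule.smul_mem _ _ (hWle i hx')) (Submodule.smul_mem _ _ hx)
  -- `a` is the coefficient of `D ^ m e` in `D ^ (m + 1) e`. Since `(D - h) ^ (m + 1) e` has second
  -- coefficient `-(m + 1) h`, this choice cancels it.
  let h : A := a / ((m + 1 : ℕ) : A)
  let q : ℕ → E := fun i => (shift D h ^ i) e
  have hq : ∀ i, q (i + 1) = shift D h (q i) := fun i => by
    simp only [q, pow_succ', Module.End.mul_apply]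
  have key : ∀ i : ℕ, q (i + 1) - p (i + 1) + (((i + 1 : ℕ) : A) * h) • p i ∈ W i := by
    intro i
    induction i with
    | zero =>
      have : q (0 + 1) - p (0 + 1) + (((0 + 1 : ℕ) : A) * h) • p 0 = 0 := by
        simp [p, q, shift_apply]
      rw [this]
      exact Submodule.zero_mem _
    | succ i ih =>
      set w := q (i + 1) - p (i + 1) + (((i + 1 : ℕ) : A) * h) • p i with hw
      have hqi : q (i + 1) = p (i + 1) - (((i + 1 : ℕ) : A) * h) • p i + w := by rw [hw]; abel
      have : q (i + 1 + 1) - p (i + 1 + 1) + (((i + 1 + 1 : ℕ) : A) * h) • p (i + 1)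
          = D w - h • w - (δ (((i + 1 : ℕ) : A) * h)) • p i
            + (h * (((i + 1 : ℕ) : A) * h)) • p i := by
        rw [hq (i + 1), shift_apply, hqi, map_add, map_sub, hD, hp, hp, smul_add, smul_sub,
          Nat.cast_succ (i + 1), add_mul, add_smul, one_mul, mul_smul h]
        abel
      rw [this]
      exact Submodule.add_mem _ (Submodule.sub_mem _ (Submodule.sub_mem _ (hDW i w ih)
        (Submodule.smul_mem _ _ (hWle i ih))) (Submodule.smul_mem _ _ (hpW i)))
        (Submodule.smul_mem _ _ (hpW i))
  have hqp : ∀ i, q i - p i ∈ W i := by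
    intro i
    cases i with
    | zero => simp [q, p]
    | succ i =>
      have := Submodule.sub_mem _ (hWle i (key i))
        (Submodule.smul_mem _ (((i + 1 : ℕ) : A) * h) (hpW i))
      rwa [add_sub_cancel_right] at this
  have hW' : ∀ i, Submodule.span A (q '' Set.Iio i) = W i := by
    intro i
    induction i with
    | zero => simp [W]
    | succ i ih =>
      rw [span_image_Iio_succ, hW, ih]
      apply le_antisymm <;> refine sup_le ?_ le_sup_right <;>
        rw [Submodule.span_singleton_le_iff_mem]
      · rw [← sub_add_cancel (q i) (p i)]
        exact Submodule.add_mem _ (le_sup_right (α := Submodule A E) (hqp i))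
          (le_sup_left (α := Submodule A E) (Submodule.mem_span_singleton_self _))
      · rw [← sub_sub_cancel (q i) (p i)]
        exact Submodule.sub_mem _
          (le_sup_left (α := Submodule A E) (Submodule.mem_span_singleton_self _))
          (le_sup_right (α := Submodule A E) (hqp i))
  refine ⟨m, h, q, linearIndependent_of_notMem_span q _ fun i hi hmem => hmin i hi ?_, hq, ?_⟩
  · rw [hW'] at hmem
    rw [← sub_sub_cancel (q i) (p i)]
    exact Submodule.sub_mem _ hmem (hqp i)
  · rw [hW']
    have hmA : ((m + 1 : ℕ) : A) ≠ 0 := Nat.cast_ne_zero.2 m.succ_ne_zero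
    have h1 := key m
    rw [show ((m + 1 : ℕ) : A) * h = a from mul_div_cancel₀ a hmA, ← hyz] at h1
    have := Submodule.add_mem _ h1 hz
    convert this using 1
    abel

end Cyclic

section MatrixConnection

variable {C A : Type*} [CommRing C] [CommRing A] [Algebra C A] {n : Type*} [Fintype n]

/-- The connection `δ + M` on the space of column vectors. -/
def matConn (δ : Derivation C A A) (M : Matrix n n A) : (n → A) →ₗ[C] (n → A) where
  toFun v i := δ (v i) + (M *ᵥ v) i
  map_add' v w := by
    ext i
    simp only [Pi.add_apply, map_add, mulVec_add]
    abel
  map_smul' a v := by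
    ext i
    simp only [Pi.smul_apply, Derivation.map_smul, mulVec_smul, smul_add, RingHom.id_apply]

theorem matConn_apply (δ : Derivation C A A) (M : Matrix n n A) (v : n → A) (i : n) :
    matConn δ M v i = δ (v i) + (M *ᵥ v) i := rfl

theorem matConn_smul (δ : Derivation C A A) (M : Matrix n n A) (f : A) (v : n → A) :
    matConn δ M (f • v) = δ f • v + f • matConn δ M v := by
  ext i
  simp only [Pi.add_apply, Pi.smul_apply, matConn_apply, mulVec_smul, smul_eq_mul,
    Derivation.leibniz]
  ring

end MatrixConnection

/-- Induction on the rank for all nonzero `c` at once, because ramification of degree `t` replaces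
`c` by `c / t`. -/
theorem hasEigenvector {C : Type u} [Field C] [IsAlgClosed C] [CharZero C] {c : C} (hc : c ≠ 0)
    {n : ℕ} (hn : 1 ≤ n) (M : Matrix (Fin n) (Fin n) C⸨X⸩) : HasEigenvector c M := by
  induction n using Nat.strong_induction_on generalizing c with
  | _ n IH =>
  have : Nonempty (Fin n) := ⟨⟨0, hn⟩⟩
  have : CharZero C⸨X⸩ := charZero_of_injective_algebraMap (algebraMap C C⸨X⸩).injective
  obtain ⟨m, h, q, hq, hstep, hlast⟩ := exists_cyclic_family (matConn_smul (eulerDer c) M)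
  have hmn : m + 1 ≤ n := by
    have := hq.fintype_card_le_finrank
    rwa [Fintype.card_fin, Module.finrank_fin_fun] at this
  have hr : q '' Set.Iio m = Set.range fun i : Fin m => q i := by
    ext x
    constructor
    · rintro ⟨i, hi, rfl⟩
      exact ⟨⟨i, hi⟩, rfl⟩
    · rintro ⟨i, rfl⟩
      exact ⟨i, i.2, rfl⟩
  rw [hr, Submodule.mem_span_range_iff_exists_fun] at hlast
  obtain ⟨a, ha⟩ := hlast
  let Y : Matrix (Fin n) (Fin (m + 1)) C⸨X⸩ := Matrix.of fun i l => q l i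
  obtain ⟨Z, hZ⟩ := exists_left_inverse_of_linearIndependent (Y := Y) hq
  -- The appended `0` is the coefficient of `q m`, as arranged by the twist; it is the trace
  -- condition for companion matrices.
  let a' : Fin (m + 1) → C⸨X⸩ := Fin.snoc a 0
  refine hasEigenvector_of_gauge hZ h (G := companionMatrix a') ?_
    (hasEigenvector_companionMatrix hc (Nat.le_add_left 1 m) hmn
      (fun c' hc' k hk hkn G => IH k hkn hc' hk G) a' fun i hi => ?_)
  · refine Matrix.ext fun i l => ?_
    have h1 := congrFun (hstep l) i
    rw [shift_apply, Pi.sub_apply, matConn_apply, Pi.smul_apply, smul_eq_mul] at h1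
    rw [Matrix.sub_apply, Matrix.add_apply, Matrix.smul_apply, Matrix.map_apply, smul_eq_mul,
      Matrix.mul_apply, Matrix.mul_apply]
    refine (Eq.trans ?_ h1.symm).trans ?_
    · rfl
    · simp only [companionMatrix_apply, mul_add, Finset.sum_add_distrib]
      by_cases hl : (l : ℕ) + 1 = m + 1
      · have hlm : (l : ℕ) = m := by omega
        rw [hlm, Fin.sum_univ_castSucc (fun x => Y i x * if m + 1 = m + 1 then a' x else 0)]
        rw [Finset.sum_eq_zero fun x _ => by rw [if_neg (by omega), mul_zero]]
        rw [← ha]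
        simp [a', Y, mul_comm]
      · rw [Finset.sum_eq_single (⟨l + 1, by omega⟩ : Fin (m + 1))]
        · have hlm : (l : ℕ) ≠ m := by omega
          simp [Y, hlm]
        · intro x _ hx
          rw [if_neg fun h => hx (Fin.ext h), mul_zero]
        · simp
  · have : i = Fin.last m := Fin.ext (by simpa using hi)
    rw [this]
    exact Fin.snoc_last _ _

end LogDec

/-! ### Spanning by generalized eigenvectors after ramification. -/

namespace LogDec

open Matrix

theorem map_mem_genEig {C A E E' : Type*} [Field C] [Field A] [Algebra C A] [AddCommGroup E]
    [Module C E] [Module A E] [IsScalarTower C A E] [AddCommGroup E'] [Module C E'] [Module A E']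
    [IsScalarTower C A E'] {D : E →ₗ[C] E} {D' : E' →ₗ[C] E'} {f : E →ₗ[A] E'}
    (hf : ∀ e, D' (f e) = f (D e)) {g : A} {v : E} (hv : v ∈ genEig D g) : f v ∈ genEig D' g := by
  obtain ⟨k, hk⟩ := mem_genEig.1 hv
  have h : ∀ (k : ℕ) (w : E), (shift D' g ^ k) (f w) = f ((shift D g ^ k) w) := by
    intro k
    induction k with
    | zero => simp
    | succ k ih =>
      intro w
      have h1 : shift D' g (f w) = f (shift D g w) := by
        rw [shift_apply, shift_apply, hf, map_sub, map_smul]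
      rw [pow_succ, pow_succ, Module.End.mul_apply, Module.End.mul_apply, ← ih, h1]
  exact mem_genEig.2 ⟨k, by rw [h, hk, map_zero]⟩

theorem map_genSpan_le {C A E E' : Type*} [Field C] [Field A] [Algebra C A] [AddCommGroup E]
    [Module C E] [Module A E] [IsScalarTower C A E] [AddCommGroup E'] [Module C E'] [Module A E']
    [IsScalarTower C A E'] {D : E →ₗ[C] E} {D' : E' →ₗ[C] E'} {f : E →ₗ[A] E'}
    (hf : ∀ e, D' (f e) = f (D e)) (G : Set A) :
    (genSpan D G).map f ≤ genSpan D' G := by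
  rw [Submodule.map_le_iff_le_comap]
  exact genSpan_induction fun g hg v hv => mem_genSpan hg (map_mem_genEig hf hv)

section Extension

variable {C A : Type*} [Field C] [Field A] [Algebra C A] {δ : Derivation C A A}

/-- The hypothesis says that `w` is an eigenvector of the dual connection; the formula is the
Leibniz rule for the pairing. It makes the kernel of `w` a subconnection. -/
theorem dotProduct_matConn {n : Type*} [Fintype n] {M : Matrix n n A} {w : n → A} {g : A}
    (hg : ∀ i, δ (w i) - (Mᵀ *ᵥ w) i = g * w i) (v : n → A) :
    w ⬝ᵥ matConn δ M v = δ (w ⬝ᵥ v) - g * (w ⬝ᵥ v) := by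
  have h1 : w ⬝ᵥ (M *ᵥ v) = (Mᵀ *ᵥ w) ⬝ᵥ v := by
    rw [dotProduct_mulVec, mulVec_transpose]
  have h2 : w ⬝ᵥ matConn δ M v = w ⬝ᵥ (fun i => δ (v i)) + w ⬝ᵥ (M *ᵥ v) :=
    dotProduct_add w (fun i => δ (v i)) (M *ᵥ v)
  rw [h2, h1]
  simp only [dotProduct, map_sum, Finset.mul_sum, ← Finset.sum_add_distrib,
    ← Finset.sum_sub_distrib]
  refine Finset.sum_congr rfl fun i _ => ?_
  rw [Derivation.leibniz, smul_eq_mul, smul_eq_mul]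
  linear_combination (-v i) * hg i

/-- `Y` is a basis of the hyperplane `w = 0`, `G` the matrix of the connection on it, and `Y * Z`
the projection onto it along `v`. Stated as matrix identities, these data survive a further
substitution `x ↦ x ^ t`. -/
theorem exists_kernel_basis {n : ℕ} {M : Matrix (Fin (n + 1)) (Fin (n + 1)) A}
    {w : Fin (n + 1) → A} {g : A} (hw : w ≠ 0) (hg : ∀ i, δ (w i) - (Mᵀ *ᵥ w) i = g * w i) :
    ∃ (Y : Matrix (Fin (n + 1)) (Fin n) A) (Z : Matrix (Fin n) (Fin (n + 1)) A)
      (G : Matrix (Fin n) (Fin n) A) (v : Fin (n + 1) → A), w ⬝ᵥ v = 1 ∧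
      1 = Y * Z + vecMulVec v w ∧ Y.map δ + M * Y = Y * G := by
  classical
  let φ : (Fin (n + 1) → A) →ₗ[A] A := dotProductBilin A A w
  have hφ : ∀ v, φ v = w ⬝ᵥ v := fun v => rfl
  obtain ⟨i₀, hi₀⟩ := Function.ne_iff.1 hw
  have hφ0 : φ (Pi.single i₀ (w i₀)⁻¹) = 1 := by
    rw [hφ, dotProduct_single, mul_inv_cancel₀ hi₀]
  have hφD := dotProduct_matConn hg
  have hrank : Module.finrank A (LinearMap.ker φ) = n := by
    have h1 := φ.finrank_range_add_finrank_ker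
    have h2 : LinearMap.range φ = ⊤ := by
      rw [LinearMap.range_eq_top]
      intro a
      exact ⟨a • Pi.single i₀ (w i₀)⁻¹, by rw [map_smul, hφ0, smul_eq_mul, mul_one]⟩
    rw [h2, finrank_top, Module.finrank_self, Module.finrank_fin_fun] at h1
    omega
  let b := Module.finBasisOfFinrankEq A (LinearMap.ker φ) hrank
  let Y : Matrix (Fin (n + 1)) (Fin n) A := of fun i l => (b l : Fin (n + 1) → A) i
  have hY : ∀ x, φ x = 0 → ∃ z : Fin n → A, Y *ᵥ z = x := by
    intro x hx
    refine ⟨b.repr ⟨x, hx⟩, ?_⟩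
    have h1 := congrArg (Subtype.val) (b.sum_repr ⟨x, hx⟩)
    rw [AddSubmonoidClass.coe_finsetSum] at h1
    ext i
    have h2 := congrFun h1 i
    rw [Finset.sum_apply] at h2
    refine Eq.trans ?_ h2
    change ∑ l, Y i l * b.repr ⟨x, hx⟩ l = ∑ l, b.repr ⟨x, hx⟩ l * Y i l
    exact Finset.sum_congr rfl fun l _ => mul_comm _ _
  have hYcol : ∀ l, φ (Y.col l) = 0 := fun l => (b l).2
  have hZ : ∀ j, ∃ z : Fin n → A, Y *ᵥ z = Pi.single j 1 - w j • Pi.single i₀ (w i₀)⁻¹ := by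
    intro j
    refine hY _ ?_
    rw [map_sub, map_smul, hφ0, hφ, dotProduct_single, smul_eq_mul, mul_one, sub_self]
  choose Z hZ using hZ
  have hG : ∀ l, ∃ z : Fin n → A, Y *ᵥ z = matConn δ M (Y.col l) := by
    intro l
    refine hY _ ?_
    rw [hφ, hφD, ← hφ, hYcol, map_zero, mul_zero, sub_zero]
  choose G hG using hG
  refine ⟨Y, (of Z)ᵀ, (of G)ᵀ, Pi.single i₀ (w i₀)⁻¹, hφ0, ?_, ?_⟩
  · refine Matrix.ext fun i j => ?_
    have h1 := congrFun (hZ j) i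
    rw [Pi.sub_apply, Pi.smul_apply, smul_eq_mul] at h1
    rw [Matrix.add_apply, vecMulVec_apply, one_apply, Matrix.mul_apply]
    have h2 : ∑ x, Y i x * (of Z)ᵀ x j = (Y *ᵥ Z j) i := rfl
    rw [h2, h1, Pi.single_apply]
    ring
  · refine Matrix.ext fun i l => ?_
    exact (congrFun (hG l) i).symm

/-- The hyperplane is spanned by assumption, and modulo it `v` is an eigenvector with eigenvalue
`-g`. A multiple `u • v` has a normalized eigenvalue in `P`, and `mem_genSpan_of_shift_mem` absorbs
the error in the hyperplane. -/
theorem genSpan_eq_top_of_kernel {P : Set A}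
    (hnorm : ∀ g : A, ∃ g' ∈ P, ∃ u, u ≠ 0 ∧ δ u = (g' - g) * u)
    (hsolve : ∀ g ∈ P, ∀ g' ∈ P, ∀ w, ∃ u, twist δ (g' - g) (twist δ (g' - g) u - w) = 0)
    {n : ℕ} {M : Matrix (Fin (n + 1)) (Fin (n + 1)) A} {w v : Fin (n + 1) → A} {g : A}
    {Y : Matrix (Fin (n + 1)) (Fin n) A} {Z : Matrix (Fin n) (Fin (n + 1)) A}
    {G : Matrix (Fin n) (Fin n) A} (hg : ∀ i, δ (w i) - (Mᵀ *ᵥ w) i = g * w i)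
    (hv : w ⬝ᵥ v = 1) (h1 : 1 = Y * Z + vecMulVec v w) (hG : Y.map δ + M * Y = Y * G)
    (hspan : genSpan (matConn δ G) P = ⊤) : genSpan (matConn δ M) P = ⊤ := by
  have hdec : ∀ z, z = Y *ᵥ (Z *ᵥ z) + (w ⬝ᵥ z) • v := by
    intro z
    have h2 := congrArg (· *ᵥ z) h1
    simp only [one_mulVec, add_mulVec, ← mulVec_mulVec] at h2
    conv_lhs => rw [h2]
    congr 1
    ext i
    simp only [mulVec, dotProduct, vecMulVec_apply, Pi.smul_apply, smul_eq_mul, Finset.sum_mul]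
    exact Finset.sum_congr rfl fun l _ => by ring
  have hYmem : ∀ z, Y *ᵥ z ∈ genSpan (matConn δ M) P := by
    intro z
    have hcomm : ∀ e, matConn δ M (Y.mulVecLin e) = Y.mulVecLin (matConn δ G e) := by
      intro e
      ext i
      rw [mulVecLin_apply, mulVecLin_apply, matConn_apply, derivation_mulVec, mulVec_mulVec]
      have h2 : Y *ᵥ (matConn δ G e) = (Y *ᵥ fun k => δ (e k)) + (Y * G) *ᵥ e := by
        rw [← mulVec_mulVec, ← mulVec_add]
        rfl
      rw [h2, ← hG, add_mulVec]
      simp only [Pi.add_apply]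
      ring
    refine map_genSpan_le (f := Y.mulVecLin) hcomm P ⟨z, ?_, rfl⟩
    rw [hspan]
    trivial
  obtain ⟨g', hg', u, hu, hu'⟩ := hnorm (-g)
  have hφD : w ⬝ᵥ (matConn δ M v) = -g := by
    rw [dotProduct_matConn hg, hv, Derivation.map_one_eq_zero, mul_one, zero_sub]
  have hshift : shift (matConn δ M) (-g) v ∈ genSpan (matConn δ M) P := by
    rw [hdec (shift (matConn δ M) (-g) v)]
    have e : w ⬝ᵥ shift (matConn δ M) (-g) v = 0 := by
      rw [shift_apply, dotProduct_sub, hφD, dotProduct_smul, hv, smul_eq_mul, mul_one, sub_self]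
    rw [e, zero_smul, add_zero]
    exact hYmem _
  have huv : u • v ∈ genSpan (matConn δ M) P := by
    refine mem_genSpan_of_shift_mem (matConn_smul δ M) hg' (hsolve g' hg') ?_
    rw [shift_smul (matConn_smul δ M) g' (-g), hu',
      show (g' - -g) * u + (-g - g') * u = 0 by ring, zero_smul, zero_add]
    exact Submodule.smul_mem _ _ hshift
  have hvmem : v ∈ genSpan (matConn δ M) P := by
    have := Submodule.smul_mem _ u⁻¹ huv
    rwa [smul_smul, inv_mul_cancel₀ hu, one_smul] at this
  rw [eq_top_iff]
  intro z _
  rw [hdec z]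
  exact Submodule.add_mem _ (hYmem _) (Submodule.smul_mem _ _ hvmem)

end Extension

variable {C : Type u} [Field C] [CharZero C]

variable (C) in
/-- The Laurent series without positive powers of the variable. -/
def polarSet : Set C⸨X⸩ := {g | ∃ a f, IsPolarLaurent f ∧ g = algebraMap C C⸨X⸩ a + f}

theorem exists_twist_twist_sub_eq_zero_of_mem_polarSet (c : C) {g g' : C⸨X⸩}
    (hg : g ∈ polarSet C) (hg' : g' ∈ polarSet C) (w : C⸨X⸩) :
    ∃ u, twist (eulerDer c) (g' - g) (twist (eulerDer c) (g' - g) u - w) = 0 := by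
  obtain ⟨a, f, hf, rfl⟩ := hg
  obtain ⟨a', f', hf', rfl⟩ := hg'
  have h : algebraMap C C⸨X⸩ a' + f' - (algebraMap C C⸨X⸩ a + f)
      = algebraMap C C⸨X⸩ (a' - a) + (f' - f) := by
    rw [map_sub]; ring
  rw [h]
  refine exists_twist_twist_sub_eq_zero c (fun n hn => ?_) w
  rw [HahnSeries.coeff_sub, hf n hn, hf' n hn, sub_zero]

/-- After ramification, a connection is spanned by generalized eigenvectors. -/
theorem exists_genSpan_matConn_eq_top [IsAlgClosed C] {c : C} (hc : c ≠ 0) {n : ℕ}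
    (M : Matrix (Fin n) (Fin n) C⸨X⸩) : ∃ t : ℕ+,
      genSpan (matConn (eulerDer (c / ((t : ℕ) : C))) (M.map (expand t))) (polarSet C) = ⊤ := by
  induction n generalizing c with
  | zero => exact ⟨1, Subsingleton.elim _ _⟩
  | succ n ih =>
    -- The dual of `δ + M` is `δ - Mᵀ`. The induction continues on the kernel of the eigenvector
    -- found, and the ramification indices multiply.
    obtain ⟨t, w, g, hw, hg⟩ := hasEigenvector hc (Nat.le_add_left 1 n) (-Mᵀ)
    have ht : ((t : ℕ) : C) ≠ 0 := by exact_mod_cast t.ne_zero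
    have hg' : ∀ i, eulerDer (c / ((t : ℕ) : C)) (w i) - ((M.map (expand t))ᵀ *ᵥ w) i
        = g * w i := by
      intro i
      rw [← hg i]
      have : (-Mᵀ).map (expand t) = -((M.map (expand t))ᵀ) :=
        Matrix.ext fun a b => map_neg (expand t) (M b a)
      rw [this, neg_mulVec, Pi.neg_apply, sub_eq_add_neg]
    obtain ⟨Y, Z, G, v, hv, h1, hG⟩ := exists_kernel_basis hw hg'
    obtain ⟨t', ht'⟩ := ih (div_ne_zero hc ht) G
    refine ⟨t * t', ?_⟩
    have ht'0 : ((t' : ℕ) : C) ≠ 0 := by exact_mod_cast t'.ne_zero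
    have hM : M.map (expand (t * t')) = (M.map (expand t)).map (expand t') :=
      Matrix.ext fun a b => (expand_expand t t' (M a b)).symm
    have hcc : c / (((t * t' : ℕ+) : ℕ) : C) = c / ((t : ℕ) : C) / ((t' : ℕ) : C) := by
      rw [PNat.mul_coe, Nat.cast_mul, div_mul_eq_div_div]
    rw [hM, hcc]
    have hc₁ := div_ne_zero hc ht
    generalize M.map (expand t) = M₁ at *
    generalize c / ((t : ℕ) : C) = c₁ at *
    have hδ := eulerDer_expand c₁ t'
    let ψ : C⸨X⸩ →+* C⸨X⸩ := (expand t' : C⸨X⸩ →ₐ[C] C⸨X⸩).toRingHom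
    have hψ : ∀ f, expand t' f = ψ f := fun _ => rfl
    replace hc₁ := div_ne_zero hc₁ ht'0
    refine genSpan_eq_top_of_kernel (w := ψ ∘ w) (v := ψ ∘ v) (g := ψ g) (Y := Y.map ψ)
      (Z := Z.map ψ) ?_ ?_ ?_ ?_ ?_ ?_ ht'
    · intro g
      obtain ⟨a, f, u, hf, hu, h⟩ := exists_normal_form hc₁ g
      exact ⟨_, ⟨a, f, hf, rfl⟩, u, hu, h⟩
    · exact fun g hg g' hg' w => exists_twist_twist_sub_eq_zero_of_mem_polarSet _ hg hg' w
    · intro i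
      have h2 := congrArg ψ (hg' i)
      rw [map_sub, map_mul] at h2
      rw [Function.comp_apply, ← h2]
      congr 1
      · exact hδ (w i)
      · rw [RingHom.map_mulVec]
        rfl
    · rw [← RingHom.map_dotProduct, hv, map_one]
    · have h2 := congrArg (fun Q => Q.map ψ) h1
      rw [Matrix.map_one _ (map_zero ψ) (map_one ψ), Matrix.map_add _ (map_add ψ),
        Matrix.map_mul] at h2
      rw [h2]
      congr 1
      exact Matrix.ext fun i j => map_mul ψ _ _
    · have h2 := congrArg (fun Q => Q.map ψ) hG
      rw [Matrix.map_add _ (map_add ψ), Matrix.map_mul, Matrix.map_mul] at h2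
      refine Eq.trans ?_ h2
      congr 1
      exact Matrix.ext fun i j => hδ (Y i j)

end LogDec

/-! ### Jordan bases with normalized eigenvalues and their polar part. -/

namespace LogDec

variable {C : Type u} {A : Type v} {E : Type w} [Field C] [Field A] [Algebra C A]
  [AddCommGroup E] [Module C E] [Module A E] [IsScalarTower C A E]
  {δ : Derivation C A A} {D : E →ₗ[C] E} {c : C} {Q : Set A}

/-- The properties of the derivation `c x d/dx` of `C((x))` on which the Jordan form of a connection
depends; `Q` is a set of polar parts. -/
structure IsEulerDerivation (δ : Derivation C A A) (c : C) (Q : Set A) : Prop where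
  const : ∀ a, δ (δ a) = 0 → a ∈ (algebraMap C A).range
  exists_unit : ∀ p : ℤ, ∃ u, u ≠ 0 ∧ δ u = algebraMap C A (c * p) * u
  eq_of_eq_mul : ∀ a : C, ∀ f ∈ Q, ∀ f' ∈ Q, ∀ u, u ≠ 0 →
    δ u = (algebraMap C A a + (f - f')) * u → f = f' ∧ ∃ p : ℤ, a = c * p

/-- A basis in which `D` has Jordan form, with eigenvalues `a i + f i`. -/
structure JordanBasis (C : Type u) {A : Type v} {E : Type w} [Field C] [Field A] [Algebra C A]
    [AddCommGroup E] [Module C E] [Module A E] (D : E →ₗ[C] E) (Q : Set A) where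
  κ : Type v
  fintype : Fintype κ
  r : κ → ℕ
  basis : Module.Basis ((i : κ) × Fin (r i)) A E
  a : κ → C
  f : κ → A
  f_mem : ∀ i, f i ∈ Q
  apply_basis : ∀ i j, D (basis ⟨i, j⟩) = (algebraMap C A (a i) + f i) • basis ⟨i, j⟩ +
    if h : (j : ℕ) + 1 < r i then basis ⟨i, ⟨j + 1, h⟩⟩ else 0

theorem exists_representatives (c : C) : ∃ ρ : C → C,
    (∀ a, ∃ p : ℤ, ρ a - a = c * p) ∧ ∀ a b, (∃ p : ℤ, a - b = c * p) → ρ a = ρ b := by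
  let H := AddSubgroup.zmultiples c
  have hH : ∀ x : C, x ∈ H ↔ ∃ p : ℤ, x = c * p := fun x => by
    simp only [H, AddSubgroup.mem_zmultiples_iff, zsmul_eq_mul, mul_comm c, eq_comm]
  refine ⟨fun a => (QuotientAddGroup.mk a : C ⧸ H).out, fun a => ?_, fun a b hab => ?_⟩
  · rw [← hH]
    have h1 : (QuotientAddGroup.mk (QuotientAddGroup.mk a : C ⧸ H).out : C ⧸ H)
        = QuotientAddGroup.mk a := Quotient.out_eq' _
    have h2 := QuotientAddGroup.eq.1 h1.symm
    rwa [neg_add_eq_sub] at h2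
  · have h1 : (QuotientAddGroup.mk a : C ⧸ H) = QuotientAddGroup.mk b := by
      rw [QuotientAddGroup.eq, neg_add_eq_sub, ← neg_sub, neg_mem_iff]
      exact (hH _).2 hab
    exact congrArg Quotient.out h1

/-- Units `u` with `δ u = c p u` move the constant part of an eigenvalue by `c p`, so the constants
can be taken from representatives modulo `c ℤ`. Then distinct eigenvalues are inequivalent, as the
construction of the basis requires, and congruent constants are equal. -/
theorem exists_jordanBasis [Module.Finite A E] (hδ : IsEulerDerivation δ c Q)
    (hD : ∀ (f : A) (e : E), D (f • e) = δ f • e + f • D e)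
    (hspan : genSpan D {g | ∃ a, ∃ f ∈ Q, g = algebraMap C A a + f} = ⊤) :
    ∃ J : JordanBasis C D Q, ∀ i i' (p : ℤ), J.a i - J.a i' = c * p → J.a i = J.a i' := by
  obtain ⟨ρ, hρ, hρ'⟩ := exists_representatives c
  let G : Set A := {g | ∃ a, ∃ f ∈ Q, g = algebraMap C A (ρ a) + f}
  have hG : ∀ g ∈ G, ∀ g' ∈ G, ∀ u : A, u ≠ 0 → δ u = (g - g') * u → g = g' := by
    rintro _ ⟨a, f, hf, rfl⟩ _ ⟨a', f', hf', rfl⟩ u hu h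
    obtain ⟨rfl, p, hp⟩ := hδ.eq_of_eq_mul (ρ a - ρ a') f hf f' hf' u hu
      (by rw [h, map_sub]; ring)
    have : ρ a = ρ a' := by
      refine hρ' _ _ ?_
      obtain ⟨q, hq⟩ := hρ a
      obtain ⟨q', hq'⟩ := hρ a'
      refine ⟨p - q + q', ?_⟩
      push_cast
      linear_combination hp - hq + hq'
    rw [this]
  have hspan' : genSpan D G = ⊤ := by
    rw [eq_top_iff, ← hspan]
    refine genSpan_induction ?_
    rintro _ ⟨a, f, hf, rfl⟩ v hv
    obtain ⟨p, hp⟩ := hρ a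
    obtain ⟨u, hu, hu'⟩ := hδ.exists_unit p
    have h1 : u • v ∈ genEig D (algebraMap C A (ρ a) + f) := by
      refine smul_mem_genEig hD ?_ hv
      rw [hu', ← hp, map_sub]
      ring
    have h2 := Submodule.smul_mem _ u⁻¹ (mem_genSpan (G := G) ⟨a, f, hf, rfl⟩ h1)
    rwa [smul_smul, inv_mul_cancel₀ hu, one_smul] at h2
  obtain ⟨κ, hκ, r, b, g, hg, hb⟩ := exists_jordan_basis_of_genSpan_eq_top hδ.const hD hG hspan'
  choose a f hf hgaf using hg
  refine ⟨⟨κ, hκ, r, b, fun i => ρ (a i), f, hf, fun i j => by rw [hb, hgaf]⟩,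
    fun i i' p h => hρ' _ _ ?_⟩
  obtain ⟨q, hq⟩ := hρ (a i)
  obtain ⟨q', hq'⟩ := hρ (a i')
  refine ⟨p - q + q', ?_⟩
  push_cast
  linear_combination h - hq + hq'

namespace JordanBasis

variable (J : JordanBasis C D Q)

instance : Fintype J.κ := J.fintype

/-- The nilpotent part of a connection in Jordan form. -/
def nil : Module.End A E :=
  J.basis.constr A fun x => if h : (x.2 : ℕ) + 1 < J.r x.1 then J.basis ⟨x.1, ⟨x.2 + 1, h⟩⟩ else 0

/-- The polar part of a connection in Jordan form. -/
def polar : Module.End A E := J.basis.constr A fun x => J.f x.1 • J.basis x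

theorem nil_basis (x : (i : J.κ) × Fin (J.r i)) : J.nil (J.basis x)
    = if h : (x.2 : ℕ) + 1 < J.r x.1 then J.basis ⟨x.1, ⟨x.2 + 1, h⟩⟩ else 0 :=
  J.basis.constr_basis A _ x

theorem polar_basis (x : (i : J.κ) × Fin (J.r i)) :
    J.polar (J.basis x) = J.f x.1 • J.basis x :=
  J.basis.constr_basis A _ x

theorem apply_eq (x : (i : J.κ) × Fin (J.r i)) :
    D (J.basis x) = (algebraMap C A (J.a x.1) + J.f x.1) • J.basis x + J.nil (J.basis x) := by
  rw [nil_basis]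
  exact J.apply_basis x.1 x.2

theorem apply_nil (x : (i : J.κ) × Fin (J.r i)) :
    D (J.nil (J.basis x)) = (algebraMap C A (J.a x.1) + J.f x.1) • J.nil (J.basis x)
      + J.nil (J.nil (J.basis x)) := by
  rw [nil_basis]
  split_ifs with h
  · exact J.apply_eq ⟨x.1, ⟨x.2 + 1, h⟩⟩
  · simp

theorem polar_nil (x : (i : J.κ) × Fin (J.r i)) :
    J.polar (J.nil (J.basis x)) = J.f x.1 • J.nil (J.basis x) := by
  rw [nil_basis]
  split_ifs with h
  · exact J.polar_basis ⟨x.1, ⟨x.2 + 1, h⟩⟩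
  · simp

theorem isNilpotent_nil : IsNilpotent J.nil := by
  have h : ∀ (k : ℕ) (x : (i : J.κ) × Fin (J.r i)), J.r x.1 ≤ x.2 + k →
      (J.nil ^ k) (J.basis x) = 0 := by
    intro k
    induction k with
    | zero => intro x hx; have := x.2.2; omega
    | succ k ih =>
      intro x hx
      rw [pow_succ, Module.End.mul_apply, nil_basis]
      split_ifs with h
      · exact ih ⟨x.1, ⟨x.2 + 1, h⟩⟩ (by simp only; omega)
      · exact map_zero _
  refine ⟨Finset.univ.sup J.r, J.basis.ext fun x => ?_⟩
  rw [h _ x ((Finset.le_sup (Finset.mem_univ x.1)).trans (Nat.le_add_left _ _))]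
  rfl

theorem basis_mem_genEig (x : (i : J.κ) × Fin (J.r i)) :
    J.basis x ∈ genEig D (algebraMap C A (J.a x.1) + J.f x.1) := by
  obtain ⟨k, hk⟩ := J.isNilpotent_nil
  have h : ∀ (k : ℕ) (x : (i : J.κ) × Fin (J.r i)),
      (shift D (algebraMap C A (J.a x.1) + J.f x.1) ^ k) (J.basis x)
        = (J.nil ^ k) (J.basis x) := by
    intro k
    induction k with
    | zero => intro x; rfl
    | succ k ih =>
      intro x
      rw [pow_succ, pow_succ, Module.End.mul_apply, Module.End.mul_apply, shift_apply, J.apply_eq,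
        add_sub_cancel_left, nil_basis]
      split_ifs with h
      · exact ih ⟨x.1, ⟨x.2 + 1, h⟩⟩
      · simp
  exact mem_genEig.2 ⟨k, by rw [h, hk]; rfl⟩

theorem apply_of_mem_genEig (hδ : IsEulerDerivation δ c Q)
    (hD : ∀ (f : A) (e : E), D (f • e) = δ f • e + f • D e) {a : C} {f : A} {v : E}
    (hv : v ∈ genEig D (algebraMap C A a + f)) :
    D v = (algebraMap C A a + f) • v + J.nil v :=
  (semisimple_apply_of_mem_genEig hδ.const hD J.isNilpotent_nil J.apply_eq J.apply_nil hv).1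

/-- A nonzero coordinate of `v` solves the rank one equation for the difference of the two
eigenvalues, which determines the polar part and the class of the constant. -/
theorem eq_of_mem_genEig (hδ : IsEulerDerivation δ c Q)
    (hD : ∀ (f : A) (e : E), D (f • e) = δ f • e + f • D e) {a : C} {f : A} {v : E}
    (hf : f ∈ Q) (hv : v ∈ genEig D (algebraMap C A a + f))
    {x : (i : J.κ) × Fin (J.r i)} (hx : J.basis.repr v x ≠ 0) :
    f = J.f x.1 ∧ ∃ p : ℤ, a - J.a x.1 = c * p := by
  refine hδ.eq_of_eq_mul _ f hf _ (J.f_mem x.1) _ hx ?_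
  rw [(semisimple_apply_of_mem_genEig hδ.const hD J.isNilpotent_nil J.apply_eq J.apply_nil
    hv).2 x, map_sub]
  ring

/-- This describes the polar part without reference to `J`: by `eq_of_mem_genEig` only basis vectors
with the same polar part `f` occur in `v`. Descent, commutation with endomorphisms and uniqueness
all follow from it. -/
theorem polar_of_mem_genEig (hδ : IsEulerDerivation δ c Q)
    (hD : ∀ (f : A) (e : E), D (f • e) = δ f • e + f • D e) {a : C} {f : A} {v : E}
    (hf : f ∈ Q) (hv : v ∈ genEig D (algebraMap C A a + f)) :
    J.polar v = f • v := by
  conv_lhs => rw [← J.basis.sum_repr v]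
  conv_rhs => rw [← J.basis.sum_repr v]
  rw [map_sum, Finset.smul_sum]
  refine Finset.sum_congr rfl fun x _ => ?_
  rw [map_smul, polar_basis]
  by_cases hx : J.basis.repr v x = 0
  · rw [hx, zero_smul, zero_smul, smul_zero]
  · rw [← (J.eq_of_mem_genEig hδ hD hf hv hx).1, smul_comm]

/-- The left side does not involve `J`, so different Jordan bases of one connection with constant
eigenvalues have the same components modulo `c ℤ`. -/
theorem genSpan_eq_span (hδ : IsEulerDerivation δ c Q)
    (hD : ∀ (f : A) (e : E), D (f • e) = δ f • e + f • D e)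
    (hQ : ∀ i, J.f i = 0) (a : C) :
    genSpan D {g | ∃ (a' : C) (p : ℤ), a' - a = c * p ∧ g = algebraMap C A a'}
      = Submodule.span A (J.basis '' {x | ∃ p : ℤ, J.a x.1 - a = c * p}) := by
  apply le_antisymm
  · refine genSpan_induction ?_
    rintro _ ⟨a', p, hp, rfl⟩ v hv
    rw [← J.basis.sum_repr v]
    refine Submodule.sum_mem _ fun x _ => ?_
    by_cases hx : J.basis.repr v x = 0
    · rw [hx, zero_smul]
      exact Submodule.zero_mem _
    · refine Submodule.smul_mem _ _ (Submodule.subset_span ⟨x, ?_, rfl⟩)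
      obtain ⟨q, hq⟩ := (J.eq_of_mem_genEig hδ hD (f := 0) (hQ x.1 ▸ J.f_mem x.1)
        (by rwa [add_zero]) hx).2
      refine ⟨p - q, ?_⟩
      push_cast
      linear_combination hp - hq
  · rw [Submodule.span_le]
    rintro _ ⟨x, ⟨p, hp⟩, rfl⟩
    refine mem_genSpan (g := algebraMap C A (J.a x.1))
      (G := {g | ∃ (a' : C) (p : ℤ), a' - a = c * p ∧ g = algebraMap C A a'})
      ⟨J.a x.1, p, hp, rfl⟩ ?_
    have := J.basis_mem_genEig x
    rwa [hQ, add_zero] at this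

end JordanBasis

end LogDec

/-! ### Rotations, the fixed field `C((x))`, and the projection to exponents divisible by `s`. -/

namespace LogDec

section Euler

variable {C : Type u} [Field C] [CharZero C]

theorem IsEulerDerivation.mono {C : Type u} {A : Type v} [Field C] [Field A] [Algebra C A]
    {δ : Derivation C A A} {c : C} {Q Q' : Set A} (h : IsEulerDerivation δ c Q) (hQ : Q' ⊆ Q) :
    IsEulerDerivation δ c Q' :=
  ⟨h.const, h.exists_unit, fun a f hf f' hf' => h.eq_of_eq_mul a f (hQ hf) f' (hQ hf')⟩

theorem isEulerDerivation_eulerDer {c : C} (hc : c ≠ 0) :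
    IsEulerDerivation (eulerDer c) c {f | IsPolarLaurent f} where
  const := const_of_eulerDer_eulerDer hc
  exists_unit p := ⟨HahnSeries.single p 1, HahnSeries.single_ne_zero one_ne_zero,
    eulerDer_single c 1 p⟩
  eq_of_eq_mul a f hf f' hf' u hu h := by
    have h1 : IsPolarLaurent (f - f') := fun n hn => by
      rw [HahnSeries.coeff_sub, hf n hn, hf' n hn, sub_zero]
    obtain ⟨h2, h3⟩ := eq_of_eulerDer_eq_mul h1 hu h
    exact ⟨sub_eq_zero.1 h2, h3⟩

theorem isPolarLaurent_zero : IsPolarLaurent (0 : C⸨X⸩) := fun _ _ => rfl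

theorem isEulerDerivation_laurent :
    IsEulerDerivation (ϑ C : Derivation C C⸨X⸩ C⸨X⸩) 1 {0} :=
  (isEulerDerivation_eulerDer one_ne_zero).mono
    (Set.singleton_subset_iff.2 isPolarLaurent_zero)

variable (C) in
theorem isEulerDerivation_ram (s : ℕ+) :
    IsEulerDerivation (ϑ C : Derivation C (Ram C s) (Ram C s)) ((s : ℕ) : C)⁻¹ {f | IsPolar f} :=
  isEulerDerivation_eulerDer (C := C)
    (inv_ne_zero (by exact_mod_cast s.ne_zero : ((s : ℕ) : C) ≠ 0))

variable (C) in
theorem isEulerDerivation_ram_zero (s : ℕ+) :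
    IsEulerDerivation (ϑ C : Derivation C (Ram C s) (Ram C s)) ((s : ℕ) : C)⁻¹ {0} :=
  (isEulerDerivation_ram C s).mono (Set.singleton_subset_iff.2 fun _ _ => rfl)

theorem exists_ram_normal_form (s : ℕ+) (g : Ram C s) : ∃ (a : C) (f u : Ram C s), IsPolar f ∧
    u ≠ 0 ∧ ϑ C u = (algebraMap C (Ram C s) a + f - g) * u :=
  exists_normal_form (C := C) (c := ((s : ℕ) : C)⁻¹)
    (inv_ne_zero (by exact_mod_cast s.ne_zero)) g

end Euler

section Rotation

variable {C : Type u} [Field C]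

/-- The coefficientwise product of a Laurent series with the powers of `ζ`. -/
def rotateFun (ζ : C) (f : C⸨X⸩) : C⸨X⸩ where
  coeff n := ζ ^ n * f.coeff n
  isPWO_support' := f.isPWO_support.mono fun n hn h0 => hn (by simp [h0])

theorem coeff_rotateFun (ζ : C) (f : C⸨X⸩) (n : ℤ) :
    (rotateFun ζ f).coeff n = ζ ^ n * f.coeff n := rfl

/-- The substitution `x ↦ ζ x` on Laurent series. -/
def rotate {ζ : C} (hζ : ζ ≠ 0) : C⸨X⸩ →ₐ[C] C⸨X⸩ where
  toFun := rotateFun ζ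
  map_one' := by
    ext n
    rw [coeff_rotateFun]
    by_cases h : n = 0
    · rw [h, zpow_zero, one_mul]
    · rw [HahnSeries.coeff_one, if_neg h, mul_zero]
  map_mul' f g := by
    have hs : ∀ f : C⸨X⸩, (rotateFun ζ f).support ⊆ f.support :=
      fun f n hn h0 => hn (by simp [coeff_rotateFun, h0])
    ext n
    rw [coeff_rotateFun, HahnSeries.coeff_mul,
      HahnSeries.coeff_mul_left' f.isPWO_support (hs f)]
    rw [Finset.mul_sum]
    have h2 : ∀ f : C⸨X⸩, (rotateFun ζ f).support = f.support := by
      intro f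
      ext n
      rw [HahnSeries.mem_support, HahnSeries.mem_support, coeff_rotateFun, Ne,
        mul_eq_zero_iff_left (zpow_ne_zero n hζ)]
    refine Finset.sum_congr ?_ fun ij hij => ?_
    · ext ij
      simp only [Finset.mem_antidiagonal, h2]
    · rw [Finset.mem_antidiagonal] at hij
      rw [coeff_rotateFun, coeff_rotateFun, ← hij.2.2, zpow_add₀ hζ]
      ring
  map_zero' := by
    ext n
    rw [coeff_rotateFun, HahnSeries.coeff_zero, mul_zero]
  map_add' f g := by
    ext n
    rw [HahnSeries.coeff_add, coeff_rotateFun, coeff_rotateFun, coeff_rotateFun,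
      HahnSeries.coeff_add, mul_add]
  commutes' a := by
    ext n
    rw [coeff_rotateFun, algebraMap_laurent]
    by_cases h : n = 0
    · rw [h, zpow_zero, one_mul]
    · rw [HahnSeries.C_apply, HahnSeries.coeff_single_of_ne h, mul_zero]

theorem coeff_rotate {ζ : C} (hζ : ζ ≠ 0) (f : C⸨X⸩) (n : ℤ) :
    (rotate hζ f).coeff n = ζ ^ n * f.coeff n := rfl

theorem eulerDer_rotate {ζ : C} (hζ : ζ ≠ 0) (c : C) (f : C⸨X⸩) :
    eulerDer c (rotate hζ f) = rotate hζ (eulerDer c f) := by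
  ext n
  rw [eulerDer_coeff, coeff_rotate, coeff_rotate, eulerDer_coeff]
  ring

theorem rotate_expand {ζ : C} (hζ : ζ ≠ 0) {s : ℕ+} (hs : ζ ^ (s : ℕ) = 1) (f : C⸨X⸩) :
    rotate hζ (expand s f) = expand s f := by
  ext n
  rw [coeff_rotate]
  by_cases hn : ((s : ℕ) : ℤ) ∣ n
  · obtain ⟨m, rfl⟩ := hn
    rw [zpow_mul, zpow_natCast, hs, one_zpow, one_mul]
  · rw [coeff_expand_of_not_dvd s f hn, mul_zero]

/-- The series `∑ a_{s n} xⁿ`. -/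
def contract (s : ℕ+) (f : C⸨X⸩) : C⸨X⸩ where
  coeff n := f.coeff (((s : ℕ) : ℤ) * n)
  isPWO_support' := by
    refine (BddBelow.isWF ⟨-|f.order|, fun n hn => ?_⟩).isPWO
    have h1 : f.order ≤ ((s : ℕ) : ℤ) * n := HahnSeries.order_le_of_coeff_ne_zero hn
    have hs : (1 : ℤ) ≤ ((s : ℕ) : ℤ) := by exact_mod_cast s.pos
    by_contra! h2
    have h3 : n < 0 := h2.trans_le (neg_nonpos.2 (abs_nonneg _))
    have h4 : ((s : ℕ) : ℤ) * n ≤ 1 * n := mul_le_mul_of_nonpos_right hs h3.le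
    have h5 := neg_abs_le f.order
    omega

theorem coeff_contract (s : ℕ+) (f : C⸨X⸩) (n : ℤ) :
    (contract s f).coeff n = f.coeff (((s : ℕ) : ℤ) * n) := rfl

theorem expand_contract {s : ℕ+} {f : C⸨X⸩} (hf : ∀ n, ¬ ((s : ℕ) : ℤ) ∣ n → f.coeff n = 0) :
    expand s (contract s f) = f := by
  ext n
  by_cases hn : ((s : ℕ) : ℤ) ∣ n
  · obtain ⟨m, rfl⟩ := hn
    rw [coeff_expand_mul, coeff_contract]
  · rw [coeff_expand_of_not_dvd s _ hn, hf n hn]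

theorem contract_expand_mul (s : ℕ+) (f g : C⸨X⸩) :
    contract s (expand s f * g) = f * contract s g := by
  have hs : ((s : ℕ) : ℤ) ≠ 0 := by exact_mod_cast s.ne_zero
  ext n
  rw [coeff_contract, HahnSeries.coeff_mul, HahnSeries.coeff_mul]
  symm
  refine Finset.sum_of_injOn
    (fun ij : ℤ × ℤ => (((s : ℕ) : ℤ) * ij.1, ((s : ℕ) : ℤ) * ij.2)) ?_ ?_ ?_ ?_
  · rintro ⟨i, j⟩ _ ⟨i', j'⟩ _ h
    simp only [Prod.mk.injEq, mul_right_inj' hs] at h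
    exact Prod.ext h.1 h.2
  · rintro ⟨i, j⟩ hij
    simp only [Finset.mem_coe, Finset.mem_antidiagonal, HahnSeries.mem_support,
      coeff_contract, coeff_expand_mul] at hij ⊢
    exact ⟨hij.1, hij.2.1, by rw [← mul_add, hij.2.2]⟩
  · rintro ⟨i, j⟩ hij hnot
    simp only [Finset.mem_antidiagonal, HahnSeries.mem_support] at hij
    exfalso
    apply hnot
    have hi : ((s : ℕ) : ℤ) ∣ i := by
      by_contra h
      exact hij.1 (coeff_expand_of_not_dvd s f h)
    obtain ⟨i', rfl⟩ := hi
    obtain ⟨j', rfl⟩ : ((s : ℕ) : ℤ) ∣ j :=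
      ⟨n - i', by rw [mul_sub, ← hij.2.2, add_sub_cancel_left]⟩
    rw [coeff_expand_mul] at hij
    refine ⟨(i', j'), ?_, rfl⟩
    simp only [Finset.mem_coe, Finset.mem_antidiagonal, HahnSeries.mem_support, coeff_contract]
    refine ⟨hij.1, hij.2.1, mul_left_cancel₀ hs ?_⟩
    rw [mul_add, hij.2.2]
  · rintro ⟨i, j⟩ _
    rw [coeff_contract, coeff_expand_mul]

/-- For a primitive root, `ζ ^ n = 1` only if `s ∣ n`, so an invariant series has only exponents
divisible by `s`. -/
theorem mem_range_expand_of_rotate {ζ : C} (hζ : ζ ≠ 0) {s : ℕ+} (hs : IsPrimitiveRoot ζ s)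
    {f : C⸨X⸩} (hf : rotate hζ f = f) : ∃ g, expand s g = f := by
  refine ⟨contract s f, expand_contract fun n hn => ?_⟩
  have h1 := congrArg (fun h => HahnSeries.coeff h n) hf
  simp only [coeff_rotate] at h1
  by_contra h0
  have h2 : ζ ^ n = 1 := mul_right_cancel₀ h0 (by rw [h1, one_mul])
  exact hn ((hs.zpow_eq_one_iff_dvd n).1 h2)

theorem contract_one (s : ℕ+) : contract s (1 : C⸨X⸩) = 1 := by
  ext n
  rw [coeff_contract, HahnSeries.coeff_one, HahnSeries.coeff_one]
  simp

theorem contract_add (s : ℕ+) (f g : C⸨X⸩) :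
    contract s (f + g) = contract s f + contract s g := by
  ext n
  simp only [HahnSeries.coeff_add, coeff_contract]

theorem contract_eulerDer [CharZero C] (s : ℕ+) (c : C) (f : C⸨X⸩) :
    contract s (eulerDer (c / ((s : ℕ) : C)) f) = eulerDer c (contract s f) := by
  have hs : ((s : ℕ) : C) ≠ 0 := by exact_mod_cast s.ne_zero
  ext n
  rw [coeff_contract, eulerDer_coeff, eulerDer_coeff, coeff_contract]
  push_cast
  field_simp

/-- `f = ∑_{i < s} x_s^i fᵢ` with `fᵢ ∈ C((x_s ^ s))`. -/
theorem sum_single_mul_expand (s : ℕ+) (f : C⸨X⸩) :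
    ∑ i ∈ Finset.range (s : ℕ), HahnSeries.single (i : ℤ) (1 : C) *
      expand s (contract s (HahnSeries.single (-(i : ℤ)) 1 * f)) = f := by
  have hco : ∀ (g : C⸨X⸩) (p n : ℤ),
      (HahnSeries.single p (1 : C) * g).coeff n = g.coeff (n - p) := by
    intro g p n
    have := HahnSeries.coeff_single_mul_add (r := (1 : C)) (x := g) (a := n - p) (b := p)
    rwa [sub_add_cancel, one_mul] at this
  have hs : (0 : ℤ) < ((s : ℕ) : ℤ) := by exact_mod_cast s.pos
  ext n
  rw [HahnSeries.coeff_sum]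
  have h0 := Int.emod_nonneg n hs.ne'
  have h1 := Int.emod_lt_of_pos n hs
  have h2 := Int.mul_ediv_add_emod n ((s : ℕ) : ℤ)
  rw [Finset.sum_eq_single (n % ((s : ℕ) : ℤ)).toNat]
  · rw [hco, Int.toNat_of_nonneg h0,
      show n - n % ((s : ℕ) : ℤ) = ((s : ℕ) : ℤ) * (n / ((s : ℕ) : ℤ)) by linarith,
      coeff_expand_mul, coeff_contract, hco]
    congr 1
    linarith
  · intro i hi hne
    rw [hco]
    refine coeff_expand_of_not_dvd s _ fun h => hne ?_
    have h3 : n % ((s : ℕ) : ℤ) = (i : ℤ) % ((s : ℕ) : ℤ) :=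
      Int.emod_eq_emod_iff_emod_sub_eq_zero.2 (Int.emod_eq_zero_of_dvd h)
    rw [Int.emod_eq_of_lt (a := (i : ℤ)) (Int.natCast_nonneg i)
      (by exact_mod_cast Finset.mem_range.1 hi)] at h3
    omega
  · intro h
    exact absurd (Finset.mem_range.2 (by omega)) h

end Rotation

end LogDec

/-! ### Descent from `C((x_s))` to `C((x))`. -/

namespace LogDec

variable {C : Type u} [Field C] [CharZero C] {E : Type w} [AddCommGroup E] [Module C E]
  [Module C⸨X⸩ E] [IsScalarTower C C⸨X⸩ E] {s : ℕ+}

variable (C) in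
/-- The elements `a + f` of `C((x_s))` with `a` constant and `f` polar. -/
def ramPolar (s : ℕ+) : Set (Ram C s) :=
  {g | ∃ a, ∃ f ∈ {f : Ram C s | IsPolar f}, g = algebraMap C (Ram C s) a + f}

section Spanning

variable [IsAlgClosed C] [Module.Finite C⸨X⸩ E]

theorem exists_genSpan_baseChange_eq_top (D : Connection C C⸨X⸩ E) :
    ∃ s : ℕ+, genSpan (D.baseChange (Ram C s)).toLin (ramPolar C s) = ⊤ := by
  let β := Module.finBasis C⸨X⸩ E
  let M : Matrix (Fin (Module.finrank C⸨X⸩ E)) (Fin (Module.finrank C⸨X⸩ E)) C⸨X⸩ :=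
    Matrix.of fun i j => β.repr (D (β j)) i
  have hM : ∀ j, D (β j) = ∑ i, M i j • β i := fun j => (β.sum_repr (D (β j))).symm
  obtain ⟨s, hs⟩ := exists_genSpan_matConn_eq_top (one_ne_zero : (1 : C) ≠ 0) M
  refine ⟨s, ?_⟩
  rw [one_div] at hs
  have hs' : genSpan (A := Ram C s) (matConn (ϑ C : Derivation C (Ram C s) (Ram C s))
      (M.map (algebraMap C⸨X⸩ (Ram C s)))) (ramPolar C s) = ⊤ := hs
  let b := Algebra.TensorProduct.basis (Ram C s) β
  let φ : (Fin (Module.finrank C⸨X⸩ E) → Ram C s) ≃ₗ[Ram C s] (Ram C s ⊗[C⸨X⸩] E) :=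
    b.equivFun.symm
  have hφ : ∀ v, φ v = ∑ i, v i • b i := fun v => b.equivFun_symm_apply v
  have hb : ∀ j, (D.baseChange (Ram C s)).toLin (b j)
      = ∑ i, algebraMap C⸨X⸩ (Ram C s) (M i j) • b i := by
    intro j
    simp only [b, Algebra.TensorProduct.basis_apply, Connection.baseChange_tmul, hM,
      Derivation.map_one_eq_zero, TensorProduct.zero_tmul, zero_add, TensorProduct.tmul_sum]
    refine Finset.sum_congr rfl fun i _ => ?_
    rw [TensorProduct.tmul_smul, algebraMap_smul]
  have hcomm : ∀ e, (D.baseChange (Ram C s)).toLin (φ e)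
      = φ (matConn (ϑ C : Derivation C (Ram C s) (Ram C s))
        (M.map (algebraMap C⸨X⸩ (Ram C s))) e) := by
    intro e
    rw [hφ, hφ, map_sum]
    simp only [Connection.leibniz, hb, matConn_apply, add_smul, Finset.sum_add_distrib]
    congr 1
    simp only [Finset.smul_sum, Matrix.mulVec, dotProduct, Finset.sum_smul, smul_smul]
    rw [Finset.sum_comm]
    refine Finset.sum_congr rfl fun i _ => Finset.sum_congr rfl fun j _ => ?_
    rw [Matrix.map_apply, mul_comm]
  have h1 := map_genSpan_le (f := (φ : (Fin (Module.finrank C⸨X⸩ E) → Ram C s) →ₗ[Ram C s]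
    (Ram C s ⊗[C⸨X⸩] E))) hcomm (ramPolar C s)
  rw [hs', Submodule.map_top, LinearMap.range_eq_top.2 φ.surjective] at h1
  exact top_le_iff.1 h1

end Spanning

section Descent

theorem one_tmul_injective (s : ℕ+) {e : E} (h : (1 : Ram C s) ⊗ₜ[C⸨X⸩] e = 0) : e = 0 := by
  let β := Module.Basis.ofVectorSpace C⸨X⸩ E
  refine β.ext_elem fun i => ?_
  have h1 := congrArg (fun z => (Algebra.TensorProduct.basis (Ram C s) β).repr z i) h
  simp only [Algebra.TensorProduct.basis_repr_tmul, map_zero] at h1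
  have h2 : algebraMap C⸨X⸩ (Ram C s) (β.repr e i) = 0 := by simpa using h1
  simpa using h2

theorem eq_of_baseChange_eq {P P' : Module.End C⸨X⸩ E}
    (h : P.baseChange (Ram C s) = P'.baseChange (Ram C s)) : P = P' := by
  ext e
  rw [← sub_eq_zero]
  apply one_tmul_injective (C := C) s
  rw [TensorProduct.tmul_sub, sub_eq_zero]
  simpa using LinearMap.congr_fun h ((1 : Ram C s) ⊗ₜ[C⸨X⸩] e)

/-- The extension of an automorphism of `C((x_s))` over `C((x))` to `C((x_s)) ⊗ E`. -/
abbrev semilinearExt (E : Type w) [AddCommGroup E] [Module C⸨X⸩ E]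
    (σ : Ram C s →ₐ[C⸨X⸩] Ram C s) :
    Ram C s ⊗[C⸨X⸩] E →ₗ[C⸨X⸩] Ram C s ⊗[C⸨X⸩] E := LinearMap.rTensor E σ.toLinearMap

theorem semilinearExt_smul (σ : Ram C s →ₐ[C⸨X⸩] Ram C s) (g : Ram C s)
    (z : Ram C s ⊗[C⸨X⸩] E) : semilinearExt E σ (g • z) = σ g • semilinearExt E σ z := by
  induction z using TensorProduct.induction_on with
  | zero => simp
  | add x y hx hy => simp only [smul_add, map_add, hx, hy]
  | tmul h e => simp [TensorProduct.smul_tmul']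

theorem baseChange_semilinearExt (D : Connection C C⸨X⸩ E) {σ : Ram C s →ₐ[C⸨X⸩] Ram C s}
    (hσ : ∀ g, ϑ C (σ g) = σ (ϑ C g)) (z : Ram C s ⊗[C⸨X⸩] E) :
    D.baseChange (Ram C s) (semilinearExt E σ z)
      = semilinearExt E σ (D.baseChange (Ram C s) z) := by
  induction z using TensorProduct.induction_on with
  | zero => simp
  | add x y hx hy => simp only [map_add, hx, hy]
  | tmul h e => simp [hσ]

theorem semilinearExt_mem_genEig {D : Connection C C⸨X⸩ E} {σ : Ram C s →ₐ[C⸨X⸩] Ram C s}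
    (hσ : ∀ g, ϑ C (σ g) = σ (ϑ C g)) {g : Ram C s} {z : Ram C s ⊗[C⸨X⸩] E}
    (hz : z ∈ genEig (D.baseChange (Ram C s)).toLin g) :
    semilinearExt E σ z ∈ genEig (D.baseChange (Ram C s)).toLin (σ g) := by
  obtain ⟨k, hk⟩ := mem_genEig.1 hz
  have h : ∀ (k : ℕ) z, (shift (D.baseChange (Ram C s)).toLin (σ g) ^ k) (semilinearExt E σ z)
      = semilinearExt E σ ((shift (D.baseChange (Ram C s)).toLin g ^ k) z) := by
    intro k
    induction k with
    | zero => intro z; rfl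
    | succ k ih =>
      intro z
      have h1 : shift (D.baseChange (Ram C s)).toLin (σ g) (semilinearExt E σ z)
          = semilinearExt E σ (shift (D.baseChange (Ram C s)).toLin g z) := by
        rw [shift_apply, shift_apply, baseChange_semilinearExt D hσ, map_sub, semilinearExt_smul]
      rw [pow_succ, pow_succ, Module.End.mul_apply, Module.End.mul_apply, ← ih, h1]
  exact mem_genEig.2 ⟨k, by rw [h, hk, map_zero]⟩

/-- The automorphism `x_s ↦ ζ x_s` of `C((x_s))` over `C((x))`. -/
def ramRotate {ζ : C} (hζ : IsPrimitiveRoot ζ s) : Ram C s →ₐ[C⸨X⸩] Ram C s :=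
  { (rotate (hζ.ne_zero s.ne_zero) : C⸨X⸩ →ₐ[C] C⸨X⸩).toRingHom with
    commutes' := fun f => rotate_expand (hζ.ne_zero s.ne_zero) hζ.pow_eq_one f }

theorem theta_ramRotate {ζ : C} (hζ : IsPrimitiveRoot ζ s) (g : Ram C s) :
    ϑ C (ramRotate hζ g) = ramRotate hζ (ϑ C g) :=
  eulerDer_rotate (hζ.ne_zero s.ne_zero) _ (show C⸨X⸩ from g)

theorem isPolar_ramRotate {ζ : C} (hζ : IsPrimitiveRoot ζ s) {f : Ram C s} (hf : IsPolar f) :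
    IsPolar (ramRotate hζ f) := by
  intro n hn
  have h1 : (ramRotate hζ f).coeff n = ζ ^ n * f.coeff n := rfl
  rw [h1, hf n hn, mul_zero]

theorem ramRotate_algebraMap {ζ : C} (hζ : IsPrimitiveRoot ζ s) (a : C) :
    ramRotate hζ (algebraMap C (Ram C s) a) = algebraMap C (Ram C s) a := by
  rw [IsScalarTower.algebraMap_apply C C⸨X⸩ (Ram C s), AlgHom.commutes]

/-- In a basis `1 ⊗ β` the semilinear rotation acts on coordinates only, so the matrix entries of a
commuting `T` are invariant and lie in `C((x))`. -/
theorem exists_baseChange_eq [Module.Finite C⸨X⸩ E] {ζ : C} (hζ : IsPrimitiveRoot ζ s)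
    {T : Module.End (Ram C s) (Ram C s ⊗[C⸨X⸩] E)}
    (hT : ∀ z, T (semilinearExt E (ramRotate hζ) z) = semilinearExt E (ramRotate hζ) (T z)) :
    ∃ P : Module.End C⸨X⸩ E, P.baseChange (Ram C s) = T := by
  let β := Module.finBasis C⸨X⸩ E
  let b := Algebra.TensorProduct.basis (Ram C s) β
  have hb : ∀ j, b j = 1 ⊗ₜ[C⸨X⸩] β j := Algebra.TensorProduct.basis_apply β
  have hσb : ∀ j, semilinearExt E (ramRotate hζ) (b j) = b j := fun j => by
    rw [hb]; simp
  have hmem : ∀ i j, ∃ m : C⸨X⸩, algebraMap C⸨X⸩ (Ram C s) m = b.repr (T (b j)) i := by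
    intro i j
    refine mem_range_expand_of_rotate (hζ.ne_zero s.ne_zero) hζ
      (f := (show C⸨X⸩ from b.repr (T (b j)) i)) ?_
    change ramRotate hζ (b.repr (T (b j)) i) = b.repr (T (b j)) i
    have h1 := hT (b j)
    rw [hσb] at h1
    have h2 : semilinearExt E (ramRotate hζ) (T (b j))
        = ∑ i, ramRotate hζ (b.repr (T (b j)) i) • b i := by
      conv_lhs => rw [← b.sum_repr (T (b j)), map_sum]
      exact Finset.sum_congr rfl fun i _ => by rw [semilinearExt_smul, hσb]
    rw [h2] at h1
    have h3 := congrArg (fun z => b.repr z i) h1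
    simp only [b.repr_sum_self] at h3
    exact h3.symm
  choose m hm using hmem
  refine ⟨β.constr C⸨X⸩ fun j => ∑ i, m i j • β i, b.ext fun j => ?_⟩
  rw [hb, LinearMap.baseChange_tmul, β.constr_basis, TensorProduct.tmul_sum, ← hb,
    ← b.sum_repr (T (b j))]
  refine Finset.sum_congr rfl fun i _ => ?_
  rw [TensorProduct.tmul_smul, ← hm, algebraMap_smul, hb]

end Descent

section Contraction

/-- The projection of `C((x_s)) ⊗ E = ⨁ x_s^i ⊗ E` to the summand with `i = 0`. -/
def contractTensor (E : Type w) [AddCommGroup E] [Module C⸨X⸩ E] (s : ℕ+) :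
    Ram C s ⊗[C⸨X⸩] E →ₗ[C⸨X⸩] E :=
  TensorProduct.lift (LinearMap.mk₂ C⸨X⸩ (fun (g : Ram C s) (e : E) => contract s g • e)
    (fun g g' e => by rw [← add_smul]; exact congrArg (· • e) (contract_add s _ _))
    (fun f g e => by
      rw [smul_smul, Algebra.smul_def]
      exact congrArg (· • e) (contract_expand_mul s f _))
    (fun g e e' => smul_add _ _ _) (fun f g e => smul_comm _ _ _))

theorem contractTensor_tmul (g : Ram C s) (e : E) :
    contractTensor E s (g ⊗ₜ[C⸨X⸩] e) = contract s g • e := rfl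

theorem apply_contractTensor (D : Connection C C⸨X⸩ E) (z : Ram C s ⊗[C⸨X⸩] E) :
    D (contractTensor E s z) = contractTensor E s (D.baseChange (Ram C s) z) := by
  induction z using TensorProduct.induction_on with
  | zero => simp
  | add x y hx hy => simp only [map_add, hx, hy]
  | tmul g e =>
    rw [contractTensor_tmul, D.leibniz, Connection.baseChange_tmul, map_add, contractTensor_tmul,
      contractTensor_tmul]
    congr 2
    have := contract_eulerDer s (1 : C) (show C⸨X⸩ from g)
    rw [one_div] at this
    exact this.symm

theorem contractTensor_mem_genEig {D : Connection C C⸨X⸩ E} {a : C} {z : Ram C s ⊗[C⸨X⸩] E}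
    (hz : z ∈ genEig (D.baseChange (Ram C s)).toLin (algebraMap C (Ram C s) a)) :
    contractTensor E s z ∈ genEig D.toLin (algebraMap C C⸨X⸩ a) := by
  obtain ⟨k, hk⟩ := mem_genEig.1 hz
  have h : ∀ (k : ℕ) z, (shift D.toLin (algebraMap C C⸨X⸩ a) ^ k) (contractTensor E s z)
      = contractTensor E s
        ((shift (D.baseChange (Ram C s)).toLin (algebraMap C (Ram C s) a) ^ k) z) := by
    intro k
    induction k with
    | zero => intro z; rfl
    | succ k ih =>
      intro z
      have h1 : shift D.toLin (algebraMap C C⸨X⸩ a) (contractTensor E s z)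
          = contractTensor E s
            (shift (D.baseChange (Ram C s)).toLin (algebraMap C (Ram C s) a) z) := by
        rw [shift_apply, shift_apply, apply_contractTensor, map_sub,
          IsScalarTower.algebraMap_apply C C⸨X⸩ (Ram C s),
          algebraMap_smul (Ram C s) (algebraMap C C⸨X⸩ a), map_smul]
      rw [pow_succ, pow_succ, Module.End.mul_apply, Module.End.mul_apply, ← ih, h1]
  exact mem_genEig.2 ⟨k, by rw [h, hk, map_zero]⟩

/-- The projection to exponent `0` is horizontal and `C((x))`-linear, and it maps onto `E`. If `v`
has constant eigenvalue `a`, then `x_s ^ i v` has the constant eigenvalue `a + i / s`; so the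
projections of these vectors are generalized eigenvectors over `C((x))`, and they generate `E`. -/
theorem genSpan_eq_top_of_baseChange (D : Connection C C⸨X⸩ E)
    (h : genSpan (D.baseChange (Ram C s)).toLin (Set.range (algebraMap C (Ram C s))) = ⊤) :
    genSpan D.toLin (Set.range (algebraMap C C⸨X⸩)) = ⊤ := by
  have hs : ((s : ℕ) : C) ≠ 0 := by exact_mod_cast s.ne_zero
  have key : ∀ z : Ram C s ⊗[C⸨X⸩] E, ∀ g : Ram C s,
      contractTensor E s (g • z) ∈ genSpan D.toLin (Set.range (algebraMap C C⸨X⸩)) := by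
    intro z
    have hz : z ∈ genSpan (D.baseChange (Ram C s)).toLin
        (Set.range (algebraMap C (Ram C s))) := by rw [h]; trivial
    induction hz using Submodule.span_induction with
    | mem v hv =>
      intro g
      obtain ⟨_, ⟨a, rfl⟩, hv⟩ := Set.mem_iUnion₂.1 hv
      have hg : g = ∑ i ∈ Finset.range (s : ℕ), algebraMap C⸨X⸩ (Ram C s)
          (contract s (HahnSeries.single (-(i : ℤ)) 1 * (show C⸨X⸩ from g)))
            * (show Ram C s from HahnSeries.single (i : ℤ) (1 : C)) := by
        refine (sum_single_mul_expand s (show C⸨X⸩ from g)).symm.trans ?_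
        exact Finset.sum_congr rfl fun i _ => mul_comm (G := C⸨X⸩) _ _
      rw [hg, Finset.sum_smul, map_sum]
      refine Submodule.sum_mem _ fun i _ => ?_
      rw [mul_smul, algebraMap_smul, map_smul]
      refine Submodule.smul_mem _ _ (mem_genSpan
        (g := algebraMap C C⸨X⸩ (a + i / ((s : ℕ) : C))) (Set.mem_range_self _)
        (contractTensor_mem_genEig ?_))
      refine smul_mem_genEig (D.baseChange (Ram C s)).leibniz ?_ hv
      rw [← map_sub, add_sub_cancel_left]
      refine (eulerDer_single ((s : ℕ) : C)⁻¹ 1 (i : ℤ)).trans ?_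
      rw [Int.cast_natCast, inv_mul_eq_div]
      rfl
    | zero => intro g; simp
    | add x y _ _ hx hy =>
      intro g
      rw [smul_add, map_add]
      exact Submodule.add_mem _ (hx g) (hy g)
    | smul f x _ hx =>
      intro g
      rw [smul_smul]
      exact hx _
  rw [eq_top_iff]
  intro e _
  have := key ((1 : Ram C s) ⊗ₜ[C⸨X⸩] e) 1
  rw [one_smul, contractTensor_tmul] at this
  rwa [show contract s (1 : Ram C s) = 1 from contract_one s, one_smul] at this

end Contraction

end LogDec

/-! ### The ramified form and the Turrittin index. -/

namespace LogDec

namespace Connection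

section

variable {C A E : Type*} [CommRing C] [CommRing A] [Algebra C A] [Theta C A]
  [AddCommGroup E] [Module C E] [Module A E] [IsScalarTower C A E]

/-- The connection `D - P`. -/
def subEnd (D : Connection C A E) (P : Module.End A E) : Connection C A E where
  toLin := D.toLin - P.restrictScalars C
  leibniz f e := by
    simp only [LinearMap.sub_apply, D.leibniz, LinearMap.restrictScalars_apply, map_smul, smul_sub]
    abel

theorem subEnd_apply (D : Connection C A E) (P : Module.End A E) (e : E) :
    D.subEnd P e = D e - P e := rfl

theorem ext_apply {D D' : Connection C A E} (h : ∀ e, D e = D' e) : D = D' := by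
  cases D
  cases D'
  congr
  exact LinearMap.ext h

theorem commute_of_basis (D : Connection C A E) (N : Module.End A E) {ι : Type*}
    (b : Module.Basis ι A E) (h : ∀ i, D (N (b i)) = N (D (b i))) (e : E) :
    D (N e) = N (D e) := by
  have he : e ∈ Submodule.span A (Set.range b) := by rw [b.span_eq]; trivial
  induction he using Submodule.span_induction with
  | mem x hx => obtain ⟨i, rfl⟩ := hx; exact h i
  | zero => simp
  | add x y _ _ hx hy => simp only [map_add, hx, hy]
  | smul f x _ hx => simp only [map_smul, D.leibniz, map_add, hx]

theorem baseChange_subEnd (B : Type*) [CommRing B] [Algebra C B] [Algebra A B] [Theta C B]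
    [ThetaAlgebra C A B] (D : Connection C A E) (P : Module.End A E) (z : B ⊗[A] E) :
    (D.subEnd P).baseChange B z = D.baseChange B z - P.baseChange B z := by
  induction z using TensorProduct.induction_on with
  | zero => simp
  | add x y hx hy => simp only [map_add, hx, hy]; abel
  | tmul g e =>
    simp only [baseChange_tmul, subEnd_apply, LinearMap.baseChange_tmul, TensorProduct.tmul_sub]
    abel

theorem baseChange_commute (B : Type*) [CommRing B] [Algebra C B] [Algebra A B] [Theta C B]
    [ThetaAlgebra C A B] {D : Connection C A E} {N : Module.End A E}
    (h : ∀ e, D (N e) = N (D e)) (z : B ⊗[A] E) :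
    D.baseChange B (N.baseChange B z) = N.baseChange B (D.baseChange B z) := by
  induction z using TensorProduct.induction_on with
  | zero => simp
  | add x y hx hy => simp only [map_add, hx, hy]
  | tmul g e =>
    simp only [baseChange_tmul, LinearMap.baseChange_tmul, map_add, h]

theorem isDiagonalizable_of_basis {C A E : Type*} [CommRing C] [Field A] [Algebra C A]
    [Theta C A] [AddCommGroup E] [Module C E] [Module A E] {D : Connection C A E} {ι : Type*}
    [Fintype ι] (b : Module.Basis ι A E) {g : ι → A} (h : ∀ i, D (b i) = g i • b i) :
    D.IsDiagonalizable := by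
  let e : ι ≃ Fin (Module.finrank A E) :=
    Fintype.equivFinOfCardEq (Module.finrank_eq_card_basis b).symm
  exact ⟨b.reindex e, fun i => g (e.symm i), fun i => by rw [b.reindex_apply, h]⟩

end

end Connection

variable {C : Type u} [Field C] [CharZero C] {E : Type w} [AddCommGroup E] [Module C E]
  [Module C⸨X⸩ E] [IsScalarTower C C⸨X⸩ E] {s : ℕ+}

namespace JordanBasis

/-- The base change to `C((x_s))` of a Jordan basis with constant eigenvalues. -/
def baseChange {D : Connection C C⸨X⸩ E} (J : JordanBasis C D.toLin ({0} : Set C⸨X⸩)) (s : ℕ+) :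
    JordanBasis C (D.baseChange (Ram C s)).toLin ({0} : Set (Ram C s)) where
  κ := J.κ
  fintype := J.fintype
  r := J.r
  basis := Algebra.TensorProduct.basis (Ram C s) J.basis
  a := J.a
  f _ := 0
  f_mem _ := rfl
  apply_basis i j := by
    have h0 : J.f i = 0 := J.f_mem i
    simp only [Algebra.TensorProduct.basis_apply, Connection.baseChange_tmul,
      Derivation.map_one_eq_zero, TensorProduct.zero_tmul, zero_add, J.apply_basis, h0, add_zero,
      TensorProduct.tmul_add]
    congr 1
    · rw [TensorProduct.tmul_smul, IsScalarTower.algebraMap_apply C C⸨X⸩ (Ram C s),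
        algebraMap_smul (Ram C s) (algebraMap C C⸨X⸩ (J.a i))]
    · split_ifs
      · rfl
      · exact TensorProduct.tmul_zero _ _

theorem baseChange_nil {D : Connection C C⸨X⸩ E} (J : JordanBasis C D.toLin ({0} : Set C⸨X⸩)) (s : ℕ+) :
    (J.baseChange s).nil = J.nil.baseChange (Ram C s) := by
  refine (J.baseChange s).basis.ext fun (x : (i : J.κ) × Fin (J.r i)) => ?_
  refine ((J.baseChange s).nil_basis x).trans ?_
  change (if h : (x.2 : ℕ) + 1 < J.r x.1 then
    Algebra.TensorProduct.basis (Ram C s) J.basis ⟨x.1, ⟨x.2 + 1, h⟩⟩ else 0)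
      = J.nil.baseChange (Ram C s) (Algebra.TensorProduct.basis (Ram C s) J.basis x)
  rw [Algebra.TensorProduct.basis_apply, LinearMap.baseChange_tmul, nil_basis]
  split_ifs
  · exact Algebra.TensorProduct.basis_apply _ _
  · exact (TensorProduct.tmul_zero _ _).symm

end JordanBasis

/-- A Jordan basis of `(E, ∇)` over `C((x_s))`, whose polar part `P` is defined over `C((x))`,
together with a Jordan basis of `∇ - P` over `C((x))`. -/
structure RamifiedForm (D : Connection C C⸨X⸩ E) (s : ℕ+) where
  J : JordanBasis C (D.baseChange (Ram C s)).toLin {f : Ram C s | IsPolar f}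
  a_eq : ∀ i i' (p : ℤ), J.a i - J.a i' = ((s : ℕ) : C)⁻¹ * p → J.a i = J.a i'
  P : Module.End C⸨X⸩ E
  P_baseChange : P.baseChange (Ram C s) = J.polar
  J₀ : JordanBasis C (D.subEnd P).toLin ({0} : Set C⸨X⸩)

theorem exists_ramifiedForm [IsAlgClosed C] [Module.Finite C⸨X⸩ E] {D : Connection C C⸨X⸩ E}
    (hspan : genSpan (D.baseChange (Ram C s)).toLin (ramPolar C s) = ⊤) :
    Nonempty (RamifiedForm D s) := by
  have hδ := isEulerDerivation_ram C s
  have hD := (D.baseChange (Ram C s)).leibniz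
  obtain ⟨J, hJ⟩ := exists_jordanBasis hδ hD hspan
  have : NeZero (s : ℕ) := ⟨s.ne_zero⟩
  obtain ⟨ζ, hζ⟩ := HasEnoughRootsOfUnity.exists_primitiveRoot C (s : ℕ)
  -- The rotation `σ` maps generalized eigenvectors for `a + f` to such vectors for `a + σ f`, and
  -- `σ f` is again polar. The polar part multiplies them by `f` and `σ f` respectively, so it
  -- commutes with `σ`.
  obtain ⟨P, hP⟩ := exists_baseChange_eq (E := E) hζ (T := J.polar) (by
    intro z
    have hz : z ∈ genSpan (D.baseChange (Ram C s)).toLin (ramPolar C s) := by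
      rw [hspan]; trivial
    induction hz using Submodule.span_induction with
    | mem v hv =>
      obtain ⟨_, ⟨a, f, hf, rfl⟩, hv⟩ := Set.mem_iUnion₂.1 hv
      have h1 := semilinearExt_mem_genEig (theta_ramRotate hζ) hv
      rw [map_add, ramRotate_algebraMap] at h1
      rw [J.polar_of_mem_genEig hδ hD (isPolar_ramRotate hζ hf) h1,
        J.polar_of_mem_genEig hδ hD hf hv, semilinearExt_smul]
    | zero => simp
    | add x y _ _ hx hy => simp only [map_add, hx, hy]
    | smul f x _ hx => simp only [semilinearExt_smul, map_smul, hx])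
  -- Subtracting the polar part leaves the same Jordan basis with the eigenvalues `a i` alone.
  have hrs : genSpan ((D.subEnd P).baseChange (Ram C s)).toLin
      (Set.range (algebraMap C (Ram C s))) = ⊤ := by
    let J' : JordanBasis C ((D.subEnd P).baseChange (Ram C s)).toLin ({0} : Set (Ram C s)) :=
      { J with
        f := fun _ => 0
        f_mem := fun _ => rfl
        apply_basis := fun i j => by
          rw [Connection.baseChange_subEnd, hP, J.apply_basis, J.polar_basis, add_smul, add_zero]
          abel }
    rw [eq_top_iff, ← J'.basis.span_eq, Submodule.span_le]
    rintro _ ⟨x, rfl⟩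
    have := J'.basis_mem_genEig x
    exact mem_genSpan (g := algebraMap C (Ram C s) (J'.a x.1)) (Set.mem_range_self _)
      (by rwa [show J'.f x.1 = 0 from rfl, add_zero] at this)
  obtain ⟨J₀, -⟩ := exists_jordanBasis (Q := {0}) (c := (1 : C)) isEulerDerivation_laurent
    (D.subEnd P).leibniz (by
      rw [eq_top_iff, ← genSpan_eq_top_of_baseChange (D.subEnd P) hrs]
      refine genSpan_induction ?_
      rintro _ ⟨a, rfl⟩ v hv
      exact mem_genSpan (G := {g | ∃ a, ∃ f ∈ ({0} : Set C⸨X⸩), g = algebraMap C C⸨X⸩ a + f})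
        (g := algebraMap C C⸨X⸩ a) ⟨a, 0, rfl, (add_zero _).symm⟩ hv)
  exact ⟨⟨J, hJ, P, hP, J₀⟩⟩

namespace RamifiedForm

variable {D : Connection C C⸨X⸩ E} (R : RamifiedForm D s)

/-- The regular singular part of a connection. -/
def rs : Connection C C⸨X⸩ E := D.subEnd R.P

theorem rs_apply (e : E) : R.rs e = D e - R.P e := rfl

/-- A Jordan basis of the regular singular part over `C((x_s))`. -/
def Jrs : JordanBasis C (R.rs.baseChange (Ram C s)).toLin ({0} : Set (Ram C s)) :=
  { R.J with
    f := fun _ => 0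
    f_mem := fun _ => rfl
    apply_basis := fun i j => by
      rw [rs, Connection.baseChange_subEnd, R.P_baseChange, R.J.apply_basis, R.J.polar_basis,
        add_smul, add_zero]
      abel }

theorem polar_of_mem_genEig {a : C} {f : Ram C s} {v : Ram C s ⊗[C⸨X⸩] E} (hf : IsPolar f)
    (hv : v ∈ genEig (D.baseChange (Ram C s)).toLin (algebraMap C (Ram C s) a + f)) :
    R.P.baseChange (Ram C s) v = f • v := by
  rw [R.P_baseChange]
  exact R.J.polar_of_mem_genEig (isEulerDerivation_ram C s) (D.baseChange (Ram C s)).leibniz hf hv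

/-- The nilpotent part of a connection. -/
def nil : Module.End C⸨X⸩ E := R.J₀.nil

/-- The vector is a generalized eigenvector of the regular singular part with a constant eigenvalue,
and on such vectors the nilpotent part of any Jordan basis is the connection minus that eigenvalue.
So the nilpotent parts computed over `C((x))` and over `C((x_s))` agree. -/
theorem nil_baseChange_basis (x : (i : R.J.κ) × Fin (R.J.r i)) :
    R.nil.baseChange (Ram C s) (R.J.basis x) = R.J.nil (R.J.basis x) := by
  have h1 := R.Jrs.basis_mem_genEig x
  have h2 := (R.J₀.baseChange s).apply_of_mem_genEig (isEulerDerivation_ram_zero C s)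
    (R.rs.baseChange (Ram C s)).leibniz h1
  have h3 := R.Jrs.apply_eq x
  have h4 := add_left_cancel (h2.symm.trans h3)
  rw [JordanBasis.baseChange_nil] at h4
  exact h4.trans ((R.Jrs.nil_basis x).trans (R.J.nil_basis x).symm)

theorem rs_nil (e : E) : R.rs (R.nil e) = R.nil (R.rs e) := by
  refine R.rs.commute_of_basis R.nil R.J₀.basis (fun x => ?_) e
  refine (R.J₀.apply_nil x).trans ?_
  have h := R.J₀.apply_eq x
  rw [show R.rs (R.J₀.basis x) = _ from h, map_add, map_smul]
  rfl

/-- Over `C((x_s))`, `P` is a scalar on each Jordan block of `R.J`, and the nilpotent part preserves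
the blocks. -/
theorem P_nil : R.P * R.nil = R.nil * R.P := by
  apply eq_of_baseChange_eq (s := s)
  refine R.J.basis.ext fun x => ?_
  rw [LinearMap.baseChange_mul, LinearMap.baseChange_mul, Module.End.mul_apply,
    Module.End.mul_apply, nil_baseChange_basis, R.P_baseChange, R.J.polar_basis, R.J.polar_nil,
    map_smul, nil_baseChange_basis]

theorem D_nil (e : E) : D (R.nil e) = R.nil (D e) := by
  have h : ∀ e, D e = R.rs e + R.P e := fun e => by rw [rs_apply]; abel
  have h1 := LinearMap.congr_fun R.P_nil e
  rw [Module.End.mul_apply, Module.End.mul_apply] at h1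
  rw [h, h e, map_add, rs_nil, h1]

theorem isNilpotent_nil : IsNilpotent R.nil := R.J₀.isNilpotent_nil

theorem isJordanLevelt : IsJordanLevelt D (D.subEnd R.nil) R.nil where
  eq_add e := by rw [Connection.subEnd_apply]; abel
  semisimple := by
    refine ⟨s, Connection.isDiagonalizable_of_basis R.J.basis
      (g := fun x => algebraMap C (Ram C s) (R.J.a x.1) + R.J.f x.1) fun x => ?_⟩
    rw [Connection.baseChange_subEnd, R.J.apply_eq, nil_baseChange_basis]
    abel
  nilpotent := R.isNilpotent_nil
  commute e := by
    rw [Connection.subEnd_apply, Connection.subEnd_apply, map_sub, D_nil]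

theorem exists_isTurrittinIndex {D : Connection C C⸨X⸩ E} (R : RamifiedForm D s) :
    ∃ s : ℕ+, IsTurrittinIndex D s := by
  let T := {s' : ℕ+ | ((D.subEnd R.nil).baseChange (Ram C s')).IsDiagonalizable}
  have hT : T.Nonempty := R.isJordanLevelt.semisimple
  have hwf := (wellFounded_lt : WellFounded ((· < ·) : ℕ+ → ℕ+ → Prop))
  refine ⟨hwf.min T hT, D.subEnd R.nil, R.nil, R.isJordanLevelt, hwf.min_mem T hT, fun t ht => ?_⟩
  exact not_lt.1 (hwf.not_lt_min T ht)

end RamifiedForm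

/-- This ties the construction to the index as defined: the diagonalizing vectors of `S`, rescaled
to normalized eigenvalues, are generalized eigenvectors of `D = S + N`, because `D - g` acts as `N`
on their `N`-iterates. -/
theorem genSpan_eq_top_of_isTurrittinIndex {D : Connection C C⸨X⸩ E} (h : IsTurrittinIndex D s) :
    genSpan (D.baseChange (Ram C s)).toLin (ramPolar C s) = ⊤ := by
  obtain ⟨S, N, hSN, ⟨b, g, hb⟩, -⟩ := h
  obtain ⟨k, hk⟩ := hSN.nilpotent
  have hN : N.baseChange (Ram C s) ^ k = 0 := by
    rw [← LinearMap.baseChange_pow, hk, LinearMap.baseChange_zero]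
  have hD : ∀ z, D.baseChange (Ram C s) z
      = S.baseChange (Ram C s) z + N.baseChange (Ram C s) z := by
    intro z
    have h1 : S = D.subEnd N := Connection.ext_apply fun e => by
      rw [Connection.subEnd_apply, hSN.eq_add]; abel
    rw [h1, Connection.baseChange_subEnd]
    abel
  have hcomm := Connection.baseChange_commute (Ram C s) hSN.commute
  rw [eq_top_iff, ← b.span_eq, Submodule.span_le]
  rintro _ ⟨i, rfl⟩
  obtain ⟨a, f, u, hf, hu, hu'⟩ := exists_ram_normal_form s (g i)
  have h1 : S.baseChange (Ram C s) (u • b i)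
      = (algebraMap C (Ram C s) a + f) • (u • b i) := by
    rw [Connection.leibniz, hb, hu', smul_smul, smul_smul, ← add_smul]
    congr 1
    ring
  have h2 : ∀ k, S.baseChange (Ram C s) ((N.baseChange (Ram C s) ^ k) (u • b i))
      = (algebraMap C (Ram C s) a + f) • (N.baseChange (Ram C s) ^ k) (u • b i) := by
    intro k
    induction k with
    | zero => exact h1
    | succ k ih => rw [pow_succ', Module.End.mul_apply, hcomm, ih, map_smul]
  have h3 : ∀ k, (shift (D.baseChange (Ram C s)).toLin (algebraMap C (Ram C s) a + f) ^ k)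
      (u • b i) = (N.baseChange (Ram C s) ^ k) (u • b i) := by
    intro k
    induction k with
    | zero => rfl
    | succ k ih =>
      rw [pow_succ', Module.End.mul_apply, ih, shift_apply, hD, h2, add_sub_cancel_left, pow_succ',
        Module.End.mul_apply]
  have h4 : u • b i ∈ genSpan (D.baseChange (Ram C s)).toLin (ramPolar C s) :=
    mem_genSpan (G := ramPolar C s) (g := algebraMap C (Ram C s) a + f) ⟨a, f, hf, rfl⟩
      (mem_genEig.2 ⟨k, by rw [h3, hN]; rfl⟩)
  have h5 := Submodule.smul_mem _ u⁻¹ h4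
  rwa [smul_smul, inv_mul_cancel₀ hu, one_smul] at h5

end LogDec

/-! ### Lattices, classes of constants and flat Jordan matrices. -/

namespace LogDec

variable {C : Type u} [Field C] {E : Type w} [AddCommGroup E] [Module C E]
  [Module C⸨X⸩ E] [IsScalarTower C C⸨X⸩ E] {s : ℕ+}

/-- A constant matrix defines a logarithmic connection on the free `C⟦x⟧`-module with the same
basis. -/
theorem isRegularSingular_of_basis {D : Connection C C⸨X⸩ E} {ι : Type u} [Fintype ι]
    (b : Module.Basis ι C⸨X⸩ E) (m : Matrix ι ι C)
    (hb : ∀ j, D (b j) = ∑ i, m i j • b i) : IsRegularSingular D := by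
  classical
  let DM : Connection C C⟦X⟧ (ι → C⟦X⟧) :=
    ⟨matConn (ϑ C) (m.map (algebraMap C C⟦X⟧)), matConn_smul _ _⟩
  let B : Module.Basis ι C⸨X⸩ (C⸨X⸩ ⊗[C⟦X⟧] (ι → C⟦X⟧)) :=
    Algebra.TensorProduct.basis C⸨X⸩ (Pi.basisFun C⟦X⟧ ι)
  let φ := B.equiv b (Equiv.refl ι)
  have hφ : ∀ i, φ (B i) = b i := fun i => B.equiv_apply i b (Equiv.refl ι)
  have hDM : ∀ j, DM.baseChange C⸨X⸩ (B j) = ∑ i, m i j • B i := by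
    intro j
    have h1 : DM (Pi.basisFun C⟦X⟧ ι j) = ∑ i, m i j • Pi.basisFun C⟦X⟧ ι i := by
      ext1 i
      rw [Finset.sum_apply]
      simp only [Pi.basisFun_apply, Pi.smul_apply]
      rw [Finset.sum_eq_single i]
      · change ϑ C ((Pi.single j 1 : ι → C⟦X⟧) i) + _ = _
        rw [Matrix.mulVec_single_one, Pi.single_eq_same, Matrix.col_apply, Matrix.map_apply,
          Algebra.smul_def, mul_one, Pi.single_apply, apply_ite (ϑ C),
          Derivation.map_one_eq_zero, map_zero, ite_self, zero_add]
      · intro k _ hk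
        rw [Pi.single_eq_of_ne' hk, smul_zero]
      · simp
    simp only [B, Algebra.TensorProduct.basis_apply, Connection.baseChange_tmul, h1,
      Derivation.map_one_eq_zero, TensorProduct.zero_tmul, zero_add, TensorProduct.tmul_sum]
    exact Finset.sum_congr rfl fun i _ => TensorProduct.tmul_smul _ _ _
  refine ⟨ι → C⟦X⟧, inferInstance, inferInstance, inferInstance, inferInstance, inferInstance,
    DM, φ, fun z => ?_⟩
  have hz : z ∈ Submodule.span C⸨X⸩ (Set.range B) := by rw [B.span_eq]; trivial
  induction hz using Submodule.span_induction with
  | mem x hx =>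
    obtain ⟨j, rfl⟩ := hx
    rw [hφ, hb, hDM, map_sum]
    refine Finset.sum_congr rfl fun i _ => ?_
    rw [← algebraMap_smul C⸨X⸩ (m i j) (B i), map_smul, hφ, algebraMap_smul]
  | zero => simp
  | add x y _ _ hx hy => simp only [map_add, hx, hy]
  | smul f x _ hx => simp only [map_smul, map_add, Connection.leibniz, hx]

theorem JordanBasis.isRegularSingular {D : Connection C C⸨X⸩ E}
    (J : JordanBasis C D.toLin ({0} : Set C⸨X⸩)) : IsRegularSingular D := by
  classical
  refine isRegularSingular_of_basis J.basis
    (Matrix.diagonal (fun x => J.a x.1) + nilBlocks C J.r) ?_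
  rintro ⟨i, j⟩
  have h0 : J.f i = 0 := J.f_mem i
  have h1 := sum_nilBlocks_smul (C := C) J.r J.basis i j
  have h2 : ∑ y, (Matrix.diagonal (fun x : (i : J.κ) × Fin (J.r i) => J.a x.1) :
      Matrix _ _ C) y ⟨i, j⟩ • J.basis y = J.a i • J.basis ⟨i, j⟩ := by
    rw [Finset.sum_eq_single (⟨i, j⟩ : (i : J.κ) × Fin (J.r i))]
    · rw [Matrix.diagonal_apply_eq]
    · intro y _ hy
      rw [Matrix.diagonal_apply_ne _ hy, zero_smul]
    · simp
  rw [J.apply_basis, h0, add_zero, algebraMap_smul, ← h1, ← h2, ← Finset.sum_add_distrib]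
  exact Finset.sum_congr rfl fun y _ => (add_smul _ _ _).symm

variable [CharZero C]

theorem constClass_eq_iff {a b : C} : constClass a = constClass b ↔ ∃ p : ℤ, a - b = p := by
  unfold constClass
  rw [eq_comm, QuotientAddGroup.eq, neg_add_eq_sub, ← map_sub]
  constructor
  · rintro ⟨u, hu, h⟩
    have h1 := (isEulerDerivation_laurent (C := C)).eq_of_eq_mul (a - b) 0 rfl 0 rfl u hu
      (by rw [h, sub_zero, add_zero, mul_comm u⁻¹, mul_assoc, inv_mul_cancel₀ hu, mul_one])
    simpa using h1.2
  · rintro ⟨p, hp⟩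
    obtain ⟨u, hu, h⟩ := (isEulerDerivation_laurent (C := C)).exists_unit p
    refine ⟨u, hu, ?_⟩
    rw [h, hp, one_mul, mul_comm u⁻¹, mul_assoc, mul_inv_cancel₀ hu, mul_one]

theorem constClass_sub (a b : C) : constClass a - constClass b = constClass (a - b) := by
  unfold constClass
  rw [map_sub]
  rfl

theorem sum_flatJordan_smul {K V : Type*} [CommRing K] [AddCommGroup V] [Module K V] {l : ℕ}
    (r : Fin l → ℕ) (g : Fin l → K) (star : (i : Fin l) → Fin (r i) → Bool)
    (v : ((i : Fin l) × Fin (r i)) → V) (i : Fin l) (j : Fin (r i)) :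
    ∑ p, Matrix.blockDiagonal' (fun i => flatJordan (r i) (g i) (star i)) p ⟨i, j⟩ • v p
      = g i • v ⟨i, j⟩ + if h : (j : ℕ) + 1 < r i then
          (if star i j = true then v ⟨i, ⟨j + 1, h⟩⟩ else 0) else 0 := by
  rw [Fintype.sum_sigma, Finset.sum_eq_single i]
  · simp only [Matrix.blockDiagonal'_apply_eq, flatJordan]
    rw [← Finset.add_sum_erase _ _ (Finset.mem_univ j), if_pos rfl]
    congr 1
    split_ifs with h h'
    · rw [Finset.sum_eq_single ⟨j + 1, h⟩]
      · rw [if_neg (by simp [Fin.ext_iff]), if_pos ⟨rfl, h'⟩, one_smul]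
      · intro k hk hne
        rw [if_neg (Finset.ne_of_mem_erase hk), if_neg fun h2 => hne (Fin.ext h2.1), zero_smul]
      · intro h2
        exact absurd (Finset.mem_erase.2 ⟨by simp [Fin.ext_iff], Finset.mem_univ _⟩) h2
    · refine Finset.sum_eq_zero fun k hk => ?_
      rw [if_neg (Finset.ne_of_mem_erase hk), if_neg fun h2 => h' h2.2, zero_smul]
    · refine Finset.sum_eq_zero fun k hk => ?_
      rw [if_neg (Finset.ne_of_mem_erase hk), if_neg fun h2 : (k : ℕ) = j + 1 ∧ _ => h (h2.1 ▸ k.2), zero_smul]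
  · intro k _ hk
    refine Finset.sum_eq_zero fun p _ => ?_
    rw [Matrix.blockDiagonal'_apply_ne _ _ _ hk, zero_smul]
  · simp

/-- Membership in a coordinate subspace is the vanishing of coordinates, and the map to `C((x_s))`
is injective on these. -/
theorem mem_span_image_of_one_tmul {ι : Type*} (b : Module.Basis ι C⸨X⸩ E) (X : Set ι) {e : E}
    (h : (1 : Ram C s) ⊗ₜ[C⸨X⸩] e ∈ (Submodule.span C⸨X⸩ (b '' X)).baseChange (Ram C s)) :
    e ∈ Submodule.span C⸨X⸩ (b '' X) := by
  have h1 : (Submodule.span C⸨X⸩ (b '' X)).baseChange (Ram C s)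
      = Submodule.span (Ram C s) (Algebra.TensorProduct.basis (Ram C s) b '' X) := by
    rw [Submodule.baseChange_span, Set.image_image]
    congr 1
    refine Set.image_congr fun i _ => ?_
    rw [Algebra.TensorProduct.basis_apply]
    rfl
  rw [h1, Module.Basis.mem_span_image] at h
  rw [Module.Basis.mem_span_image]
  refine fun i hi => h ?_
  rw [Finset.mem_coe, Finsupp.mem_support_iff] at hi ⊢
  rw [Algebra.TensorProduct.basis_repr_tmul]
  intro h0
  apply hi
  have h2 : algebraMap C⸨X⸩ (Ram C s) (b.repr e i) = 0 := by simpa using h0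
  simpa using h2

end LogDec

/-! ### Components of the regular singular part; existence and uniqueness. -/

namespace LogDec

variable {C : Type u} [Field C] [CharZero C] {E : Type w} [AddCommGroup E] [Module C E]
  [Module C⸨X⸩ E] [IsScalarTower C C⸨X⸩ E] {s : ℕ+}

namespace JordanBasis

variable {D : Connection C C⸨X⸩ E} (J : JordanBasis C D.toLin ({0} : Set C⸨X⸩))

theorem subEnd_nil_basis (x : (i : J.κ) × Fin (J.r i)) :
    D.subEnd J.nil (J.basis x) = algebraMap C C⸨X⸩ (J.a x.1) • J.basis x := by
  have h0 : J.f x.1 = 0 := J.f_mem x.1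
  rw [Connection.subEnd_apply, J.apply_eq, h0, add_zero, add_sub_cancel_right]

/-- If `S e = f e`, each nonzero coordinate of `e` has logarithmic derivative `f` minus the
eigenvalue of its basis vector, so that basis vector has the same type. -/
theorem isotypical_eq_span (ρ : C⸨X⸩ ⧸ dLog C C⸨X⸩) : isotypical (D.subEnd J.nil) ρ
    = Submodule.span C⸨X⸩ (J.basis '' {x | constClass (J.a x.1) = ρ}) := by
  apply le_antisymm
  · refine Submodule.span_le.2 ?_
    rintro e ⟨f, hf, he⟩
    rw [SetLike.mem_coe, Module.Basis.mem_span_image]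
    intro x hx
    rw [Finset.mem_coe, Finsupp.mem_support_iff] at hx
    have h1 := repr_shift_semisimple (D.subEnd J.nil).leibniz J.subEnd_nil_basis f e x
    rw [shift_apply, he, sub_self, map_zero, Finsupp.zero_apply, twist_apply] at h1
    rw [Set.mem_ofPred_eq, ← hf]
    refine QuotientAddGroup.eq.2 ⟨J.basis.repr e x, hx, ?_⟩
    rw [eq_inv_mul_iff_mul_eq₀ hx]
    linear_combination h1
  · refine Submodule.span_le.2 ?_
    rintro _ ⟨x, hx, rfl⟩
    exact Submodule.subset_span ⟨_, hx, J.subEnd_nil_basis x⟩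

theorem isJordanLevelt : IsJordanLevelt D (D.subEnd J.nil) J.nil where
  eq_add e := by rw [Connection.subEnd_apply]; abel
  semisimple := by
    refine ⟨1, Connection.isDiagonalizable_of_basis
      (Algebra.TensorProduct.basis (Ram C 1) J.basis)
      (g := fun x => algebraMap C⸨X⸩ (Ram C 1) (algebraMap C C⸨X⸩ (J.a x.1))) fun x => ?_⟩
    rw [Algebra.TensorProduct.basis_apply, Connection.baseChange_tmul, J.subEnd_nil_basis,
      Derivation.map_one_eq_zero, TensorProduct.zero_tmul, zero_add, TensorProduct.tmul_smul,
      algebraMap_smul (Ram C 1) (algebraMap C C⸨X⸩ (J.a x.1))]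
  nilpotent := J.isNilpotent_nil
  commute e := by
    have h : ∀ e, D (J.nil e) = J.nil (D e) := D.commute_of_basis J.nil J.basis fun x => by
      rw [J.apply_nil, J.apply_eq, map_add, map_smul]
    rw [Connection.subEnd_apply, Connection.subEnd_apply, map_sub, h]

open Classical in
/-- The types of the components of a connection with constant eigenvalues. -/
def types : Finset (C⸨X⸩ ⧸ dLog C C⸨X⸩) :=
  Finset.univ.image fun x : (i : J.κ) × Fin (J.r i) => constClass (J.a x.1)

theorem mem_types {ρ : C⸨X⸩ ⧸ dLog C C⸨X⸩} :
    ρ ∈ J.types ↔ ∃ x : (i : J.κ) × Fin (J.r i), constClass (J.a x.1) = ρ := by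
  simp [types]

theorem isTLJDecomposition :
    IsTLJDecomposition D J.types (isotypical (D.subEnd J.nil)) := by
  refine ⟨D.subEnd J.nil, J.nil, J.isJordanLevelt,
    Connection.isDiagonalizable_of_basis J.basis J.subEnd_nil_basis, fun _ => rfl, fun ρ => ?_,
    ?_, ?_⟩
  · rw [mem_types, isotypical_eq_span, Ne, Submodule.span_eq_bot]
    constructor
    · rintro ⟨x, hx⟩ h
      exact J.basis.ne_zero x (h _ ⟨x, hx, rfl⟩)
    · intro h
      push Not at h
      obtain ⟨_, ⟨x, hx, rfl⟩, -⟩ := h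
      exact ⟨x, hx⟩
  · intro ρ
    simp only [isotypical_eq_span]
    refine (J.basis.linearIndependent.disjoint_span_image (s := {x | constClass (J.a x.1) = ρ})
      (t := {x | constClass (J.a x.1) ≠ ρ})
      (Set.disjoint_left.2 fun x hx hx' => hx' hx)).mono_right ?_
    refine iSup₂_le fun ρ' hρ' => Submodule.span_mono (Set.image_mono fun x hx => ?_)
    rw [Set.mem_ofPred_eq] at hx ⊢
    rw [hx]
    exact fun h => hρ' (Subtype.ext h)
  · rw [eq_top_iff, ← J.basis.span_eq, Submodule.span_le]
    rintro _ ⟨x, rfl⟩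
    refine Submodule.mem_iSup_of_mem ⟨constClass (J.a x.1), J.mem_types.2 ⟨x, rfl⟩⟩ ?_
    rw [isotypical_eq_span]
    exact Submodule.subset_span ⟨x, rfl, rfl⟩

theorem ramComponent_eq_span (s : ℕ+) (c : C) :
    ramComponent s J.types (isotypical (D.subEnd J.nil)) (constClass c)
      = Submodule.span C⸨X⸩
        (J.basis '' {x | ∃ p : ℤ, J.a x.1 - c = ((s : ℕ) : C)⁻¹ * p}) := by
  have hs : ((s : ℕ) : C) ≠ 0 := by exact_mod_cast s.ne_zero
  apply le_antisymm
  · refine iSup₂_le fun ρ' hρ' => ?_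
    obtain ⟨-, k, hk⟩ := hρ'
    rw [isotypical_eq_span]
    refine Submodule.span_mono (Set.image_mono fun x hx => ?_)
    rw [Set.mem_ofPred_eq] at hx
    rw [← hx, constClass_sub, constClass_eq_iff] at hk
    obtain ⟨p, hp⟩ := hk
    refine ⟨k + (s : ℕ) * p, ?_⟩
    push_cast
    field_simp at hp ⊢
    linear_combination hp
  · refine Submodule.span_le.2 ?_
    rintro _ ⟨x, ⟨p, hp⟩, rfl⟩
    have hx : constClass (J.a x.1) ∈ {ρ' | ρ' ∈ J.types ∧
        ∃ k : ℤ, ρ' - constClass c = constClass ((k : C) / ((s : ℕ) : C))} :=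
      ⟨J.mem_types.2 ⟨x, rfl⟩, p, by rw [constClass_sub, hp, inv_mul_eq_div]⟩
    refine Submodule.mem_iSup_of_mem _ (Submodule.mem_iSup_of_mem hx ?_)
    rw [isotypical_eq_span]
    exact Submodule.subset_span ⟨x, rfl, rfl⟩

end JordanBasis

theorem le_ramComponent {types : Finset (C⸨X⸩ ⧸ dLog C C⸨X⸩)}
    (comp : (C⸨X⸩ ⧸ dLog C C⸨X⸩) → Submodule C⸨X⸩ E) {ρ : C⸨X⸩ ⧸ dLog C C⸨X⸩} (hρ : ρ ∈ types) :
    comp ρ ≤ ramComponent s types comp ρ := by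
  have h : ρ ∈ {ρ' | ρ' ∈ types ∧ ∃ k : ℤ, ρ' - ρ = constClass ((k : C) / ((s : ℕ) : C))} :=
    ⟨hρ, 0, by rw [sub_self, Int.cast_zero, zero_div, constClass, map_zero]; rfl⟩
  exact le_biSup comp h

namespace RamifiedForm

variable {D : Connection C C⸨X⸩ E} (R : RamifiedForm D s)

/-- Both sides are the span of the generalized eigenvectors of the regular singular part with
eigenvalues in `c + s⁻¹ ℤ`, computed in two Jordan bases. This is why the components must be grouped
modulo `s⁻¹ ℤ`. -/
theorem baseChange_ramComponent (c : C) :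
    (Submodule.span C⸨X⸩
      (R.J₀.basis '' {x | ∃ p : ℤ, R.J₀.a x.1 - c = ((s : ℕ) : C)⁻¹ * p})).baseChange (Ram C s)
    = Submodule.span (Ram C s)
      (R.J.basis '' {x | ∃ p : ℤ, R.J.a x.1 - c = ((s : ℕ) : C)⁻¹ * p}) := by
  have h1 := (R.J₀.baseChange s).genSpan_eq_span (isEulerDerivation_ram_zero C s)
    (R.rs.baseChange (Ram C s)).leibniz (fun _ => rfl) c
  have h2 := R.Jrs.genSpan_eq_span (isEulerDerivation_ram_zero C s)
    (R.rs.baseChange (Ram C s)).leibniz (fun _ => rfl) c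
  refine Eq.trans ?_ (h1.symm.trans h2)
  rw [Submodule.baseChange_span, Set.image_image]
  congr 1
  refine Set.image_congr fun x _ => ?_
  exact (Algebra.TensorProduct.basis_apply R.J₀.basis x).symm

theorem P_mem_ramComponent (c : C) {e : E} (he : e ∈ Submodule.span C⸨X⸩
      (R.J₀.basis '' {x | ∃ p : ℤ, R.J₀.a x.1 - c = ((s : ℕ) : C)⁻¹ * p})) :
    R.P e ∈ Submodule.span C⸨X⸩
      (R.J₀.basis '' {x | ∃ p : ℤ, R.J₀.a x.1 - c = ((s : ℕ) : C)⁻¹ * p}) := by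
  have h1 := Submodule.tmul_mem_baseChange_of_mem (1 : Ram C s) he
  refine mem_span_image_of_one_tmul (s := s) R.J₀.basis _ ?_
  rw [baseChange_ramComponent] at h1 ⊢
  rw [← LinearMap.baseChange_tmul, R.P_baseChange]
  generalize (1 : Ram C s) ⊗ₜ[C⸨X⸩] e = z at h1 ⊢
  induction h1 using Submodule.span_induction with
  | mem z hz =>
    obtain ⟨x, hx, rfl⟩ := hz
    rw [R.J.polar_basis]
    exact Submodule.smul_mem _ _ (Submodule.subset_span ⟨x, hx, rfl⟩)
  | zero => rw [map_zero]; exact Submodule.zero_mem _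
  | add x y _ _ hx hy => rw [map_add]; exact Submodule.add_mem _ hx hy
  | smul f x _ hx => rw [map_smul]; exact Submodule.smul_mem _ _ hx

theorem hasCommonFlatJordanForm (c : C) {F : Submodule C⸨X⸩ E}
    (hF : F = Submodule.span C⸨X⸩
      (R.J₀.basis '' {x | ∃ p : ℤ, R.J₀.a x.1 - c = ((s : ℕ) : C)⁻¹ * p})) :
    HasCommonFlatJordanForm s D R.rs F := by
  classical
  let I := {i : R.J.κ // ∃ p : ℤ, R.J.a i - c = ((s : ℕ) : C)⁻¹ * p}
  let e : Fin (Fintype.card I) ≃ I := (Fintype.equivFin I).symm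
  let r : Fin (Fintype.card I) → ℕ := fun i => R.J.r (e i)
  let ε : (i : Fin (Fintype.card I)) × Fin (r i) → (i : R.J.κ) × Fin (R.J.r i) :=
    fun x => ⟨e x.1, x.2⟩
  have hε : Function.Injective ε := by
    rintro ⟨i, j⟩ ⟨i', j'⟩ h
    have h1 : (e i : R.J.κ) = e i' := congrArg Sigma.fst h
    have h2 : i = i' := e.injective (Subtype.ext h1)
    subst h2
    have h3 : j = j' := by
      have := (Sigma.mk.inj h).2
      exact eq_of_heq this
    rw [h3]
  have hli : LinearIndependent (Ram C s) (R.J.basis ∘ ε) := R.J.basis.linearIndependent.comp ε hε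
  have hrange : Submodule.span (Ram C s) (Set.range (R.J.basis ∘ ε)) = F.baseChange (Ram C s) := by
    rw [hF, baseChange_ramComponent, Set.range_comp]
    congr 2
    ext x
    constructor
    · rintro ⟨y, rfl⟩
      exact (e y.1).2
    · intro hx
      refine ⟨⟨e.symm ⟨x.1, hx⟩, Fin.cast ?_ x.2⟩, ?_⟩
      · simp only [r, Equiv.apply_symm_apply]
      · simp only [ε]
        refine Sigma.ext ?_ ?_
        · simp only [Equiv.apply_symm_apply]
        · simp only
          rw [Fin.heq_ext_iff]
          · rfl
          · simp only [r, Equiv.apply_symm_apply]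
  let b := (Module.Basis.span hli).map (LinearEquiv.ofEq _ _ hrange)
  have hb : ∀ x, (b x : Ram C s ⊗[C⸨X⸩] E) = R.J.basis (ε x) := fun x => by
    rw [Module.Basis.map_apply, LinearEquiv.coe_ofEq_apply, Module.Basis.span_apply]
    rfl
  -- Constants in one class modulo `s⁻¹ ℤ` coincide by the choice of representatives recorded in
  -- `a_eq`; this common value is `c_ρ`.
  obtain ⟨t, ht⟩ : ∃ t, ∀ i : I, R.J.a i = t := by
    by_cases hI : Nonempty I
    · obtain ⟨i₀, q, hq⟩ := hI
      refine ⟨R.J.a i₀, fun i => ?_⟩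
      obtain ⟨i, p, hp⟩ := i
      refine R.a_eq i i₀ (p - q) ?_
      push_cast
      linear_combination hp - hq
    · exact ⟨0, fun i => (hI ⟨i⟩).elim⟩
  refine ⟨Fintype.card I, r, b, t, fun i => R.J.f (e i), fun _ _ => true,
    fun i => R.J.f_mem (e i), ?_, ?_⟩
  · rintro ⟨i, j⟩
    change R.rs.baseChange (Ram C s) (b ⟨i, j⟩ : Ram C s ⊗[C⸨X⸩] E) = _
    rw [sum_flatJordan_smul, hb]
    refine (R.Jrs.apply_basis (e i).1 j).trans ?_
    change (algebraMap C (Ram C s) (R.J.a (e i)) + 0) • _ + _ = _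
    rw [ht, add_zero]
    congr 1
    refine dite_congr rfl (fun h => ?_) fun h => rfl
    rw [if_pos rfl, hb]
    rfl
  · rintro ⟨i, j⟩
    change D.baseChange (Ram C s) (b ⟨i, j⟩ : Ram C s ⊗[C⸨X⸩] E) = _
    rw [sum_flatJordan_smul, hb]
    refine (R.J.apply_basis (e i) j).trans ?_
    rw [ht]
    congr 1
    refine dite_congr rfl (fun h => ?_) fun h => rfl
    rw [if_pos rfl, hb]

/-- A horizontal endomorphism preserves each generalized eigenspace, and on it `P` is multiplication
by the polar part of the eigenvalue. -/
theorem P_commute {φ : Module.End C⸨X⸩ E} (hφ : ∀ e, D (φ e) = φ (D e)) (e : E) :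
    R.P (φ e) = φ (R.P e) := by
  have h : R.P * φ = φ * R.P := by
    apply eq_of_baseChange_eq (s := s)
    refine R.J.basis.ext fun x => ?_
    rw [LinearMap.baseChange_mul, LinearMap.baseChange_mul, Module.End.mul_apply,
      Module.End.mul_apply, R.polar_of_mem_genEig (R.J.f_mem x.1)
        (map_mem_genEig (Connection.baseChange_commute (Ram C s) hφ) (R.J.basis_mem_genEig x)),
      R.P_baseChange, R.J.polar_basis, map_smul]
  exact LinearMap.congr_fun h e

theorem isDiagonalizableOver_P : IsDiagonalizableOver s R.P := by
  have hcard : Fintype.card ((i : R.J.κ) × Fin (R.J.r i)) = Module.finrank C⸨X⸩ E := by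
    rw [← Module.finrank_eq_card_basis R.J.basis, Module.finrank_baseChange]
  let e := Fintype.equivFinOfCardEq hcard
  refine ⟨R.J.basis.reindex e, fun i => R.J.f (e.symm i).1, fun i => ?_⟩
  rw [R.J.basis.reindex_apply, R.P_baseChange, R.J.polar_basis]

variable {L : Type v} [CommRing L] [Algebra C L] [Module.Finite C L]

theorem isLogDecomposition (α : L →ₐ[C] D.endAlgebra) : IsLogDecomposition s D α R.rs R.P where
  eq_add e := by rw [rs_apply]; abel
  regularSingular := R.J₀.isRegularSingular
  action a e := by
    have h : ∀ e, D ((α a : Module.End C⸨X⸩ E) e) = (α a : Module.End C⸨X⸩ E) (D e) := (α a).2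
    rw [rs_apply, rs_apply, map_sub, h, R.P_commute h]
  linear a e := by
    simp only [laurentAction, LinearMap.sum_apply, LinearMap.smul_apply, map_sum, map_smul]
    refine Finset.sum_congr rfl fun i _ => ?_
    congr 1
    exact R.P_commute (α (Module.finBasis C L i)).2 e
  diagonalizable := R.isDiagonalizableOver_P
  tlj := by
    refine ⟨R.J₀.types, _, R.J₀.isTLJDecomposition, fun ρ hρ => ?_, fun ρ hρ => ?_⟩
    · obtain ⟨x, hx⟩ := R.J₀.mem_types.1 hρ
      exact ⟨_, hx.symm⟩
    · obtain ⟨x, rfl⟩ := R.J₀.mem_types.1 hρ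
      have h := R.J₀.ramComponent_eq_span s (R.J₀.a x.1)
      refine ⟨fun e he => ?_, R.hasCommonFlatJordanForm _ h⟩
      rw [h] at he ⊢
      exact R.P_mem_ramComponent _ he

/-- The core of uniqueness: comparing the two matrices, `P` multiplies the `i`-th block by `f i`.
The block consists of generalized eigenvectors of `D` with eigenvalue `c + f i`, on which `R.P` acts
in the same way. -/
theorem baseChange_eq_of_hasCommonFlatJordanForm {Drs : Connection C C⸨X⸩ E}
    {P : Module.End C⸨X⸩ E} (hP : ∀ e, D e = Drs e + P e) {F : Submodule C⸨X⸩ E}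
    (hF : HasCommonFlatJordanForm s D Drs F) {e : E} (he : e ∈ F) : P e = R.P e := by
  obtain ⟨l, r, b, c, f, star, hf, hrs, hD⟩ := hF
  have hDb : ∀ i j, D.baseChange (Ram C s) (b ⟨i, j⟩ : Ram C s ⊗[C⸨X⸩] E)
      = (algebraMap C (Ram C s) c + f i) • (b ⟨i, j⟩ : Ram C s ⊗[C⸨X⸩] E)
        + if h : (j : ℕ) + 1 < r i then
          (if star i j = true then (b ⟨i, ⟨j + 1, h⟩⟩ : Ram C s ⊗[C⸨X⸩] E) else 0) else 0 := by
    intro i j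
    rw [hD ⟨i, j⟩, sum_flatJordan_smul]
  have hrsb : ∀ i j, Drs.baseChange (Ram C s) (b ⟨i, j⟩ : Ram C s ⊗[C⸨X⸩] E)
      = algebraMap C (Ram C s) c • (b ⟨i, j⟩ : Ram C s ⊗[C⸨X⸩] E)
        + if h : (j : ℕ) + 1 < r i then
          (if star i j = true then (b ⟨i, ⟨j + 1, h⟩⟩ : Ram C s ⊗[C⸨X⸩] E) else 0) else 0 := by
    intro i j
    rw [hrs ⟨i, j⟩, sum_flatJordan_smul]
  have hPb : ∀ x, P.baseChange (Ram C s) (b x : Ram C s ⊗[C⸨X⸩] E)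
      = f x.1 • (b x : Ram C s ⊗[C⸨X⸩] E) := by
    rintro ⟨i, j⟩
    have h1 : Drs = D.subEnd P := Connection.ext_apply fun e => by
      rw [Connection.subEnd_apply, hP]; abel
    have h2 := Connection.baseChange_subEnd (Ram C s) D P (b ⟨i, j⟩ : Ram C s ⊗[C⸨X⸩] E)
    rw [← h1, hDb, hrsb, add_smul] at h2
    rw [eq_sub_iff_add_eq] at h2
    refine add_left_cancel (a := algebraMap C (Ram C s) c • (b ⟨i, j⟩ : Ram C s ⊗[C⸨X⸩] E)
        + if h : (j : ℕ) + 1 < r i then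
          (if star i j = true then (b ⟨i, ⟨j + 1, h⟩⟩ : Ram C s ⊗[C⸨X⸩] E) else 0) else 0) ?_
    rw [h2]
    abel
  -- Induction from the end of a block: `D - c - f i` sends a vector to the next one or to `0`,
  -- whatever the subdiagonal entries are.
  have hgen : ∀ (m : ℕ) i (j : Fin (r i)), r i ≤ j + m → (b ⟨i, j⟩ : Ram C s ⊗[C⸨X⸩] E) ∈
      genEig (D.baseChange (Ram C s)).toLin (algebraMap C (Ram C s) c + f i) := by
    intro m
    induction m with
    | zero => intro i j h; have := j.2; omega
    | succ m ih =>
      intro i j h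
      refine mem_genEig_of_shift_mem ?_
      rw [shift_apply, hDb, add_sub_cancel_left]
      split_ifs with h1 h2
      · exact ih i _ (by simp only; omega)
      · exact Submodule.zero_mem _
      · exact Submodule.zero_mem _
  have hker : ∀ z ∈ F.baseChange (Ram C s),
      P.baseChange (Ram C s) z = R.P.baseChange (Ram C s) z := by
    intro z hz
    have h1 := congrArg (Subtype.val) (b.sum_repr ⟨z, hz⟩)
    rw [AddSubmonoidClass.coe_finsetSum] at h1
    rw [show z = _ from h1.symm, map_sum, map_sum]
    refine Finset.sum_congr rfl fun x _ => ?_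
    rw [Submodule.coe_smul, map_smul, map_smul, hPb,
      R.polar_of_mem_genEig (hf x.1) (hgen (r x.1) x.1 x.2 (Nat.le_add_left _ _))]
  have h1 := hker _ (Submodule.tmul_mem_baseChange_of_mem (1 : Ram C s) he)
  rw [LinearMap.baseChange_tmul, LinearMap.baseChange_tmul, ← sub_eq_zero,
    ← TensorProduct.tmul_sub] at h1
  exact sub_eq_zero.1 (one_tmul_injective (C := C) s h1)

theorem eq_of_isLogDecomposition {α : L →ₐ[C] D.endAlgebra} {Drs : Connection C C⸨X⸩ E}
    {P : Module.End C⸨X⸩ E} (h : IsLogDecomposition s D α Drs P) : Drs = R.rs ∧ P = R.P := by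
  obtain ⟨types, comp, ⟨-, -, -, -, -, -, -, htop⟩, -, hρ⟩ := h.tlj
  have hP : P = R.P := by
    have h1 : ⨆ ρ : types, comp ρ ≤ LinearMap.ker (P - R.P) := by
      refine iSup_le fun ρ e he => ?_
      rw [LinearMap.mem_ker, LinearMap.sub_apply, sub_eq_zero]
      exact R.baseChange_eq_of_hasCommonFlatJordanForm h.eq_add (hρ ρ ρ.2).2
        (le_ramComponent comp ρ.2 he)
    rw [htop, top_le_iff, LinearMap.ker_eq_top, sub_eq_zero] at h1
    exact h1
  refine ⟨Connection.ext_apply fun e => ?_, hP⟩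
  rw [rs_apply, h.eq_add, hP]
  abel

end RamifiedForm

end LogDec

end

open LogDec in
theorem theorem3p4 {C : Type u} [Field C] [IsAlgClosed C] [CharZero C]
    {L : Type v} [CommRing L] [IsLocalRing L] [Algebra C L] [Module.Finite C L]
    {E : Type w} [AddCommGroup E] [Module C E] [Module C⸨X⸩ E] [IsScalarTower C C⸨X⸩ E]
    [Module.Finite C⸨X⸩ E]
    (D : Connection C C⸨X⸩ E) (α : L →ₐ[C] D.endAlgebra) :
    (∃ s : ℕ+, IsTurrittinIndex D s) ∧
    ∀ s : ℕ+, IsTurrittinIndex D s →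
      ∃! d : Connection C C⸨X⸩ E × Module.End C⸨X⸩ E,
        IsLogDecomposition s D α d.1 d.2 := by
  constructor
  · obtain ⟨s, hs⟩ := exists_genSpan_baseChange_eq_top D
    obtain ⟨R⟩ := exists_ramifiedForm hs
    exact R.exists_isTurrittinIndex
  · intro s hs
    -- The form is built over `C((x_s))` for the Turrittin index `s` itself, not for the possibly
    -- larger ramification used to prove that the index exists.
    obtain ⟨R⟩ := exists_ramifiedForm (genSpan_eq_top_of_isTurrittinIndex hs)
    refine ⟨(R.rs, R.P), R.isLogDecomposition α, ?_⟩
    rintro ⟨Drs, P⟩ h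
    obtain ⟨h1, h2⟩ := R.eq_of_isLogDecomposition h
    exact Prod.ext h1 h2
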